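/- Let $P$ be a simple polygon in the plane, regarded as a closed region with boundary curve $\partial P$ traversed in a fixed direction. For $x,y\in P$ let $d(x,y)$ be the geodesic distance, i.e. the length of the shortest path (geodesic) $\pi(x,y)$ from $x$ to $y$ inside $P$. A chord of $P$ is a line segment $h=pq$ with $p\neq q$, contained in $P$ and with both endpoints on $\partial P$; the half-polygon $H$ with defining chord $h=pq$ is the closed (weakly simple) region bounded by $h$ and the path along $\partial P$ from $p$ to $q$ in the fixed direction. Let $d(x,H)=\min_{y\in H} d(x,y)$. Then for every half-polygon $H$ of $P$: 1. The function $x\mapsto d(x,H)$ is geodesically convex: for all $a,b\in P$, on the geodesic $\pi(a,b)$ the value $d(x,H)$ is a convex function of $d(a,x)\in[0,d(a,b)]$. 2. If $a,b\in P\setminus H$, then the set of points of $\pi(a,b)$ at which $d(\cdot,H)$ attains its minimum over $\pi(a,b)$ is either a single point or a line segment parallel to $h$. -/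

import Mathlib

open Set
open scoped ENNReal

/-- The Euclidean plane. -/
abbrev Plane : Type := EuclideanSpace ℝ (Fin 2)

/-- The set `K` together with everything it encloses, i.e. with all bounded connected components
of its complement. -/
def enclosed (K : Set Plane) : Set Plane :=
  K ∪ {x | Bornology.IsBounded (connectedComponentIn Kᶜ x)}

/-- The closed polygonal curve through the vertices of a polygon, in their given cyclic order, as an
`n`-periodic function: for an integer `i`, the interval `[i, i + 1]` is mapped affinely onto the
edge from vertex `i mod n` to the next one. -/
noncomputable def boundaryCurve {n : ℕ} [NeZero n] (poly : Polygon Plane n) (t : ℝ) : Plane :=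
  poly.edgePath ℝ (Fin.ofNat n (⌊t⌋ % (n : ℤ)).toNat) (Int.fract t)

/-- A simple polygon: its closed boundary curve does not pass twice through any point.
(This forces `3 ≤ n`. Both orientations of the boundary are allowed.) -/
structure SimplePolygon (n : ℕ) [NeZero n] where
  /-- The cyclic sequence of vertices. -/
  poly : Polygon Plane n
  simple : InjOn (boundaryCurve poly) (Ico 0 (n : ℝ))

/-- The closed region of the plane bounded by a simple polygon (boundary and interior). -/
def SimplePolygon.region {n : ℕ} [NeZero n] (P : SimplePolygon n) : Set Plane :=
  enclosed (P.poly.boundary ℝ)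

/-- A half-polygon of `P`, given by its defining chord. The chord is a nondegenerate segment inside
`P` from a boundary point `p`, at parameter `s`, to a boundary point `q`, at parameter `t`. The
boundary path from `p` to `q` in the direction of the boundary is traversed over `[s, t]`. -/
structure HalfPolygon {n : ℕ} [NeZero n] (P : SimplePolygon n) where
  s : ℝ
  t : ℝ
  s_lt_t : s < t
  t_lt : t < s + n
  chord_subset :
    segment ℝ (boundaryCurve P.poly s) (boundaryCurve P.poly t) ⊆ P.region

namespace HalfPolygon

/-- First endpoint of the defining chord. -/
noncomputable def p {n : ℕ} [NeZero n] {P : SimplePolygon n} (H : HalfPolygon P) : Plane :=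
  boundaryCurve P.poly H.s

/-- Second endpoint of the defining chord. -/
noncomputable def q {n : ℕ} [NeZero n] {P : SimplePolygon n} (H : HalfPolygon P) : Plane :=
  boundaryCurve P.poly H.t

/-- The defining chord. -/
noncomputable def chord {n : ℕ} [NeZero n] {P : SimplePolygon n} (H : HalfPolygon P) : Set Plane :=
  segment ℝ H.p H.q

/-- The half-polygon as a closed set: the (possibly only weakly simple) closed curve made of the
boundary path from `p` to `q` and the chord, with everything that this curve encloses. -/
noncomputable def region {n : ℕ} [NeZero n] {P : SimplePolygon n} (H : HalfPolygon P) :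
    Set Plane :=
  enclosed (boundaryCurve P.poly '' Icc H.s H.t ∪ H.chord)

end HalfPolygon

/-- The length of a path in the plane. -/
noncomputable def pathLength {a b : Plane} (γ : Path a b) : ℝ≥0∞ :=
  eVariationOn γ univ

/-- `γ` is a shortest path (a geodesic) from `a` to `b` inside `X`. -/
def IsShortestPath (X : Set Plane) {a b : Plane} (γ : Path a b) : Prop :=
  range γ ⊆ X ∧ ∀ γ' : Path a b, range γ' ⊆ X → pathLength γ ≤ pathLength γ'

/-- Geodesic distance in `X`, as an extended number: the infimum of the lengths of the paths
inside `X`. -/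
noncomputable def geodEDist (X : Set Plane) (x y : Plane) : ℝ≥0∞ :=
  ⨅ (γ : Path x y) (_ : range γ ⊆ X), pathLength γ

/-- Geodesic distance `d(x, y)` in `X`. -/
noncomputable def geodDist (X : Set Plane) (x y : Plane) : ℝ :=
  (geodEDist X x y).toReal

/-- Geodesic distance `d(x, H)` in `X` from a point `x` to a set `H`. -/
noncomputable def geodDistTo (X H : Set Plane) (x : Plane) : ℝ :=
  (⨅ y ∈ H, geodEDist X x y).toReal

/-- `f` is geodesically convex on `X`: on every geodesic of `X`, say from `a` to `b`, the value
`f x` is a convex function of `d(a, x)`. -/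
def GeodesicallyConvexOn (X : Set Plane) (f : Plane → ℝ) : Prop :=
  ∀ a ∈ X, ∀ b ∈ X, ∀ γ : Path a b, IsShortestPath X γ →
    ∃ g : ℝ → ℝ, ConvexOn ℝ (Icc 0 (geodDist X a b)) g ∧
      ∀ x ∈ range γ, f x = g (geodDist X a x)

/-!
Write `K` for the polygon, `h` for the chord and `d` for the geodesic distance in `K`. Outside the
half-polygon, the distance to it is the distance to `h`, so the subject is the function
`f x = d(x, h)` along a geodesic.

**Topology.** What is used about `K` is collected in `IsTame`: `K` is compact and connected, it looks
like a cone near each of its points, and for each `z ∉ K` there is a continuous logarithm of `x - z`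
on `K`, which expresses that `K` has no holes. The last property characterizes the points that are
not enclosed by a compact set (`notMem_enclosed_iff`). Since logarithms on two sets with connected
intersection can be glued, an arc encloses nothing, and the chord cuts the polygon into the
half-polygon and a closed complement that meet exactly in the chord
(`HalfPolygon.exists_complement`).

**Obstructed angles.** Geodesics are straight near each of their points, on either side. Let a linear
functional take its maximum over a closed curve in `K` at a point `v` where the curve forms an
angle. Then this angle contains no points of the complement of `K` near `v`
(`IsTame.free_of_max`): the ray from such a point through `v` would cross the curve just once, so the
curve would wind around the point. A geodesic does not bend at a free angle; hence the maximum of a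
functional over a geodesic triangle or quadrilateral is found at its corners
(`IsQuad.exists_max_corner`).

**Comparison of directions.** Let the segment from `x₁` to `x₂ = x₁ + L w` lie in `K` and miss `h`, and
let `u₁`, `u₂` be the initial directions of shortest geodesics from `x₁`, `x₂` to `h`. The geodesics
and the segment bound a geodesic triangle, or a quadrilateral with a part of `h`. Evaluating
functionals at the corners shows `⟪w, u₂⟫ ≤ ⟪w, u₁⟫` when the base angles are free, and that
an obstructed base angle can only occur if the other geodesic runs along the segment. In terms of
`distSlope`, the one-sided slope of `f` predicted by first variation, this says that the
slopes at the two ends, each taken towards the other end, add up to at most zero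
(`IsClosest.distSlope_add_le`). In the equality case with vanishing slopes the base is parallel
to `h`.

**Convexity.** First variation bounds `f` from above, to first order, by its slope
(`IsClosest.geodDistTo_le`), and by the comparison the slope at one end of a segment therefore
bounds `f` from below on the whole segment (`IsClosest.le_geodDistTo`). At a bend of a
geodesic the angle on one side is obstructed, so the two slopes still support a convex function
(`IsGeodesic.distSlope_add_nonneg`). So `f` has local affine supports along each geodesic and
is convex. Where `f` is constant and positive along a geodesic, the slopes vanish and the geodesic
is parallel to `h`; where it vanishes, the geodesic runs from `h` to `h` and hence inside `h`.
-/

/-! ### Logarithms and enclosed points -/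

/-- The plane read as the complex plane. -/
noncomputable def planeToComplex (x : Plane) : ℂ := ⟨x 0, x 1⟩

lemma continuous_planeToComplex : Continuous planeToComplex := by
  have : planeToComplex = fun x : Plane => ((x 0 : ℝ) : ℂ) + ((x 1 : ℝ) : ℂ) * Complex.I := by
    funext x; apply Complex.ext <;> simp [planeToComplex]
  rw [this]; fun_prop

lemma planeToComplex_sub (x y : Plane) :
    planeToComplex (x - y) = planeToComplex x - planeToComplex y := by
  apply Complex.ext <;> simp [planeToComplex]

lemma norm_planeToComplex (x : Plane) : ‖planeToComplex x‖ = ‖x‖ := by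
  rw [EuclideanSpace.norm_eq, Fin.sum_univ_two, Complex.norm_eq_sqrt_sq_add_sq]
  simp [planeToComplex]

lemma planeToComplex_sub_ne_zero {x y : Plane} (h : x ≠ y) :
    planeToComplex x - planeToComplex y ≠ 0 := by
  rw [← planeToComplex_sub, ← norm_ne_zero_iff, norm_planeToComplex, norm_ne_zero_iff]
  exact sub_ne_zero.2 h

/-- The function `x ↦ x - z` has a continuous logarithm on `X`: no closed curve in `X` winds
around `z`. -/
def HasLog (X : Set Plane) (z : Plane) : Prop :=
  ∃ L : Plane → ℂ, ContinuousOn L X ∧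
    ∀ x ∈ X, Complex.exp (L x) = planeToComplex x - planeToComplex z

lemma HasLog.mono {X Y : Set Plane} {z : Plane} (h : HasLog Y z) (hXY : X ⊆ Y) : HasLog X z := by
  obtain ⟨L, hL, hexp⟩ := h
  exact ⟨L, hL.mono hXY, fun x hx => hexp x (hXY hx)⟩

lemma HasLog.notMem {X : Set Plane} {z : Plane} (h : HasLog X z) : z ∉ X := by
  obtain ⟨L, -, hexp⟩ := h
  intro hz
  have := hexp z hz
  rw [sub_self] at this
  exact Complex.exp_ne_zero _ this

/-- A logarithm of `x - z` gives one of `x - w` if `w` is closer to `z` than `X` is, since then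
`(x - w) / (x - z)` stays in the right half-plane. -/
lemma HasLog.of_near {X : Set Plane} {z w : Plane} (h : HasLog X z)
    (hw : ∀ x ∈ X, ‖w - z‖ < ‖x - z‖) : HasLog X w := by
  obtain ⟨L, hL, hexp⟩ := h
  have hne : ∀ x ∈ X, planeToComplex x - planeToComplex z ≠ 0 := fun x hx => by
    rw [← hexp x hx]; exact Complex.exp_ne_zero _
  have hslit : ∀ x ∈ X, (planeToComplex x - planeToComplex w) /
      (planeToComplex x - planeToComplex z) ∈ Complex.slitPlane := by
    intro x hx
    have h1 : (planeToComplex x - planeToComplex w) / (planeToComplex x - planeToComplex z) =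
        1 + -((planeToComplex w - planeToComplex z) / (planeToComplex x - planeToComplex z)) := by
      have := hne x hx
      field_simp; ring
    rw [h1]
    apply Complex.mem_slitPlane_of_norm_lt_one
    rw [norm_neg, norm_div, ← planeToComplex_sub, ← planeToComplex_sub, norm_planeToComplex,
      norm_planeToComplex, div_lt_one ((norm_nonneg _).trans_lt (hw x hx))]
    exact hw x hx
  refine ⟨fun x => L x + Complex.log ((planeToComplex x - planeToComplex w) /
      (planeToComplex x - planeToComplex z)), ?_, ?_⟩
  · refine hL.add (ContinuousOn.clog ?_ hslit)
    refine ContinuousOn.div ?_ ?_ hne <;>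
    exact (continuous_planeToComplex.sub continuous_const).continuousOn
  · intro x hx
    rw [Complex.exp_add, hexp x hx, Complex.exp_log (Complex.slitPlane_ne_zero (hslit x hx))]
    rw [mul_div_cancel₀ _ (hne x hx)]

lemma isOpen_setOf_hasLog {X : Set Plane} (hX : IsCompact X) : IsOpen {z | HasLog X z} := by
  rw [Metric.isOpen_iff]
  intro z hz
  obtain ⟨ε, hε, hball⟩ := Metric.isOpen_iff.1 hX.isClosed.isOpen_compl z hz.notMem
  refine ⟨ε, hε, fun w hw => hz.of_near fun x hx => ?_⟩
  rw [← dist_eq_norm, ← dist_eq_norm]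
  refine (Metric.mem_ball.1 hw).trans_le ?_
  by_contra! h
  exact hball (Metric.mem_ball.2 h) hx

lemma isOpen_setOf_not_hasLog {X : Set Plane} (hX : IsCompact X) :
    IsOpen {z | z ∉ X ∧ ¬ HasLog X z} := by
  rw [Metric.isOpen_iff]
  rintro z ⟨hzX, hz⟩
  obtain ⟨ε, hε, hball⟩ := Metric.isOpen_iff.1 hX.isClosed.isOpen_compl z hzX
  have key : ∀ x ∈ X, ε ≤ dist x z := fun x hx => by
    by_contra! h
    exact hball (Metric.mem_ball.2 h) hx
  refine ⟨ε / 2, half_pos hε, fun w hw => ?_⟩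
  rw [Metric.mem_ball] at hw
  refine ⟨fun h => ?_, fun h => hz (h.of_near fun x hx => ?_)⟩
  · linarith [key w h]
  · rw [← dist_eq_norm, ← dist_eq_norm, dist_comm z w]
    linarith [key x hx, dist_triangle x w z]

lemma HasLog.of_isPreconnected {X C : Set Plane} (hX : IsCompact X) (hC : IsPreconnected C)
    (hCX : C ⊆ Xᶜ) {z w : Plane} (hz : z ∈ C) (hw : w ∈ C) (h : HasLog X z) : HasLog X w := by
  by_contra hn
  obtain ⟨y, -, hy1, hy2⟩ := hC _ _ (isOpen_setOf_hasLog hX) (isOpen_setOf_not_hasLog hX)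
    (fun y hy => by
      by_cases h' : HasLog X y
      · exact Or.inl h'
      · exact Or.inr ⟨hCX hy, h'⟩) ⟨z, hz, h⟩ ⟨w, hw, hCX hw, hn⟩
  exact hy2.2 hy1

/-- Far away from a bounded set `X`, the principal logarithm provides a logarithm of `x - z`. -/
lemma exists_hasLog_of_bounded {X : Set Plane} (hX : Bornology.IsBounded X) :
    ∃ R : ℝ, ∀ z : Plane, R < ‖z‖ → HasLog X z := by
  obtain ⟨R, hR⟩ := hX.exists_norm_le
  refine ⟨R, fun z hz => ?_⟩
  have hz0 : ∀ x ∈ X, ‖planeToComplex x / planeToComplex z‖ < 1 := by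
    intro x hx
    have := hR x hx
    rw [norm_div, norm_planeToComplex, norm_planeToComplex,
      div_lt_one (((norm_nonneg x).trans this).trans_lt hz)]
    linarith
  by_cases hne : planeToComplex z = 0
  · have hz' : ‖z‖ = 0 := by rw [← norm_planeToComplex, hne, norm_zero]
    refine ⟨0, continuousOn_const, fun x hx => ?_⟩
    have := hR x hx
    linarith [norm_nonneg x]
  have hslit : ∀ x ∈ X, 1 + -(planeToComplex x / planeToComplex z) ∈ Complex.slitPlane :=
    fun x hx => Complex.mem_slitPlane_of_norm_lt_one (by rw [norm_neg]; exact hz0 x hx)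
  refine ⟨fun x => Complex.log (-planeToComplex z) +
    Complex.log (1 + -(planeToComplex x / planeToComplex z)), ?_, ?_⟩
  · refine continuousOn_const.add (ContinuousOn.clog ?_ hslit)
    exact (continuous_const.add (continuous_planeToComplex.div_const _).neg).continuousOn
  · intro x hx
    rw [Complex.exp_add, Complex.exp_log (neg_ne_zero.2 hne),
      Complex.exp_log (Complex.slitPlane_ne_zero (hslit x hx))]
    field_simp
    ring

lemma subset_enclosed (X : Set Plane) : X ⊆ enclosed X := subset_union_left

lemma HasLog.of_notMem_enclosed {X : Set Plane} (hX : IsCompact X) {z : Plane}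
    (hz : z ∉ enclosed X) : HasLog X z := by
  have hzX : z ∉ X := fun h => hz (Or.inl h)
  have hub : ¬ Bornology.IsBounded (connectedComponentIn Xᶜ z) := fun h => hz (Or.inr h)
  obtain ⟨R, hR⟩ := exists_hasLog_of_bounded hX.isBounded
  rw [isBounded_iff_forall_norm_le] at hub
  push Not at hub
  obtain ⟨w, hw, hRw⟩ := hub R
  exact (hR w hRw).of_isPreconnected hX isPreconnected_connectedComponentIn
    (connectedComponentIn_subset _ _) hw (mem_connectedComponentIn hzX)

/-- A nonvanishing continuous function on a simply connected space has a logarithm. -/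
lemma exists_continuous_log {T : Type*} [TopologicalSpace T] [SimplyConnectedSpace T]
    [LocallyPathConnectedSpace T] (G : T → ℂ) (hG : Continuous G) (h0 : ∀ x, G x ≠ 0) :
    ∃ L : T → ℂ, Continuous L ∧ ∀ x, Complex.exp (L x) = G x := by
  obtain ⟨a⟩ : Nonempty T := inferInstance
  obtain ⟨F, ⟨-, hF⟩, -⟩ := Complex.isCoveringMap_exp.existsUnique_continuousMap_lifts
    ⟨fun x => (⟨G x, h0 x⟩ : {z : ℂ // z ≠ 0}), by fun_prop⟩ a (Complex.log (G a))
    (Subtype.ext (Complex.exp_log (h0 a)))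
  refine ⟨F, F.continuous, fun x => ?_⟩
  exact congrArg Subtype.val (congrFun hF x)

/-- Two logarithms of the same function on a preconnected set differ by a constant. -/
lemma log_sub_log_const {T : Type*} [TopologicalSpace T] {C : Set T} (hC : IsPreconnected C)
    {L M : T → ℂ} (hL : ContinuousOn L C) (hM : ContinuousOn M C)
    (h : ∀ x ∈ C, Complex.exp (L x) = Complex.exp (M x)) {x y : T} (hx : x ∈ C) (hy : y ∈ C) :
    L x - M x = L y - M y := by
  have hint : ∀ x ∈ C, ∃ n : ℤ, L x - M x = n * (2 * Real.pi * Complex.I) := by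
    intro x hx
    obtain ⟨n, hn⟩ := Complex.exp_eq_exp_iff_exists_int.1 (h x hx)
    exact ⟨n, by rw [hn]; ring⟩
  have hpi : (2 * Real.pi * Complex.I : ℂ) ≠ 0 := Complex.two_pi_I_ne_zero
  have hdisc : IsDiscrete (range ((↑) : ℤ → ℝ)) :=
    ⟨Int.isClosedEmbedding_coe_real.toIsEmbedding.toHomeomorph.symm.isEmbedding.discreteTopology⟩
  have hval : ∀ x ∈ C, ∃ n : ℤ, (L x - M x) / (2 * Real.pi * Complex.I) = (n : ℂ) := by
    intro x hx
    obtain ⟨n, hn⟩ := hint x hx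
    exact ⟨n, by rw [hn, mul_div_cancel_right₀ _ hpi]⟩
  have hconst := hC.constant_of_mapsTo hdisc
    (f := fun x => ((L x - M x) / (2 * Real.pi * Complex.I)).re)
    (Complex.continuous_re.comp_continuousOn ((hL.sub hM).div_const _))
    (fun x hx => by
      obtain ⟨n, hn⟩ := hval x hx
      exact ⟨n, by simp only [hn, Complex.intCast_re]⟩) hx hy
  obtain ⟨n, hn⟩ := hval x hx
  obtain ⟨m, hm⟩ := hval y hy
  simp only [hn, hm, Complex.intCast_re] at hconst
  have : (L x - M x) / (2 * Real.pi * Complex.I) = (L y - M y) / (2 * Real.pi * Complex.I) := by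
    rw [hn, hm]; exact_mod_cast hconst
  exact (div_left_inj' hpi).1 this

lemma frontier_connectedComponentIn_subset {X : Set Plane} (hX : IsClosed X) (z : Plane) :
    frontier (connectedComponentIn Xᶜ z) ⊆ X := by
  intro y hy
  by_contra hyX
  have hopen : IsOpen (connectedComponentIn Xᶜ z) := hX.isOpen_compl.connectedComponentIn
  rw [hopen.frontier_eq] at hy
  by_cases hz : z ∈ Xᶜ
  · have hpre : IsPreconnected (insert y (connectedComponentIn Xᶜ z)) :=
      isPreconnected_connectedComponentIn.subset_closure (subset_insert _ _)
        (insert_subset hy.1 subset_closure)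
    exact hy.2 (hpre.subset_connectedComponentIn (mem_insert_of_mem _ (mem_connectedComponentIn hz))
      (insert_subset hyX (connectedComponentIn_subset _ _)) (mem_insert _ _))
  · rw [connectedComponentIn_eq_empty hz] at hy
    simp at hy

/-- The identity of a circle is not homotopic to a constant among nonvanishing functions: a
function equal to `x - z` far away must vanish somewhere. -/
lemma exists_zero_of_eq_sub {G : Plane → ℂ} (hG : Continuous G) {z : Plane} {R : ℝ} (hR : 0 < R)
    (h : ∀ x, ‖x - z‖ = R → G x = planeToComplex x - planeToComplex z) : ∃ x, G x = 0 := by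
  by_contra! h0
  obtain ⟨L, hL, hexp⟩ := exists_continuous_log G hG h0
  set c : ℝ → Plane := fun φ => z + !₂[R * Real.cos φ, R * Real.sin φ] with hc
  have hcont : Continuous c := by
    refine continuous_const.add ((PiLp.continuous_toLp 2 _).comp (continuous_pi fun i => ?_))
    fin_cases i
    · exact continuous_const.mul Real.continuous_cos
    · exact continuous_const.mul Real.continuous_sin
  have hval : ∀ φ, G (c φ) = R * Complex.exp (φ * Complex.I) := by
    intro φ
    have h1 : planeToComplex (c φ - z) = R * Complex.exp (φ * Complex.I) := by
      rw [Complex.exp_mul_I, ← Complex.ofReal_cos, ← Complex.ofReal_sin]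
      apply Complex.ext <;> simp [planeToComplex, hc, Complex.cos_ofReal_re, Complex.sin_ofReal_re]
    rw [h, ← planeToComplex_sub, h1]
    rw [← norm_planeToComplex, h1, norm_mul, Complex.norm_exp_ofReal_mul_I]
    simp [abs_of_pos hR]
  have := log_sub_log_const (T := ℝ) isPreconnected_univ (L := fun φ => L (c φ))
    (M := fun φ => (Real.log R : ℂ) + φ * Complex.I) (hL.comp hcont).continuousOn
    (by fun_prop) (fun φ _ => by
      rw [hexp, hval, Complex.exp_add, ← Complex.ofReal_exp, Real.exp_log hR])
    (mem_univ 0) (mem_univ (2 * Real.pi))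
  have hcc : c (2 * Real.pi) = c 0 := by simp [hc]
  rw [hcc] at this
  have h2 : ((2 * Real.pi : ℝ) : ℂ) * Complex.I = 0 := by
    have h3 : ((0 : ℝ) : ℂ) = 0 := Complex.ofReal_zero
    linear_combination this + Complex.I * h3
  simp [Real.pi_ne_zero] at h2

/-- If `x - z` has a logarithm on `X`, then `z` is not enclosed by `X`. Otherwise the exponential of
an extension of the logarithm, on the component of `z`, and `x - z`, elsewhere, would fit together
to a function without zeros which contradicts `exists_zero_of_eq_sub`. -/
lemma HasLog.notMem_enclosed {X : Set Plane} (hX : IsCompact X) {z : Plane} (h : HasLog X z) :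
    z ∉ enclosed X := by
  classical
  rintro (hz | hz)
  · exact h.notMem hz
  obtain ⟨L, hL, hexp⟩ := id h
  obtain ⟨M, hM⟩ := ContinuousMap.exists_restrict_eq hX.isClosed
    (⟨X.domRestrict L, continuousOn_iff_continuous_domRestrict.1 hL⟩ : C(X, ℂ))
  have hML : ∀ x ∈ X, M x = L x := fun x hx => by
    have := DFunLike.congr_fun hM ⟨x, hx⟩
    exact this
  have hzX : z ∈ Xᶜ := h.notMem
  set U := connectedComponentIn Xᶜ z with hU
  have hzU : z ∈ U := mem_connectedComponentIn hzX
  set G : Plane → ℂ := U.piecewise (fun x => Complex.exp (M x))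
    (fun x => planeToComplex x - planeToComplex z) with hGdef
  have hG : Continuous G := by
    refine Continuous.piecewise ?_ (by fun_prop)
      (continuous_planeToComplex.sub continuous_const)
    intro x hx
    have hxX := frontier_connectedComponentIn_subset hX.isClosed z hx
    rw [hML x hxX, hexp x hxX]
  obtain ⟨R, hR⟩ := (show Bornology.IsBounded U from hz).exists_norm_le
  have hR0 : 0 ≤ R := (norm_nonneg z).trans (hR z hzU)
  obtain ⟨x, hx⟩ := exists_zero_of_eq_sub hG (z := z) (R := 2 * R + 1) (by linarith)
    (fun x hx => by
      have hxU : x ∉ U := fun hxU => by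
        have := norm_sub_le x z
        linarith [hR x hxU, hR z hzU]
      simp only [hGdef, piecewise_eq_of_notMem _ _ _ hxU])
  by_cases hxU : x ∈ U
  · simp only [hGdef, piecewise_eq_of_mem _ _ _ hxU] at hx
    exact Complex.exp_ne_zero _ hx
  · simp only [hGdef, piecewise_eq_of_notMem _ _ _ hxU] at hx
    exact planeToComplex_sub_ne_zero (fun h => hxU (by rw [h]; exact hzU)) hx

lemma notMem_enclosed_iff {X : Set Plane} (hX : IsCompact X) {z : Plane} :
    z ∉ enclosed X ↔ HasLog X z :=
  ⟨HasLog.of_notMem_enclosed hX, HasLog.notMem_enclosed hX⟩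

/-- Janiszewski's theorem: a point enclosed neither by `X` nor by `Y` is not enclosed by `X ∪ Y`
if `X ∩ Y` is connected. -/
lemma HasLog.union {X Y : Set Plane} (hX : IsClosed X) (hY : IsClosed Y)
    (hXY : IsPreconnected (X ∩ Y)) {z : Plane} (h1 : HasLog X z) (h2 : HasLog Y z) :
    HasLog (X ∪ Y) z := by
  classical
  obtain ⟨L, hL, hLe⟩ := h1
  obtain ⟨M, hM, hMe⟩ := h2
  obtain ⟨c, hc, hc1⟩ : ∃ c : ℂ, (∀ x ∈ X ∩ Y, L x = M x + c) ∧ Complex.exp c = 1 := by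
    rcases (X ∩ Y).eq_empty_or_nonempty with he | ⟨y, hy⟩
    · exact ⟨0, by simp [he], by simp⟩
    · refine ⟨L y - M y, fun x hx => ?_, ?_⟩
      · have := log_sub_log_const hXY (hL.mono inter_subset_left) (hM.mono inter_subset_right)
          (fun x hx => by rw [hLe x hx.1, hMe x hx.2]) hx hy
        linear_combination this
      · rw [Complex.exp_sub, hLe y hy.1, hMe y hy.2, ← hMe y hy.2, div_self (Complex.exp_ne_zero _)]
  refine ⟨X.piecewise L (fun x => M x + c), ?_, ?_⟩
  · refine ContinuousOn.union_of_isClosed ?_ ?_ hX hY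
    · exact hL.congr (fun x hx => piecewise_eq_of_mem _ _ _ hx)
    · refine (hM.add_const c).congr (fun x hx => ?_)
      by_cases hxX : x ∈ X
      · rw [piecewise_eq_of_mem _ _ _ hxX, hc x ⟨hxX, hx⟩]
      · rw [piecewise_eq_of_notMem _ _ _ hxX]
  · intro x hx
    by_cases hxX : x ∈ X
    · rw [piecewise_eq_of_mem _ _ _ hxX, hLe x hxX]
    · rw [piecewise_eq_of_notMem _ _ _ hxX, Complex.exp_add, hc1, mul_one,
        hMe x (hx.resolve_left hxX)]

/-- An arc encloses nothing. -/
lemma HasLog.of_arc {γ : ℝ → Plane} {a b : ℝ} (hab : a ≤ b) (hγ : ContinuousOn γ (Icc a b))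
    (hinj : InjOn γ (Icc a b)) {z : Plane} (hz : z ∉ γ '' Icc a b) : HasLog (γ '' Icc a b) z := by
  set G : ℝ → ℂ := fun t => planeToComplex (IccExtend hab ((Icc a b).domRestrict γ) t) -
    planeToComplex z with hGdef
  have hcont : Continuous G :=
    (continuous_planeToComplex.comp
      (continuousOn_iff_continuous_domRestrict.1 hγ).Icc_extend').sub continuous_const
  obtain ⟨L, hL, hexp⟩ := exists_continuous_log G hcont (fun t => by
    refine planeToComplex_sub_ne_zero fun h => hz ?_
    rw [← h]
    exact ⟨projIcc a b hab t, Subtype.mem _, rfl⟩)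
  have hcomp : IsCompact (Icc a b) := isCompact_Icc
  -- The inverse of the parametrization is continuous on the compact arc.
  have hinv : ContinuousOn (Function.invFunOn γ (Icc a b)) (γ '' Icc a b) := by
    rw [continuousOn_iff_isClosed]
    intro F hF
    refine ⟨γ '' (F ∩ Icc a b), ?_, ?_⟩
    · exact ((hcomp.inter_left hF).image_of_continuousOn (hγ.mono inter_subset_right)).isClosed
    · ext x
      constructor
      · rintro ⟨hx, t, ht, rfl⟩
        rw [mem_preimage, hinj.leftInvOn_invFunOn ht] at hx
        exact ⟨⟨t, ⟨hx, ht⟩, rfl⟩, t, ht, rfl⟩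
      · rintro ⟨⟨t, ⟨hF', ht⟩, rfl⟩, hx⟩
        refine ⟨?_, hx⟩
        rw [mem_preimage, hinj.leftInvOn_invFunOn ht]
        exact hF'
  refine ⟨fun x => L (Function.invFunOn γ (Icc a b) x), hL.comp_continuousOn hinv, ?_⟩
  rintro _ ⟨t, ht, rfl⟩
  simp only [hexp, hGdef]
  rw [hinj.leftInvOn_invFunOn ht, IccExtend_of_mem _ _ ht, domRestrict_apply]

/-! ### Enclosed sets -/

lemma isClosed_enclosed {X : Set Plane} (hX : IsCompact X) : IsClosed (enclosed X) := by
  rw [← isOpen_compl_iff]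
  convert isOpen_setOf_hasLog hX using 1
  ext z
  exact notMem_enclosed_iff hX

lemma isCompact_enclosed {X : Set Plane} (hX : IsCompact X) : IsCompact (enclosed X) := by
  refine Metric.isCompact_of_isClosed_isBounded (isClosed_enclosed hX) ?_
  obtain ⟨R, hR⟩ := exists_hasLog_of_bounded hX.isBounded
  refine isBounded_iff_forall_norm_le.2 ⟨R, fun z hz => ?_⟩
  by_contra! h
  exact (hR z h).notMem_enclosed hX hz

lemma mem_interior_enclosed {X : Set Plane} (hX : IsCompact X) {z : Plane} (hz : z ∈ enclosed X)
    (hzX : z ∉ X) : z ∈ interior (enclosed X) := by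
  refine mem_interior.2 ⟨_, ?_, isOpen_setOf_not_hasLog hX, hzX, ?_⟩
  · rintro w ⟨-, hw⟩
    by_contra h
    exact hw ((notMem_enclosed_iff hX).1 h)
  · exact fun h => h.notMem_enclosed hX hz

/-- Nothing outside of `enclosed X` is enclosed by `enclosed X`. -/
lemma HasLog.extend_enclosed {X : Set Plane} (hX : IsCompact X) {z : Plane} (hz : HasLog X z) :
    HasLog (enclosed X) z := by
  set C := connectedComponentIn Xᶜ z with hC
  have hzC : z ∈ C := mem_connectedComponentIn hz.notMem
  have hub : ¬ Bornology.IsBounded C := fun h => hz.notMem_enclosed hX (Or.inr h)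
  obtain ⟨R, hR⟩ := exists_hasLog_of_bounded (isCompact_enclosed hX).isBounded
  rw [isBounded_iff_forall_norm_le] at hub
  push Not at hub
  obtain ⟨w, hw, hRw⟩ := hub R
  refine (hR w hRw).of_isPreconnected (isCompact_enclosed hX) isPreconnected_connectedComponentIn
    (fun y hy => ?_) hw hzC
  exact (hz.of_isPreconnected hX isPreconnected_connectedComponentIn
    (connectedComponentIn_subset _ _) hzC hy).notMem_enclosed hX

lemma enclosed_subset_enclosed {X Y : Set Plane} (hX : IsCompact X) (hY : IsCompact Y)
    (hXY : X ⊆ enclosed Y) : enclosed X ⊆ enclosed Y := by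
  intro z hz
  by_contra h
  exact ((((notMem_enclosed_iff hY).1 h).extend_enclosed hY).mono hXY).notMem_enclosed hX hz

/-! ### Jordan curves and chords -/

/-- `c` runs periodically, with period `N`, through a closed curve that does not pass twice through
any point. -/
structure IsSimpleClosedCurve (c : ℝ → Plane) (N : ℝ) : Prop where
  pos : 0 < N
  cont : Continuous c
  per : Function.Periodic c N
  inj : ∀ s, InjOn c (Ico s (s + N))

namespace IsSimpleClosedCurve

variable {c : ℝ → Plane} {N : ℝ}

lemma arc_union_arc (hc : IsSimpleClosedCurve c N) {s t : ℝ} (hst : s ≤ t) (ht : t ≤ s + N) :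
    c '' Icc s t ∪ c '' Icc t (s + N) = range c := by
  rw [← image_union, Icc_union_Icc_eq_Icc hst ht]
  exact hc.per.image_Icc hc.pos s

lemma isCompact_range (hc : IsSimpleClosedCurve c N) : IsCompact (range c) := by
  rw [← hc.per.image_Icc hc.pos 0]
  exact isCompact_Icc.image hc.cont

lemma injOn_Icc (hc : IsSimpleClosedCurve c N) {s t : ℝ} (h : t < s + N) : InjOn c (Icc s t) :=
  (hc.inj s).mono (Icc_subset_Ico_right h)

/-- The exterior of a Jordan curve comes close to each of its points, because the remaining arc
does not separate the point from infinity. -/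
lemma mem_closure_compl_enclosed (hc : IsSimpleClosedCurve c N) {x : Plane} (hx : x ∈ range c) :
    x ∈ closure (enclosed (range c))ᶜ := by
  set K := enclosed (range c) with hK
  have hKc : IsCompact K := isCompact_enclosed hc.isCompact_range
  rw [closure_compl, mem_compl_iff]
  intro hint
  obtain ⟨u, rfl⟩ := hx
  obtain ⟨δ, hδ, hball⟩ := Metric.isOpen_iff.1 (isOpen_interior.preimage hc.cont) u hint
  set η := min (δ / 2) (N / 4) with hη
  have hη0 : 0 < η := lt_min (by linarith) (by linarith [hc.pos])
  have hηδ : η < δ := (min_le_left _ _).trans_lt (by linarith)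
  have hηN : η < N / 2 := (min_le_right _ _).trans_lt (by linarith [hc.pos])
  have hne : c u ∉ c '' Icc (u + η) (u + N - η) := by
    rintro ⟨v, hv, hvu⟩
    have := hc.inj u (x₁ := v) ⟨by linarith [hv.1], by linarith [hv.2]⟩
      ⟨le_rfl, by linarith [hc.pos]⟩ hvu
    linarith [hv.1]
  have hlog : HasLog (c '' Icc (u + η) (u + N - η)) (c u) :=
    HasLog.of_arc (by linarith) hc.cont.continuousOn (hc.injOn_Icc (by linarith)) hne
  have hub := hlog.notMem_enclosed (isCompact_Icc.image hc.cont)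
  set W := connectedComponentIn (c '' Icc (u + η) (u + N - η))ᶜ (c u) with hW
  have hWK : W ⊆ interior K := by
    refine isPreconnected_connectedComponentIn.subset_of_closure_inter_subset isOpen_interior
      ⟨c u, mem_connectedComponentIn hne, hint⟩ ?_
    rintro y ⟨hy, hyW⟩
    have hyK : y ∈ K := hKc.isClosed.closure_subset (closure_mono interior_subset hy)
    by_cases hyJ : y ∈ range c
    · rw [← hc.per.image_Icc hc.pos (u - η)] at hyJ
      obtain ⟨v, hv, rfl⟩ := hyJ
      by_cases hv' : v < u + η
      · refine hball ?_
        rw [Metric.mem_ball, Real.dist_eq, abs_lt]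
        exact ⟨by linarith [hv.1], by linarith⟩
      · exact absurd ⟨v, ⟨not_lt.1 hv', by linarith [hv.2]⟩, rfl⟩
          (connectedComponentIn_subset _ _ hyW)
    · exact mem_interior_enclosed hc.isCompact_range hyK hyJ
  exact hub (Or.inr ((hKc.isBounded.subset interior_subset).subset hWK))

end IsSimpleClosedCurve

lemma segment_isPreconnected (a b : Plane) : IsPreconnected (segment ℝ a b) :=
  (convex_segment a b).isPreconnected

lemma isCompact_segment (a b : Plane) : IsCompact (segment ℝ a b) := by
  rw [segment_eq_image_lineMap]
  exact isCompact_Icc.image AffineMap.lineMap_continuous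

lemma HasLog.of_segment {a b z : Plane} (hz : z ∉ segment ℝ a b) : HasLog (segment ℝ a b) z := by
  by_contra h
  have hz' : z ∈ enclosed (segment ℝ a b) := by
    by_contra h'
    exact h ((notMem_enclosed_iff (isCompact_segment a b)).1 h')
  by_cases hab : a = b
  · subst hab
    rw [segment_same] at hz' hz
    refine HasLog.notMem_enclosed isCompact_singleton ?_ hz'
    refine ⟨fun _ => Complex.log (planeToComplex a - planeToComplex z), continuousOn_const, ?_⟩
    rintro x rfl
    exact Complex.exp_log (planeToComplex_sub_ne_zero fun h => hz (by rw [h]; rfl))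
  · rw [segment_eq_image_lineMap] at hz h
    exact h (HasLog.of_arc zero_le_one AffineMap.lineMap_continuous.continuousOn
      (AffineMap.lineMap_injective ℝ hab).injOn hz)

namespace IsSimpleClosedCurve

variable {c : ℝ → Plane} {N : ℝ} {s t : ℝ}

/-- The two arcs of a Jordan curve have only their endpoints in common. -/
lemma image_inter_image_subset (hc : IsSimpleClosedCurve c N) :
    c '' Icc s t ∩ c '' Icc t (s + N) ⊆ {c s, c t} := by
  rintro _ ⟨⟨u, hu, rfl⟩, ⟨v, hv, huv⟩⟩
  by_cases hvN : v = s + N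
  · left
    rw [← huv, hvN, hc.per]
  · have hvlt : v < s + N := lt_of_le_of_ne hv.2 hvN
    have : v = u := hc.inj s ⟨hu.1.trans (hu.2.trans hv.1), hvlt⟩
      ⟨hu.1, (hu.2.trans hv.1).trans_lt hvlt⟩ huv
    right
    rw [show u = t from le_antisymm hu.2 (this ▸ hv.1)]
    rfl

lemma curve_union_chord_inter (hc : IsSimpleClosedCurve c N) :
    (c '' Icc s t ∪ segment ℝ (c s) (c t)) ∩ (c '' Icc t (s + N) ∪ segment ℝ (c s) (c t)) =
      segment ℝ (c s) (c t) := by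
  rw [← inter_union_distrib_right, union_eq_right]
  refine hc.image_inter_image_subset.trans ?_
  rintro x (rfl | rfl)
  · exact left_mem_segment _ _ _
  · exact right_mem_segment _ _ _

/-- A chord cuts the region inside a Jordan curve into two parts. -/
lemma enclosed_eq_union (hc : IsSimpleClosedCurve c N) (hst : s ≤ t) (ht : t ≤ s + N)
    (hchord : segment ℝ (c s) (c t) ⊆ enclosed (range c)) :
    enclosed (range c) = enclosed (c '' Icc s t ∪ segment ℝ (c s) (c t)) ∪
      enclosed (c '' Icc t (s + N) ∪ segment ℝ (c s) (c t)) := by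
  have hA : IsCompact (c '' Icc s t) := isCompact_Icc.image hc.cont
  have hB : IsCompact (c '' Icc t (s + N)) := isCompact_Icc.image hc.cont
  have hh := isCompact_segment (c s) (c t)
  have hrange := hc.arc_union_arc hst ht
  apply Subset.antisymm
  · intro z hz
    by_contra hn
    rw [mem_union, not_or] at hn
    have h := HasLog.union (hA.union hh).isClosed (hB.union hh).isClosed
      (by rw [hc.curve_union_chord_inter]; exact segment_isPreconnected _ _)
      ((notMem_enclosed_iff (hA.union hh)).1 hn.1) ((notMem_enclosed_iff (hB.union hh)).1 hn.2)
    refine (h.mono ?_).notMem_enclosed hc.isCompact_range hz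
    rw [← hrange]
    exact union_subset_union subset_union_left subset_union_left
  · have h1 : c '' Icc s t ⊆ enclosed (range c) := (image_subset_range _ _).trans (subset_enclosed _)
    have h2 : c '' Icc t (s + N) ⊆ enclosed (range c) :=
      (image_subset_range _ _).trans (subset_enclosed _)
    exact union_subset
      (enclosed_subset_enclosed (hA.union hh) hc.isCompact_range (union_subset h1 hchord))
      (enclosed_subset_enclosed (hB.union hh) hc.isCompact_range (union_subset h2 hchord))

/-- A point of a Jordan curve is not enclosed by a compact set inside the curve that misses it. -/
lemma notMem_enclosed_of_notMem (hc : IsSimpleClosedCurve c N) {X : Set Plane} (hX : IsCompact X)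
    (hXK : X ⊆ enclosed (range c)) {x : Plane} (hx : x ∈ range c) (hxX : x ∉ X) :
    x ∉ enclosed X := by
  intro hxe
  have h1 := mem_interior_enclosed hX hxe hxX
  have h2 : x ∈ interior (enclosed (range c)) :=
    interior_mono (enclosed_subset_enclosed hX hc.isCompact_range hXK) h1
  have h3 := hc.mem_closure_compl_enclosed hx
  rw [closure_compl] at h3
  exact h3 h2

/-- The two parts into which a chord cuts the region inside a Jordan curve meet only in the chord.
A component of the remaining common points could border only on the chord, but the
complement of a segment is connected. -/
lemma enclosed_inter_enclosed (hc : IsSimpleClosedCurve c N)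
    (hchord : segment ℝ (c s) (c t) ⊆ enclosed (range c)) :
    enclosed (c '' Icc s t ∪ segment ℝ (c s) (c t)) ∩
      enclosed (c '' Icc t (s + N) ∪ segment ℝ (c s) (c t)) = segment ℝ (c s) (c t) := by
  have hA : IsCompact (c '' Icc s t) := isCompact_Icc.image hc.cont
  have hB : IsCompact (c '' Icc t (s + N)) := isCompact_Icc.image hc.cont
  have hh := isCompact_segment (c s) (c t)
  have hinter := hc.curve_union_chord_inter (s := s) (t := t)
  set A := c '' Icc s t
  set B := c '' Icc t (s + N)
  set h := segment ℝ (c s) (c t)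
  have hAr : A ⊆ range c := image_subset_range _ _
  have hBr : B ⊆ range c := image_subset_range _ _
  have hAK : A ∪ h ⊆ enclosed (range c) := union_subset (hAr.trans (subset_enclosed _)) hchord
  have hBK : B ∪ h ⊆ enclosed (range c) := union_subset (hBr.trans (subset_enclosed _)) hchord
  have hA' : ∀ x ∈ A, x ∉ h → x ∉ enclosed (B ∪ h) := fun x hx hxh =>
    hc.notMem_enclosed_of_notMem (hB.union hh) hBK (hAr hx)
      (fun hxB => hxh (hinter.subset ⟨Or.inl hx, hxB⟩))
  have hB' : ∀ x ∈ B, x ∉ h → x ∉ enclosed (A ∪ h) := fun x hx hxh =>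
    hc.notMem_enclosed_of_notMem (hA.union hh) hAK (hBr hx)
      (fun hxA => hxh (hinter.subset ⟨hxA, Or.inl hx⟩))
  apply Subset.antisymm
  swap
  · exact fun x hx => ⟨Or.inl (Or.inr hx), Or.inl (Or.inr hx)⟩
  rintro x ⟨hx1, hx2⟩
  by_contra hxh
  have hopen : IsOpen (interior (enclosed (A ∪ h)) ∩ interior (enclosed (B ∪ h))) :=
    isOpen_interior.inter isOpen_interior
  have hxA : x ∉ A := fun h => hA' x h hxh hx2
  have hxB : x ∉ B := fun h => hB' x h hxh hx1
  have hsub : connectedComponentIn hᶜ x ⊆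
      interior (enclosed (A ∪ h)) ∩ interior (enclosed (B ∪ h)) := by
    refine isPreconnected_connectedComponentIn.subset_of_closure_inter_subset hopen
      ⟨x, mem_connectedComponentIn hxh, ?_, ?_⟩ ?_
    · exact mem_interior_enclosed (hA.union hh) hx1 (by simp [hxA, hxh])
    · exact mem_interior_enclosed (hB.union hh) hx2 (by simp [hxB, hxh])
    · rintro y ⟨hy, hyC⟩
      have hyh : y ∉ h := connectedComponentIn_subset _ _ hyC
      have hy1 : y ∈ enclosed (A ∪ h) := (isClosed_enclosed (hA.union hh)).closure_subset
        (closure_mono (inter_subset_left.trans interior_subset) hy)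
      have hy2 : y ∈ enclosed (B ∪ h) := (isClosed_enclosed (hB.union hh)).closure_subset
        (closure_mono (inter_subset_right.trans interior_subset) hy)
      have hyA : y ∉ A := fun h => hA' y h hyh hy2
      have hyB : y ∉ B := fun h => hB' y h hyh hy1
      exact ⟨mem_interior_enclosed (hA.union hh) hy1 (by simp [hyA, hyh]),
        mem_interior_enclosed (hB.union hh) hy2 (by simp [hyB, hyh])⟩
  refine (HasLog.of_segment hxh).notMem_enclosed hh (Or.inr ?_)
  exact (isCompact_enclosed (hA.union hh)).isBounded.subset
    (hsub.trans (inter_subset_left.trans interior_subset))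

end IsSimpleClosedCurve

/-! ### The boundary curve of a polygon -/

section Boundary

variable {n : ℕ} [NeZero n]

lemma boundaryCurve_eq_lineMap (poly : Polygon Plane n) (k : ℤ) {t : ℝ}
    (ht : t ∈ Icc (k : ℝ) (k + 1)) :
    boundaryCurve poly t = poly.edgePath ℝ (Fin.ofNat n (k % (n : ℤ)).toNat) (t - k) := by
  have hn : (0 : ℤ) < n := by exact_mod_cast Nat.pos_of_ne_zero (NeZero.ne n)
  rcases ht.2.lt_or_eq with h | h
  · have hf : ⌊t⌋ = k := Int.floor_eq_iff.2 ⟨ht.1, h⟩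
    rw [boundaryCurve, hf, Int.fract, hf]
  · have hf : ⌊t⌋ = k + 1 := by rw [h]; exact_mod_cast Int.floor_intCast (k + 1)
    rw [boundaryCurve, hf, Int.fract, hf, h]
    have e1 : (k : ℝ) + 1 - ((k + 1 : ℤ) : ℝ) = 0 := by push_cast; ring
    have e2 : (k : ℝ) + 1 - k = 1 := by ring
    rw [e1, e2, Polygon.edgePath, Polygon.edgePath, AffineMap.lineMap_apply_zero,
      AffineMap.lineMap_apply_one]
    congr 1
    obtain ⟨m, rfl⟩ := Nat.exists_eq_succ_of_ne_zero (NeZero.ne n)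
    rw [finRotate_apply]
    apply Fin.ext
    rw [Fin.val_add]
    simp only [Fin.ofNat, Fin.val_one']
    have h0 := Int.emod_nonneg k hn.ne'
    have h1 := Int.emod_nonneg (k + 1) hn.ne'
    push_cast at h0 h1
    zify
    rw [Int.toNat_of_nonneg h0, Int.toNat_of_nonneg h1]
    simp [Int.add_emod]

lemma continuous_boundaryCurve (poly : Polygon Plane n) : Continuous (boundaryCurve poly) := by
  have hpiece : ∀ k : ℤ, ContinuousOn (boundaryCurve poly) (Icc (k : ℝ) (k + 1)) := by
    intro k
    refine ContinuousOn.congr ?_ (fun t ht => boundaryCurve_eq_lineMap poly k ht)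
    exact ((AffineMap.lineMap_continuous).comp (continuous_id.sub continuous_const)).continuousOn
  rw [continuous_iff_continuousAt]
  intro t
  have h1 := hpiece (⌊t⌋ - 1)
  have h2 := hpiece ⌊t⌋
  push_cast at h1
  rw [sub_add_cancel] at h1
  refine (h1.union_of_isClosed h2 isClosed_Icc isClosed_Icc).continuousAt ?_
  rw [Icc_union_Icc_eq_Icc (by linarith) (by linarith)]
  exact Icc_mem_nhds (by linarith [Int.floor_le t]) (Int.lt_floor_add_one t)

lemma periodic_boundaryCurve (poly : Polygon Plane n) :
    Function.Periodic (boundaryCurve poly) n := by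
  intro t
  rw [boundaryCurve, boundaryCurve, Int.floor_add_natCast, Int.fract_add_natCast,
    Int.add_emod_right]

lemma range_boundaryCurve (poly : Polygon Plane n) :
    range (boundaryCurve poly) = poly.boundary ℝ := by
  apply Subset.antisymm
  · rintro _ ⟨t, rfl⟩
    exact mem_iUnion.2 ⟨_, _, ⟨Int.fract_nonneg t, (Int.fract_lt_one t).le⟩, rfl⟩
  · rintro x hx
    obtain ⟨i, u, hu, rfl⟩ := mem_iUnion.1 hx
    refine ⟨((i : ℕ) : ℤ) + u, ?_⟩
    rw [boundaryCurve_eq_lineMap poly ((i : ℕ) : ℤ) ⟨by linarith [hu.1], by linarith [hu.2]⟩]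
    rw [add_sub_cancel_left]
    have : Fin.ofNat n ((((i : ℕ) : ℤ) % (n : ℤ)).toNat) = i := by
      apply Fin.ext
      have h := i.isLt
      simp only [Fin.ofNat]
      rw [← Int.natCast_mod, Int.toNat_natCast, Nat.mod_mod, Nat.mod_eq_of_lt h]
    rw [this]
    rfl

lemma SimplePolygon.isSimpleClosedCurve (P : SimplePolygon n) :
    IsSimpleClosedCurve (boundaryCurve P.poly) n := by
  have hn : (0 : ℝ) < n := by exact_mod_cast Nat.pos_of_ne_zero (NeZero.ne n)
  have hper := periodic_boundaryCurve P.poly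
  refine ⟨hn, continuous_boundaryCurve _, hper, fun s x hx y hy hxy => ?_⟩
  have hmod : ∀ t, boundaryCurve P.poly (toIcoMod hn 0 t) = boundaryCurve P.poly t := by
    intro t
    rw [toIcoMod, hper.sub_zsmul_eq]
  have h0 : ∀ t, toIcoMod hn 0 t ∈ Ico (0 : ℝ) n := by
    intro t
    simpa using toIcoMod_mem_Ico hn 0 t
  have := P.simple (h0 x) (h0 y) (by rw [hmod, hmod, hxy])
  rw [← (toIcoMod_eq_self hn).2 hx, ← (toIcoMod_eq_self hn).2 hy]
  obtain ⟨m, hm⟩ := (toIcoMod_eq_toIcoMod hn).1 this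
  exact (toIcoMod_eq_toIcoMod hn).2 ⟨m, hm⟩

end Boundary

/-! ### Local structure of a polygonal region -/

/-- Near each of its points, a segment looks like a cone. -/
lemma exists_segment_conical (a b x : Plane) : ∃ r > 0, ∀ y ∈ segment ℝ a b, ∀ l : ℝ, 0 < l →
    dist (x + l • (y - x)) x < r → dist y x < r → x + l • (y - x) ∈ segment ℝ a b := by
  by_cases hx : x ∈ segment ℝ a b
  swap
  · obtain ⟨r, hr, hball⟩ :=
      Metric.isOpen_iff.1 (isCompact_segment a b).isClosed.isOpen_compl x hx
    exact ⟨r, hr, fun y hy l hl _ hyx => absurd hy (hball hyx)⟩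
  by_cases hab : a = b
  · subst hab
    refine ⟨1, one_pos, fun y hy l _ _ _ => ?_⟩
    rw [segment_same, mem_singleton_iff] at hx hy
    simp [hx, hy]
  have hex : ∀ e : Plane, ∃ r > 0, e ≠ x → r ≤ dist e x := fun e => by
    by_cases h : e = x
    · exact ⟨1, one_pos, fun h' => absurd h h'⟩
    · exact ⟨dist e x, dist_pos.2 h, fun _ => le_rfl⟩
  obtain ⟨r1, hr1, h1⟩ := hex a
  obtain ⟨r2, hr2, h2⟩ := hex b
  refine ⟨min r1 r2, lt_min hr1 hr2, ?_⟩
  intro y hy l hl hz _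
  rw [segment_eq_image_lineMap] at hx hy ⊢
  obtain ⟨u, hu, rfl⟩ := hx
  obtain ⟨v, hv, rfl⟩ := hy
  set L := AffineMap.lineMap (k := ℝ) a b with hL
  have hd : ∀ p q : ℝ, dist (L p) (L q) = |p - q| * dist a b := fun p q => by
    rw [hL, dist_lineMap_lineMap, Real.dist_eq]
  have hpt : L u + l • (L v - L u) = L (u + l * (v - u)) := by
    simp only [hL, AffineMap.lineMap_apply, vsub_eq_sub, vadd_eq_add]
    module
  have hinj : Function.Injective L := AffineMap.lineMap_injective ℝ hab
  rw [hpt] at hz ⊢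
  have ha : L 0 = a := AffineMap.lineMap_apply_zero _ _
  have hb : L 1 = b := AffineMap.lineMap_apply_one _ _
  rw [hd, add_sub_cancel_left] at hz
  refine ⟨u + l * (v - u), ⟨?_, ?_⟩, rfl⟩
  · by_contra! hneg
    have hvu : l * (v - u) < 0 := by linarith [hu.1]
    have hne : a ≠ L u := by
      rw [← ha]
      refine fun h => ?_
      have := hinj h
      nlinarith [hv.1]
    have h0 := h1 hne
    rw [← ha, hd, zero_sub, abs_neg, abs_of_nonneg hu.1] at h0
    rw [abs_of_neg hvu] at hz
    have := lt_of_mul_lt_mul_right (hz.trans_le ((min_le_left _ _).trans h0)) dist_nonneg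
    linarith
  · by_contra! hneg
    have hvu : 0 < l * (v - u) := by linarith [hu.2]
    have hne : b ≠ L u := by
      rw [← hb]
      refine fun h => ?_
      have := hinj h
      nlinarith [hv.2]
    have h0 := h2 hne
    rw [← hb, hd, abs_of_nonneg (by linarith [hu.2])] at h0
    rw [abs_of_pos hvu] at hz
    have := lt_of_mul_lt_mul_right (hz.trans_le ((min_le_right _ _).trans h0)) dist_nonneg
    linarith

lemma exists_boundary_conical {n : ℕ} (poly : Polygon Plane n) (x : Plane) :
    ∃ r > 0, ∀ y ∈ poly.boundary ℝ, ∀ l : ℝ, 0 < l →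
    dist (x + l • (y - x)) x < r → dist y x < r → x + l • (y - x) ∈ poly.boundary ℝ := by
  choose r hr h using fun i => exists_segment_conical (poly i) (poly (finRotate n i)) x
  have hseg : ∀ i, poly.edgeSet ℝ i = segment ℝ (poly i) (poly (finRotate n i)) :=
    fun i => affineSegment_eq_segment ℝ _ _
  obtain ⟨ε, hε, hmin⟩ : ∃ ε > 0, ∀ i, ε ≤ r i := by
    rcases isEmpty_or_nonempty (Fin n) with _ | _
    · exact ⟨1, one_pos, fun i => isEmptyElim i⟩
    · obtain ⟨i, hi⟩ := Finite.exists_min r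
      exact ⟨r i, hr i, hi⟩
  refine ⟨ε, hε, fun y hy l hl h1 h2 => ?_⟩
  obtain ⟨i, hi⟩ := mem_iUnion.1 hy
  rw [hseg] at hi
  refine mem_iUnion.2 ⟨i, ?_⟩
  rw [hseg]
  exact h i y hi l hl (h1.trans_le (hmin i)) (h2.trans_le (hmin i))

/-- The properties of a polygonal region on which the metric part of the argument rests. -/
structure IsTame (K : Set Plane) : Prop where
  isCompact : IsCompact K
  isPreconnected : IsPreconnected K
  /-- Near each of its points, the set is a cone. -/
  conical : ∀ x ∈ K, ∃ r > 0, ∀ y ∈ K, dist y x < r → segment ℝ x y ⊆ K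
  /-- Closed curves in the set do not wind around points outside of the set. -/
  hasLog : ∀ z, z ∉ K → HasLog K z

lemma segment_subset_insert_image (x y : Plane) :
    segment ℝ x y = insert x ((fun l : ℝ => x + l • (y - x)) '' Ioc 0 1) := by
  rw [segment_eq_image', ← Ioc_insert_left zero_le_one, image_insert_eq]
  simp

/-- A preconnected set that misses `X` and meets `enclosed X` lies in `enclosed X`. -/
lemma subset_enclosed_of_isPreconnected {X C : Set Plane} (hX : IsCompact X)
    (hC : IsPreconnected C) (hCX : C ⊆ Xᶜ) {z : Plane} (hz : z ∈ C) (hzX : z ∈ enclosed X) :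
    C ⊆ enclosed X := by
  intro w hw
  by_contra h
  exact (((notMem_enclosed_iff hX).1 h).of_isPreconnected hX hC hCX hw hz).notMem_enclosed hX hzX

lemma isPreconnected_ray (x y : Plane) :
    IsPreconnected ((fun l : ℝ => x + l • (y - x)) '' Ioc 0 1) :=
  isPreconnected_Ioc.image _ (by fun_prop)

/-- The segment to an enclosed point from a nearest point of `X` lies inside. -/
lemma exists_segment_subset_enclosed {X : Set Plane} (hX : IsCompact X) (hne : X.Nonempty)
    {z : Plane} (hz : z ∈ enclosed X) : ∃ e ∈ X, segment ℝ e z ⊆ enclosed X := by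
  obtain ⟨e, he, hmin⟩ := hX.exists_infDist_eq_dist hne z
  by_cases hzX : z ∈ X
  · exact ⟨z, hzX, by simpa using hz⟩
  have hez : 0 < dist z e := dist_pos.2 (fun h => hzX (h ▸ he))
  refine ⟨e, he, ?_⟩
  rw [segment_subset_insert_image, insert_subset_iff]
  refine ⟨subset_enclosed X he, subset_enclosed_of_isPreconnected hX (isPreconnected_ray e z) ?_
    ⟨1, ⟨one_pos, le_rfl⟩, by simp⟩ hz⟩
  rintro _ ⟨l, hl, rfl⟩ hmem
  have h1 := Metric.infDist_le_dist_of_mem (x := z) hmem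
  have h2 : z - (e + l • (z - e)) = (1 - l) • (z - e) := by module
  rw [hmin, dist_eq_norm z (e + _), h2, norm_smul, Real.norm_of_nonneg (by linarith [hl.2]),
    ← dist_eq_norm] at h1
  nlinarith [hl.1]

lemma SimplePolygon.isTame_region {n : ℕ} [NeZero n] (P : SimplePolygon n) :
    IsTame P.region := by
  have hJ := P.isSimpleClosedCurve
  have hr := range_boundaryCurve P.poly
  have hcomp : IsCompact (P.poly.boundary ℝ) := hr ▸ hJ.isCompact_range
  have hne : (P.poly.boundary ℝ).Nonempty := hr ▸ range_nonempty _
  have hconn : IsPreconnected (P.poly.boundary ℝ) := hr ▸ isPreconnected_range hJ.cont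
  refine ⟨isCompact_enclosed hcomp, ?_, ?_, ?_⟩
  · obtain ⟨e0, he0⟩ := hne
    refine isPreconnected_of_forall e0 fun z hz => ?_
    obtain ⟨e, he, hseg⟩ := exists_segment_subset_enclosed hcomp ⟨e0, he0⟩ hz
    exact ⟨P.poly.boundary ℝ ∪ segment ℝ e z, union_subset (subset_enclosed _) hseg, Or.inl he0,
      Or.inr (right_mem_segment _ _ _),
      hconn.union e he (left_mem_segment _ _ _) (segment_isPreconnected _ _)⟩
  · intro x hx
    obtain ⟨r, hr, h⟩ := exists_boundary_conical P.poly x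
    refine ⟨r, hr, fun y hy hyx => ?_⟩
    rw [segment_subset_insert_image, insert_subset_iff]
    refine ⟨hx, ?_⟩
    have hlt : ∀ l : ℝ, l ∈ Ioc (0 : ℝ) 1 → dist (x + l • (y - x)) x < r := by
      intro l hl
      rw [dist_eq_norm, add_sub_cancel_left, norm_smul, Real.norm_of_nonneg hl.1.le]
      rw [dist_eq_norm] at hyx
      nlinarith [norm_nonneg (y - x), hl.2]
    by_cases hyJ : y ∈ P.poly.boundary ℝ
    · rintro _ ⟨l, hl, rfl⟩
      exact subset_enclosed _ (h y hyJ l hl.1 (hlt l hl) hyx)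
    · refine subset_enclosed_of_isPreconnected hcomp (isPreconnected_ray x y) ?_
        ⟨1, ⟨one_pos, le_rfl⟩, by simp⟩ hy
      rintro _ ⟨l, hl, rfl⟩ hmem
      -- A boundary point on the segment would make `y` a boundary point.
      refine hyJ ?_
      have h2 : x + l⁻¹ • (x + l • (y - x) - x) = y := by
        rw [add_sub_cancel_left, smul_smul, inv_mul_cancel₀ hl.1.ne', one_smul, add_sub_cancel]
      have h3 := h _ hmem l⁻¹ (inv_pos.2 hl.1)
      rw [h2] at h3
      exact h3 hyx (hlt l hl)
  · intro z hz
    exact ((notMem_enclosed_iff hcomp).1 hz).extend_enclosed hcomp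

/-- A half-polygon and the other part of the polygon beyond the chord are closed, cover the polygon
and meet in the chord. -/
lemma HalfPolygon.exists_complement {n : ℕ} [NeZero n] {P : SimplePolygon n} (H : HalfPolygon P) :
    IsCompact H.region ∧ ∃ H' : Set Plane, IsClosed H' ∧ P.region = H.region ∪ H' ∧
      H.region ∩ H' = H.chord := by
  have hJ := P.isSimpleClosedCurve
  have hr := range_boundaryCurve P.poly
  have hchord := H.chord_subset
  rw [SimplePolygon.region, ← hr] at hchord ⊢
  have hh := isCompact_segment (boundaryCurve P.poly H.s) (boundaryCurve P.poly H.t)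
  refine ⟨isCompact_enclosed ((isCompact_Icc.image hJ.cont).union hh),
    enclosed (boundaryCurve P.poly '' Icc H.t (H.s + n) ∪ H.chord),
    isClosed_enclosed ((isCompact_Icc.image hJ.cont).union hh),
    hJ.enclosed_eq_union H.s_lt_t.le H.t_lt.le hchord,
    hJ.enclosed_inter_enclosed hchord⟩

lemma HalfPolygon.p_ne_q {n : ℕ} [NeZero n] {P : SimplePolygon n} (H : HalfPolygon P) :
    H.p ≠ H.q := by
  intro h
  have := P.isSimpleClosedCurve.inj H.s ⟨le_rfl, by linarith [P.isSimpleClosedCurve.pos]⟩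
    ⟨H.s_lt_t.le, H.t_lt⟩ h
  exact H.s_lt_t.ne this

/-! ### The geodesic distance -/

section Length

variable {K : Set Plane}

lemma geodEDist_le_eVariationOn {g : ℝ → Plane} {a b : ℝ} (hab : a ≤ b)
    (hg : ContinuousOn g (Icc a b)) (hK : MapsTo g (Icc a b) K) :
    geodEDist K (g a) (g b) ≤ eVariationOn g (Icc a b) := by
  have hmem : ∀ t : unitInterval, a + (b - a) * t ∈ Icc a b := fun t => by
    have h0 := t.2.1
    have h1 := t.2.2
    constructor <;> nlinarith
  let γ : Path (g a) (g b) :=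
    { toFun := fun t => g (a + (b - a) * t)
      continuous_toFun := hg.comp_continuous (by fun_prop) hmem
      source' := by simp
      target' := by simp }
  refine (iInf₂_le γ ?_).trans ?_
  · rintro _ ⟨t, rfl⟩
    exact hK (hmem t)
  · refine eVariationOn.comp_le_of_monotoneOn g (fun t : unitInterval => a + (b - a) * (t : ℝ))
      ?_ (fun t _ => hmem t)
    intro s _ t _ hst
    have : (s : ℝ) ≤ t := hst
    simp only
    nlinarith

lemma eVariationOn_extend_le {x y : Plane} (γ : Path x y) :
    eVariationOn γ.extend (Icc 0 1) ≤ pathLength γ :=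
  eVariationOn.comp_le_of_monotoneOn γ (projIcc (0 : ℝ) 1 zero_le_one)
    ((monotone_projIcc _).monotoneOn _) (fun _ _ => mem_univ _)

lemma extend_mem {x y : Plane} {γ : Path x y} (hγ : range γ ⊆ K) (t : ℝ) : γ.extend t ∈ K := by
  rw [← γ.extend_range] at hγ
  exact hγ (mem_range_self t)

/-- The length of a curve bounds the sum of the distances along three consecutive pieces. -/
lemma geodEDist_add_add_le {x y : Plane} {γ : Path x y} (hγ : range γ ⊆ K) {s t : ℝ}
    (h0 : 0 ≤ s) (hst : s ≤ t) (h1 : t ≤ 1) :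
    geodEDist K x (γ.extend s) + geodEDist K (γ.extend s) (γ.extend t) +
      geodEDist K (γ.extend t) y ≤ pathLength γ := by
  have hx : γ.extend 0 = x := γ.extend_zero
  have hy : γ.extend 1 = y := γ.extend_one
  have hc : ∀ a b : ℝ, a ≤ b → geodEDist K (γ.extend a) (γ.extend b) ≤
      eVariationOn γ.extend (univ ∩ Icc a b) := fun a b hab => by
    rw [univ_inter]
    exact geodEDist_le_eVariationOn hab γ.continuous_extend.continuousOn
      (fun t _ => extend_mem hγ t)
  have e1 := hc 0 s h0
  have e2 := hc s t hst
  have e3 := hc t 1 h1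
  rw [hx] at e1
  rw [hy] at e3
  refine (add_le_add (add_le_add e1 e2) e3).trans ?_
  rw [eVariationOn.Icc_add_Icc _ h0 hst (mem_univ _),
    eVariationOn.Icc_add_Icc _ (h0.trans hst) h1 (mem_univ _), univ_inter]
  exact eVariationOn_extend_le γ

lemma edist_le_geodEDist (K : Set Plane) (x y : Plane) : edist x y ≤ geodEDist K x y := by
  refine le_iInf₂ fun γ _ => ?_
  have := eVariationOn.edist_le γ (mem_univ 0) (mem_univ 1)
  rwa [γ.source, γ.target] at this

lemma geodEDist_comm_le (K : Set Plane) (x y : Plane) : geodEDist K x y ≤ geodEDist K y x := by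
  refine le_iInf₂ fun γ hγ => (iInf₂_le γ.symm (by rwa [Path.symm_range])).trans ?_
  exact eVariationOn.comp_le_of_antitoneOn γ unitInterval.symm
    (unitInterval.strictAnti_symm.antitone.antitoneOn _) (fun _ _ => mem_univ _)

lemma geodEDist_comm (K : Set Plane) (x y : Plane) : geodEDist K x y = geodEDist K y x :=
  (geodEDist_comm_le K x y).antisymm (geodEDist_comm_le K y x)

lemma geodEDist_triangle (K : Set Plane) (x y z : Plane) :
    geodEDist K x z ≤ geodEDist K x y + geodEDist K y z := by
  have key : ∀ (γ : Path x y) (_ : range γ ⊆ K) (γ' : Path y z) (_ : range γ' ⊆ K),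
      geodEDist K x z ≤ pathLength γ + pathLength γ' := by
    intro γ hγ γ' hγ'
    set g : ℝ → Plane := fun t => if t ≤ 1 then γ.extend t else γ'.extend (t - 1) with hg
    have hg1 : EqOn g γ.extend (Icc 0 1) := fun t ht => by
      simp only [hg, if_pos ht.2]
    have hg2 : EqOn g (γ'.extend ∘ fun t => t - 1) (Icc 1 2) := fun t ht => by
      simp only [hg, Function.comp]
      split_ifs with h
      · have : t = 1 := le_antisymm h ht.1
        simp [this]
      · rfl
    have hcont : Continuous g := by
      refine Continuous.if_le γ.continuous_extend (by fun_prop) continuous_id continuous_const ?_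
      rintro t rfl
      simp
    have h := geodEDist_le_eVariationOn (K := K) (g := g) (a := 0) (b := 2) (by norm_num)
      hcont.continuousOn (fun t _ => by
        simp only [hg]
        split_ifs
        · exact extend_mem hγ t
        · exact extend_mem hγ' _)
    have e0 : g 0 = x := by simp [hg]
    have e2 : g 2 = z := by
      have : ¬ (2 : ℝ) ≤ 1 := by norm_num
      simp only [hg, if_neg this]
      norm_num
    rw [e0, e2] at h
    refine h.trans ?_
    have hsum := eVariationOn.Icc_add_Icc g (s := univ) (a := (0 : ℝ)) (b := 1) (c := 2)
      (by norm_num) (by norm_num) (mem_univ _)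
    simp only [univ_inter] at hsum
    rw [← hsum, eVariationOn.congr hg1, eVariationOn.congr hg2]
    refine add_le_add (eVariationOn_extend_le γ) (le_trans ?_ (eVariationOn_extend_le γ'))
    refine eVariationOn.comp_le_of_monotoneOn _ _ ?_ ?_
    · intro s _ t _ hst
      simpa using hst
    · intro t ht
      exact ⟨by linarith [ht.1], by linarith [ht.2]⟩
  simp only [geodEDist, ENNReal.iInf_add, ENNReal.add_iInf]
  exact le_iInf fun γ' => le_iInf fun hγ' => le_iInf fun γ => le_iInf fun hγ => key γ hγ γ' hγ'

lemma geodEDist_of_segment {x y : Plane} (h : segment ℝ x y ⊆ K) :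
    geodEDist K x y = edist x y := by
  refine le_antisymm ?_ (edist_le_geodEDist K x y)
  have h1 := geodEDist_le_eVariationOn (K := K) (g := AffineMap.lineMap (k := ℝ) x y)
    (a := 0) (b := 1) zero_le_one AffineMap.lineMap_continuous.continuousOn (fun t ht => by
      apply h
      rw [segment_eq_image_lineMap]
      exact ⟨t, ht, rfl⟩)
  rw [AffineMap.lineMap_apply_zero, AffineMap.lineMap_apply_one] at h1
  refine h1.trans ?_
  have h2 := ((lipschitzWith_lineMap (𝕜 := ℝ) x y).lipschitzOnWith (s := univ)).comp_eVariationOn_le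
    (g := (id : ℝ → ℝ)) (s := Icc 0 1) (fun _ _ => mem_univ _)
  have h3 := MonotoneOn.eVariationOn_eq (f := (id : ℝ → ℝ)) (s := univ) (a := 0) (b := 1)
    (monotone_id.monotoneOn _) (mem_univ _) (mem_univ _)
  rw [univ_inter] at h3
  rw [h3] at h2
  rw [id, id, sub_zero, ENNReal.ofReal_one, mul_one, ← edist_nndist] at h2
  exact h2

end Length

namespace IsTame

variable {K : Set Plane}

lemma geodEDist_ne_top (hK : IsTame K) {x y : Plane} (hx : x ∈ K) (hy : y ∈ K) :
    geodEDist K x y ≠ ⊤ := by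
  refine hK.isPreconnected.induction₂ (fun x y => geodEDist K x y ≠ ⊤) ?_ ?_ ?_ hx hy
  · intro x hx
    obtain ⟨r, hr, h⟩ := hK.conical x hx
    filter_upwards [self_mem_nhdsWithin, mem_nhdsWithin_of_mem_nhds (Metric.ball_mem_nhds x hr)]
      with y hy hyx
    rw [geodEDist_of_segment (h y hy hyx)]
    exact edist_ne_top _ _
  · intro x y z _ _ _ h1 h2
    exact ((geodEDist_triangle K x y z).trans_lt (ENNReal.add_lt_top.2
      ⟨h1.lt_top, h2.lt_top⟩)).ne
  · intro x y _ _ h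
    rwa [geodEDist_comm]

lemma ofReal_geodDist (hK : IsTame K) {x y : Plane} (hx : x ∈ K) (hy : y ∈ K) :
    ENNReal.ofReal (geodDist K x y) = geodEDist K x y :=
  ENNReal.ofReal_toReal (hK.geodEDist_ne_top hx hy)

lemma dist_le_geodDist (hK : IsTame K) {x y : Plane} (hx : x ∈ K) (hy : y ∈ K) :
    dist x y ≤ geodDist K x y := by
  rw [dist_edist]
  exact ENNReal.toReal_mono (hK.geodEDist_ne_top hx hy) (edist_le_geodEDist K x y)

lemma _root_.geodDist_comm (K : Set Plane) (x y : Plane) : geodDist K x y = geodDist K y x := by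
  rw [geodDist, geodDist, geodEDist_comm]

lemma geodDist_triangle (hK : IsTame K) {x y z : Plane} (hx : x ∈ K) (hy : y ∈ K) (hz : z ∈ K) :
    geodDist K x z ≤ geodDist K x y + geodDist K y z := by
  rw [geodDist, geodDist, geodDist,
    ← ENNReal.toReal_add (hK.geodEDist_ne_top hx hy) (hK.geodEDist_ne_top hy hz)]
  exact ENNReal.toReal_mono (ENNReal.add_ne_top.2
    ⟨hK.geodEDist_ne_top hx hy, hK.geodEDist_ne_top hy hz⟩) (geodEDist_triangle K x y z)

lemma _root_.geodDist_of_segment {x y : Plane} (h : segment ℝ x y ⊆ K) :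
    geodDist K x y = dist x y := by
  rw [geodDist, geodEDist_of_segment h, dist_edist]

lemma _root_.geodDist_nonneg (K : Set Plane) (x y : Plane) : 0 ≤ geodDist K x y :=
  ENNReal.toReal_nonneg

lemma _root_.geodDist_self {x : Plane} (hx : x ∈ K) : geodDist K x x = 0 := by
  rw [geodDist_of_segment (by simpa using hx), dist_self]

lemma continuousOn_geodDist (hK : IsTame K) :
    ContinuousOn (fun z : Plane × Plane => geodDist K z.1 z.2) (K ×ˢ K) := by
  rintro ⟨x, y⟩ ⟨hx, hy⟩
  rw [Metric.continuousWithinAt_iff]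
  intro ε hε
  obtain ⟨r1, hr1, h1⟩ := hK.conical x hx
  obtain ⟨r2, hr2, h2⟩ := hK.conical y hy
  refine ⟨min (ε / 2) (min r1 r2), by positivity, ?_⟩
  rintro ⟨x', y'⟩ ⟨hx', hy'⟩ hd
  rw [Prod.dist_eq, max_lt_iff] at hd
  simp only at hd hx' hy' hx hy ⊢
  have hd1 := hd.1.trans_le (min_le_left _ _)
  have hd2 := hd.2.trans_le (min_le_left _ _)
  have e1 := geodDist_of_segment (h1 x' hx'
    (hd.1.trans_le ((min_le_right _ _).trans (min_le_left _ _))))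
  have e2 := geodDist_of_segment (h2 y' hy'
    (hd.2.trans_le ((min_le_right _ _).trans (min_le_right _ _))))
  rw [dist_comm] at e1 e2
  have t1 := hK.geodDist_triangle hx' hx hy'
  have t2 := hK.geodDist_triangle hx hy hy'
  have t3 := hK.geodDist_triangle hx hx' hy
  have t4 := hK.geodDist_triangle hx' hy' hy
  have c1 := geodDist_comm K x' x
  have c2 := geodDist_comm K y' y
  rw [Real.dist_eq, abs_lt]
  constructor <;> linarith

lemma continuousOn_geodDist_left (hK : IsTame K) {x : Plane} (hx : x ∈ K) :
    ContinuousOn (fun y => geodDist K x y) K :=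
  hK.continuousOn_geodDist.comp (f := fun y => (x, y)) (by fun_prop) (fun _ hy => ⟨hx, hy⟩)

/-- Every distance up to `geodDist K x y` from `x` is attained by a point between `x` and `y`. -/
lemma exists_between (hK : IsTame K) {x y : Plane} (hx : x ∈ K) (hy : y ∈ K) {r : ℝ} (h0 : 0 ≤ r)
    (hr : r ≤ geodDist K x y) :
    ∃ z ∈ K, geodDist K x z = r ∧ geodDist K z y = geodDist K x y - r := by
  have happrox : ∀ ε > 0, ∃ z ∈ K, geodDist K x z = r ∧
      geodDist K z y < geodDist K x y - r + ε := by
    intro ε hε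
    have hlt : geodEDist K x y < geodEDist K x y + ENNReal.ofReal ε :=
      ENNReal.lt_add_right (hK.geodEDist_ne_top hx hy) (by simpa using hε)
    obtain ⟨γ, hγ⟩ := iInf_lt_iff.1 hlt
    obtain ⟨hγK, hlen⟩ := iInf_lt_iff.1 hγ
    have hcont : ContinuousOn (fun t => geodDist K x (γ.extend t)) (Icc 0 1) :=
      (hK.continuousOn_geodDist_left hx).comp γ.continuous_extend.continuousOn
        (fun t _ => extend_mem hγK t)
    have hmem : r ∈ Icc (geodDist K x (γ.extend 0)) (geodDist K x (γ.extend 1)) := by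
      rw [γ.extend_zero, γ.extend_one, geodDist_self hx]
      exact ⟨h0, hr⟩
    obtain ⟨t, ht, htr⟩ := intermediate_value_Icc zero_le_one hcont hmem
    refine ⟨γ.extend t, extend_mem hγK t, htr, ?_⟩
    have h := (geodEDist_add_add_le hγK ht.1 le_rfl ht.2).trans_lt hlen
    have hz := extend_mem hγK t
    rw [← hK.ofReal_geodDist hx hz, ← hK.ofReal_geodDist hz hz, ← hK.ofReal_geodDist hz hy,
      ← hK.ofReal_geodDist hx hy, ← ENNReal.ofReal_add (geodDist_nonneg _ _ _)
      (geodDist_nonneg _ _ _), ← ENNReal.ofReal_add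
      (add_nonneg (geodDist_nonneg _ _ _) (geodDist_nonneg _ _ _)) (geodDist_nonneg _ _ _), ← ENNReal.ofReal_add (geodDist_nonneg _ _ _) hε.le,
      ENNReal.ofReal_lt_ofReal_iff (by linarith [geodDist_nonneg K x y])] at h
    simp only at htr
    linarith [geodDist_nonneg K (γ.extend t) (γ.extend t)]
  have hcl : IsCompact {z | z ∈ K ∧ geodDist K x z = r} := by
    have := (hK.continuousOn_geodDist_left hx).preimage_isClosed_of_isClosed
      hK.isCompact.isClosed (isClosed_singleton (x := r))
    exact hK.isCompact.of_isClosed_subset this (fun z hz => hz.1)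
  obtain ⟨z0, hz0, hz0r, -⟩ := happrox 1 one_pos
  obtain ⟨z, ⟨hz, hzr⟩, hmin⟩ := hcl.exists_isMinOn ⟨z0, hz0, hz0r⟩
    (f := fun z => geodDist K y z) ((hK.continuousOn_geodDist_left hy).mono (fun z hz => hz.1))
  refine ⟨z, hz, hzr, le_antisymm ?_ ?_⟩
  · refine le_of_forall_pos_lt_add fun ε hε => ?_
    obtain ⟨w, hw, hwr, hlt⟩ := happrox ε hε
    have : geodDist K y z ≤ geodDist K y w := hmin ⟨hw, hwr⟩
    rw [geodDist_comm K z y]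
    rw [geodDist_comm K w y] at hlt
    linarith
  · have := hK.geodDist_triangle hx hz hy
    linarith

end IsTame

/-- `σ` is a geodesic of `K`, parametrized by arc length over `[0, l]`. -/
structure IsGeodesic (K : Set Plane) (σ : ℝ → Plane) (l : ℝ) : Prop where
  mem : ∀ s ∈ Icc 0 l, σ s ∈ K
  dist_eq : ∀ s ∈ Icc 0 l, ∀ t ∈ Icc 0 l, geodDist K (σ s) (σ t) = |s - t|

/-- A finite set of parameters can be mapped isometrically, point by point. -/
lemma IsTame.exists_isometric_finset {K : Set Plane} (hK : IsTame K) {x y : Plane} (hx : x ∈ K)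
    (hy : y ∈ K) (F : Finset ℝ) (hF : ∀ s ∈ F, s ∈ Icc 0 (geodDist K x y)) :
    ∃ σ : ℝ → K, (σ 0 : Plane) = x ∧ (σ (geodDist K x y) : Plane) = y ∧
      ∀ s ∈ F, ∀ t ∈ F, geodDist K (σ s) (σ t) = |s - t| := by
  classical
  set D := geodDist K x y with hD
  have hD0 : 0 ≤ D := geodDist_nonneg K x y
  suffices h : ∃ σ : ℝ → K, (σ 0 : Plane) = x ∧ (σ D : Plane) = y ∧
      ∀ s ∈ insert 0 (insert D F), ∀ t ∈ insert 0 (insert D F),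
        geodDist K (σ s) (σ t) = |s - t| by
    obtain ⟨σ, h0, h1, h⟩ := h
    exact ⟨σ, h0, h1, fun s hs t ht => h s (by simp [hs]) t (by simp [ht])⟩
  induction F using Finset.induction_on with
  | empty =>
    refine ⟨fun s => if s = 0 then ⟨x, hx⟩ else ⟨y, hy⟩, by simp, ?_, ?_⟩
    · by_cases h : D = 0
      · have : dist x y ≤ 0 := by rw [← h]; exact hK.dist_le_geodDist hx hy
        simp [h, dist_le_zero.1 this]
      · simp [h]
    · intro s hs t ht
      simp only [Finset.insert_empty, Finset.mem_insert, Finset.mem_singleton] at hs ht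
      by_cases h : D = 0
      · have hs0 : s = 0 := by rcases hs with h' | h' <;> simp [h', h]
        have ht0 : t = 0 := by rcases ht with h' | h' <;> simp [h', h]
        simp [hs0, ht0, geodDist_self hx]
      · rcases hs with rfl | rfl <;> rcases ht with rfl | rfl
        · simp [geodDist_self hx]
        · simp [h, ← hD, abs_of_nonneg hD0]
        · simp [h, geodDist_comm K y x, ← hD, abs_of_nonneg hD0]
        · simp [h, geodDist_self hy]
  | insert s F hsF ih =>
    obtain ⟨σ, hσ0, hσ1, hσ⟩ := ih (fun t ht => hF t (Finset.mem_insert_of_mem ht))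
    set G := insert 0 (insert D F) with hG
    have hGmem : ∀ t ∈ G, t ∈ Icc 0 D := by
      intro t ht
      simp only [hG, Finset.mem_insert] at ht
      rcases ht with rfl | rfl | ht
      · exact ⟨le_rfl, hD0⟩
      · exact ⟨hD0, le_rfl⟩
      · exact hF t (Finset.mem_insert_of_mem ht)
    have hs := hF s (Finset.mem_insert_self _ _)
    have hins : insert 0 (insert D (insert s F)) = insert s G := by
      rw [hG]
      ext t
      simp only [Finset.mem_insert]
      tauto
    rw [hins]
    by_cases hsG : s ∈ G
    · rw [Finset.insert_eq_of_mem hsG]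
      exact ⟨σ, hσ0, hσ1, hσ⟩
    -- The neighbours `a < s < b` of `s` among the parameters that are already mapped.
    obtain ⟨a, ha, hamax⟩ := (G.filter (· < s)).exists_max_image id ⟨0, by
      have h0 : (0 : ℝ) ∈ G := by simp [hG]
      refine Finset.mem_filter.2 ⟨h0, lt_of_le_of_ne hs.1 ?_⟩
      rintro rfl
      exact hsG h0⟩
    obtain ⟨b, hb, hbmin⟩ := (G.filter (s < ·)).exists_min_image id ⟨D, by
      have h0 : D ∈ G := by simp [hG]
      refine Finset.mem_filter.2 ⟨h0, lt_of_le_of_ne hs.2 ?_⟩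
      rintro rfl
      exact hsG h0⟩
    rw [Finset.mem_filter] at ha hb
    have hab := hσ a ha.1 b hb.1
    rw [abs_of_neg (by linarith [ha.2, hb.2])] at hab
    obtain ⟨z, hz, hz1, hz2⟩ := hK.exists_between (σ a).2 (σ b).2 (r := s - a)
      (by linarith [ha.2]) (by rw [hab]; linarith [hb.2])
    rw [hab] at hz2
    have hz2' : geodDist K z (σ b) = b - s := by linarith
    have key : ∀ t ∈ G, geodDist K z (σ t) = |s - t| := by
      intro t ht
      rcases lt_trichotomy t s with h | h | h
      · have hta : t ≤ a := hamax t (Finset.mem_filter.2 ⟨ht, h⟩)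
        have e1 := hσ t ht a ha.1
        have e2 := hσ t ht b hb.1
        rw [abs_of_nonpos (by linarith)] at e1
        rw [abs_of_nonpos (by linarith [hb.2])] at e2
        rw [abs_of_pos (by linarith), geodDist_comm]
        have t1 := hK.geodDist_triangle (σ t).2 (σ a).2 hz
        have t2 := hK.geodDist_triangle (σ t).2 hz (σ b).2
        linarith
      · exact absurd (h ▸ ht) hsG
      · have hta : b ≤ t := hbmin t (Finset.mem_filter.2 ⟨ht, h⟩)
        have e1 := hσ b hb.1 t ht
        have e2 := hσ a ha.1 t ht
        rw [abs_of_nonpos (by linarith)] at e1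
        rw [abs_of_nonpos (by linarith [ha.2])] at e2
        rw [abs_of_neg (by linarith)]
        have t1 := hK.geodDist_triangle hz (σ b).2 (σ t).2
        have t2 := hK.geodDist_triangle (σ a).2 hz (σ t).2
        linarith
    have hne : ∀ t ∈ G, t ≠ s := fun t ht h => hsG (h ▸ ht)
    have h0G : (0 : ℝ) ∈ G := by simp [hG]
    have hDG : D ∈ G := by simp [hG]
    refine ⟨Function.update σ s ⟨z, hz⟩, ?_, ?_, ?_⟩
    · rw [Function.update_of_ne (hne 0 h0G), hσ0]
    · rw [Function.update_of_ne (hne D hDG), hσ1]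
    · intro t ht u hu
      rcases Finset.mem_insert.1 ht with ht | ht <;> rcases Finset.mem_insert.1 hu with hu | hu
      · rw [ht, hu, Function.update_self]
        simp [geodDist_self hz]
      · rw [ht, Function.update_self, Function.update_of_ne (hne u hu)]
        exact key u hu
      · rw [hu, Function.update_self, Function.update_of_ne (hne t ht), geodDist_comm, abs_sub_comm]
        exact key t ht
      · rw [Function.update_of_ne (hne t ht), Function.update_of_ne (hne u hu)]
        exact hσ t ht u hu

/-- Geodesics exist. By Tychonoff's theorem, it suffices to map finite sets of parameters. -/
lemma IsTame.exists_isGeodesic {K : Set Plane} (hK : IsTame K) {x y : Plane} (hx : x ∈ K)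
    (hy : y ∈ K) : ∃ σ : ℝ → Plane, IsGeodesic K σ (geodDist K x y) ∧ σ 0 = x ∧
      σ (geodDist K x y) = y := by
  classical
  set D := geodDist K x y with hD
  have hD0 : 0 ≤ D := geodDist_nonneg K x y
  have : CompactSpace K := isCompact_iff_compactSpace.1 hK.isCompact
  have hcont : Continuous fun z : K × K => geodDist K (z.1 : Plane) z.2 :=
    hK.continuousOn_geodDist.comp_continuous (f := fun z : K × K => ((z.1 : Plane), (z.2 : Plane)))
      (by fun_prop) (fun z => ⟨z.1.2, z.2.2⟩)
  let C : Icc 0 D × Icc 0 D → Set (ℝ → K) := fun p =>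
    {σ | (σ 0 : Plane) = x ∧ (σ D : Plane) = y ∧
      geodDist K (σ p.1) (σ p.2) = |(p.1 : ℝ) - p.2|}
  have hC : (⋂ p, C p).Nonempty := by
    refine CompactSpace.iInter_nonempty (fun p => ?_) (fun u => ?_)
    · refine IsClosed.inter ?_ (IsClosed.inter ?_ ?_)
      · exact isClosed_eq (continuous_subtype_val.comp (continuous_apply 0)) continuous_const
      · exact isClosed_eq (continuous_subtype_val.comp (continuous_apply D)) continuous_const
      · exact isClosed_eq (hcont.comp (g := fun z : K × K => geodDist K (z.1 : Plane) z.2)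
          (f := fun σ : ℝ → K => (σ p.1, σ p.2))
          ((continuous_apply (p.1 : ℝ)).prodMk (continuous_apply (p.2 : ℝ)))) continuous_const
    · obtain ⟨σ, h0, h1, h⟩ := hK.exists_isometric_finset hx hy
        (u.image (fun p => (p.1 : ℝ)) ∪ u.image (fun p => (p.2 : ℝ))) (by
          intro s hs
          rcases Finset.mem_union.1 hs with hs | hs <;>
          obtain ⟨p, -, rfl⟩ := Finset.mem_image.1 hs
          exacts [p.1.2, p.2.2])
      refine ⟨σ, mem_iInter₂.2 fun p hp => ⟨h0, h1, h _ ?_ _ ?_⟩⟩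
      · exact Finset.mem_union_left _ (Finset.mem_image_of_mem _ hp)
      · exact Finset.mem_union_right _ (Finset.mem_image_of_mem _ hp)
  obtain ⟨σ, hσ⟩ := hC
  rw [mem_iInter] at hσ
  have h00 := hσ (⟨0, le_rfl, hD0⟩, ⟨0, le_rfl, hD0⟩)
  exact ⟨fun s => σ s, ⟨fun s _ => (σ s).2, fun s hs t ht => (hσ (⟨s, hs⟩, ⟨t, ht⟩)).2.2⟩,
    h00.1, h00.2.1⟩

namespace IsGeodesic

variable {K : Set Plane} {σ : ℝ → Plane} {l : ℝ}

lemma reverse (hσ : IsGeodesic K σ l) : IsGeodesic K (fun s => σ (l - s)) l := by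
  have hm : ∀ s ∈ Icc 0 l, l - s ∈ Icc 0 l := fun s hs =>
    ⟨by linarith [hs.2], by linarith [hs.1]⟩
  refine ⟨fun s hs => hσ.mem _ (hm s hs), fun s hs t ht => ?_⟩
  rw [hσ.dist_eq _ (hm s hs) _ (hm t ht), abs_sub_comm]
  congr 1
  ring

lemma dist_le (hσ : IsGeodesic K σ l) (hK : IsTame K) {s t : ℝ} (hs : s ∈ Icc 0 l)
    (ht : t ∈ Icc 0 l) : dist (σ s) (σ t) ≤ |s - t| := by
  rw [← hσ.dist_eq s hs t ht]
  exact hK.dist_le_geodDist (hσ.mem s hs) (hσ.mem t ht)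

lemma continuousOn (hσ : IsGeodesic K σ l) (hK : IsTame K) : ContinuousOn σ (Icc 0 l) := by
  have : LipschitzOnWith 1 σ (Icc 0 l) := LipschitzOnWith.of_dist_le_mul fun s hs t ht => by
    simpa [Real.dist_eq] using hσ.dist_le hK hs ht
  exact this.continuousOn

lemma injOn (hσ : IsGeodesic K σ l) : InjOn σ (Icc 0 l) := by
  intro s hs t ht hst
  have := hσ.dist_eq s hs t ht
  rw [hst, geodDist_self (hσ.mem t ht)] at this
  exact sub_eq_zero.1 (abs_eq_zero.1 this.symm)

/-- A geodesic is straight between two of its points that see each other. -/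
lemma dist_eq_of_segment (hσ : IsGeodesic K σ l) (hK : IsTame K) {a b s : ℝ} (ha : a ∈ Icc 0 l)
    (hb : b ∈ Icc 0 l) (hseg : segment ℝ (σ a) (σ b) ⊆ K) (hs : s ∈ Icc a b) :
    dist (σ a) (σ b) = b - a ∧ dist (σ a) (σ s) = s - a ∧ dist (σ s) (σ b) = b - s := by
  have hsl : s ∈ Icc 0 l := ⟨ha.1.trans hs.1, hs.2.trans hb.2⟩
  have h0 : dist (σ a) (σ b) = b - a := by
    rw [← geodDist_of_segment hseg, hσ.dist_eq a ha b hb, abs_of_nonpos (by linarith [hs.1, hs.2])]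
    ring
  have h1 := hσ.dist_le hK ha hsl
  have h2 := hσ.dist_le hK hsl hb
  rw [abs_of_nonpos (by linarith [hs.1])] at h1
  rw [abs_of_nonpos (by linarith [hs.2])] at h2
  have h3 := dist_triangle (σ a) (σ s) (σ b)
  exact ⟨h0, by linarith, by linarith⟩

lemma eq_add_smul_of_segment (hσ : IsGeodesic K σ l) (hK : IsTame K) {a b : ℝ} (ha : a ∈ Icc 0 l)
    (hb : b ∈ Icc 0 l) (hab : a < b) (hseg : segment ℝ (σ a) (σ b) ⊆ K) {s : ℝ}
    (hs : s ∈ Icc a b) : σ s = σ a + (s - a) • ((b - a)⁻¹ • (σ b - σ a)) := by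
  obtain ⟨h0, h1, h2⟩ := hσ.dist_eq_of_segment hK ha hb hseg hs
  have hba : 0 < b - a := by linarith
  have := eq_lineMap_of_dist_eq_mul_of_dist_eq_mul (r := (s - a) / (b - a)) (x := σ a) (y := σ s)
    (z := σ b) (by rw [h0, h1]; field_simp) (by rw [h0, h2]; field_simp; ring)
  rw [this, AffineMap.lineMap_apply, vsub_eq_sub, vadd_eq_add, smul_smul, div_eq_mul_inv, add_comm]

/-- A geodesic starts straight. -/
lemma exists_direction (hσ : IsGeodesic K σ l) (hK : IsTame K) {a : ℝ} (ha : a ∈ Ico 0 l) :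
    ∃ u : Plane, ‖u‖ = 1 ∧ ∃ ε > 0, a + ε ≤ l ∧ ∀ τ ∈ Icc 0 ε, σ (a + τ) = σ a + τ • u := by
  have ha' : a ∈ Icc 0 l := ⟨ha.1, ha.2.le⟩
  obtain ⟨r, hr, h⟩ := hK.conical _ (hσ.mem a ha')
  set ε := min (r / 2) (l - a) with hε
  have hε0 : 0 < ε := lt_min (by linarith) (by linarith [ha.2])
  have hεl : a + ε ≤ l := by linarith [min_le_right (r / 2) (l - a)]
  have hεr : ε < r := (min_le_left _ _).trans_lt (by linarith)
  have hb : a + ε ∈ Icc 0 l := ⟨by linarith [ha.1], hεl⟩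
  have hd : dist (σ (a + ε)) (σ a) < r := by
    refine (hσ.dist_le hK hb ha').trans_lt ?_
    rwa [add_sub_cancel_left, abs_of_pos hε0]
  have hseg := h _ (hσ.mem _ hb) hd
  refine ⟨ε⁻¹ • (σ (a + ε) - σ a), ?_, ε, hε0, hεl, fun τ hτ => ?_⟩
  · have := (hσ.dist_eq_of_segment hK ha' hb hseg (s := a + ε) ⟨by linarith, le_rfl⟩).1
    rw [norm_smul, norm_inv, Real.norm_of_nonneg hε0.le, ← dist_eq_norm, dist_comm, this,
      add_sub_cancel_left, inv_mul_cancel₀ hε0.ne']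
  · have := hσ.eq_add_smul_of_segment hK ha' hb (by linarith) hseg (s := a + τ)
      ⟨by linarith [hτ.1], by linarith [hτ.2]⟩
    rwa [add_sub_cancel_left, add_sub_cancel_left] at this

lemma exists_direction_left (hσ : IsGeodesic K σ l) (hK : IsTame K) {a : ℝ} (ha : a ∈ Ioc 0 l) :
    ∃ u : Plane, ‖u‖ = 1 ∧ ∃ ε > 0, ε ≤ a ∧ ∀ τ ∈ Icc 0 ε, σ (a - τ) = σ a + τ • u := by
  obtain ⟨u, hu, ε, hε, hle, h⟩ := hσ.reverse.exists_direction hK (a := l - a)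
    ⟨by linarith [ha.2], by linarith [ha.1]⟩
  refine ⟨u, hu, ε, hε, by linarith, fun τ hτ => ?_⟩
  have := h τ hτ
  simp only [sub_sub_cancel] at this
  rw [← this]
  congr 1
  ring

end IsGeodesic

/-! ### Plane geometry -/

/-- The determinant of two vectors of the plane. -/
def cross (a b : Plane) : ℝ := a 0 * b 1 - a 1 * b 0

lemma inner_eq_coord (a b : Plane) : inner ℝ a b = a 0 * b 0 + a 1 * b 1 := by
  rw [PiLp.inner_apply, Fin.sum_univ_two]
  simp [mul_comm]

lemma cross_swap (a b : Plane) : cross a b = -cross b a := by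
  simp only [cross]; ring

lemma inner_sq_add_cross_sq (a b : Plane) :
    inner ℝ a b ^ 2 + cross a b ^ 2 = ‖a‖ ^ 2 * ‖b‖ ^ 2 := by
  rw [← real_inner_self_eq_norm_sq, ← real_inner_self_eq_norm_sq, inner_eq_coord, inner_eq_coord,
    inner_eq_coord, cross]
  ring

lemma eq_or_eq_neg_of_cross_eq_zero {a b : Plane} (ha : ‖a‖ = 1) (hb : ‖b‖ = 1)
    (h : cross a b = 0) : a = b ∨ a = -b := by
  have h1 := inner_sq_add_cross_sq a b
  rw [ha, hb, h] at h1
  have h2 : (inner ℝ a b - 1) * (inner ℝ a b + 1) = 0 := by linarith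
  rcases mul_eq_zero.1 h2 with h3 | h3
  · left
    have := norm_sub_sq_real a b
    rw [ha, hb, sub_eq_zero.1 h3] at this
    norm_num at this
    exact sub_eq_zero.1 this
  · right
    have := norm_add_sq_real a b
    rw [ha, hb, eq_neg_of_add_eq_zero_left h3] at this
    norm_num at this
    exact eq_neg_of_add_eq_zero_left this

lemma cross_eq_zero_of_cross_eq_zero {d a b : Plane} (hd : d ≠ 0) (ha : cross d a = 0)
    (hb : cross d b = 0) : cross a b = 0 := by
  have h0 : d 0 * cross a b = 0 := by
    simp only [cross] at *
    linear_combination a 0 * hb - b 0 * ha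
  have h1 : d 1 * cross a b = 0 := by
    simp only [cross] at *
    linear_combination a 1 * hb - b 1 * ha
  by_contra h
  refine hd ?_
  ext i
  fin_cases i
  · exact (mul_eq_zero.1 h0).resolve_right h
  · exact (mul_eq_zero.1 h1).resolve_right h

/-! ### Crossing a region -/

lemma tendsto_ray (v e : Plane) {Z : Set Plane} {ε : ℝ} (hε : 0 < ε)
    (h : ∀ τ ∈ Ioc 0 ε, v + τ • e ∈ Z) :
    Filter.Tendsto (fun τ : ℝ => v + τ • e) (nhdsWithin 0 (Ioi 0)) (nhdsWithin v Z) := by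
  refine tendsto_nhdsWithin_iff.2 ⟨?_, ?_⟩
  · have : Filter.Tendsto (fun τ : ℝ => v + τ • e) (nhds 0) (nhds (v + (0 : ℝ) • e)) :=
      Continuous.tendsto (by fun_prop) 0
    rw [zero_smul, add_zero] at this
    exact this.mono_left nhdsWithin_le_nhds
  · filter_upwards [Ioc_mem_nhdsGT hε] with τ hτ using h τ hτ

/-- A connected subset of `K` that reaches a point `v` from both sides of a segment must meet the
segment elsewhere if both ends of the segment are outside `K` and not enclosed by `K`. Otherwise
the function `log (z - w) - log (z - r)`, which is continuous on `K`, and the principal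
logarithm of `(z - w) / (z - r)`, which jumps by `2 π i` across the segment, would differ
by a constant. -/
lemma crossing {K Z : Set Plane} {v k e₁ e₂ : Plane} {N ε : ℝ} (hN : 0 < N) (hε : 0 < ε)
    (hw : HasLog K (v + k)) (hr : HasLog K (v - N • k)) (hv : v ∈ K)
    (h1 : 0 < cross k e₁) (h2 : cross k e₂ < 0) (hZK : Z ⊆ K) (hZ : IsPreconnected Z)
    (hmiss : ∀ s ∈ Icc (-N) 1, v + s • k ∉ Z)
    (hZ1 : ∀ τ ∈ Ioc 0 ε, v + τ • e₁ ∈ Z) (hZ2 : ∀ τ ∈ Ioc 0 ε, v + τ • e₂ ∈ Z) : False := by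
  obtain ⟨A, hA, hAe⟩ := hw
  obtain ⟨B, hB, hBe⟩ := hr
  set g : Plane → ℂ := fun z => (planeToComplex z - planeToComplex (v + k)) /
    (planeToComplex z - planeToComplex (v - N • k)) with hg
  have hBne : ∀ z ∈ K, planeToComplex z - planeToComplex (v - N • k) ≠ 0 := fun z hz => by
    rw [← hBe z hz]; exact Complex.exp_ne_zero _
  have hgK : ContinuousOn g K := by
    refine ContinuousOn.div ?_ ?_ hBne <;>
    exact (continuous_planeToComplex.sub continuous_const).continuousOn
  have hk0 : planeToComplex k ≠ 0 := by
    intro h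
    have h3 : k 0 = 0 := congrArg Complex.re h
    have h4 : k 1 = 0 := congrArg Complex.im h
    simp [cross, h3, h4] at h1
  have hslit : ∀ z ∈ Z, g z ∈ Complex.slitPlane := by
    intro z hz
    rw [Complex.mem_slitPlane_iff_not_le_zero]
    intro hle
    obtain ⟨c, hc0, hc⟩ : ∃ c : ℝ, 0 ≤ c ∧ g z = ((-c : ℝ) : ℂ) :=
      ⟨-(g z).re, by linarith [(Complex.le_def.1 hle).1.trans_eq Complex.zero_re], by
        apply Complex.ext
        · simp
        · simpa using (Complex.le_def.1 hle).2⟩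
    rw [hg] at hc
    simp only at hc
    rw [div_eq_iff (hBne z (hZK hz))] at hc
    have hre := congrArg Complex.re hc
    have him := congrArg Complex.im hc
    simp [planeToComplex] at hre him
    refine hmiss ((1 - c * N) / (1 + c)) ⟨?_, ?_⟩ ?_
    · rw [le_div_iff₀ (by linarith)]; nlinarith
    · rw [div_le_iff₀ (by linarith)]; nlinarith
    · convert hz using 1
      ext i
      fin_cases i
      · simp; field_simp; linarith
      · simp; field_simp; linarith
  have hconst := fun x hx y hy => log_sub_log_const hZ (L := fun z => A z - B z)
    (M := fun z => Complex.log (g z)) ((hA.sub hB).mono hZK)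
    ((hgK.mono hZK).clog hslit) (fun z hz => by
      rw [Complex.exp_sub, hAe z (hZK hz), hBe z (hZK hz),
        Complex.exp_log (Complex.slitPlane_ne_zero (hslit z hz))]) (x := x) (y := y) hx hy
  have hgv : g v = ((-N⁻¹ : ℝ) : ℂ) := by
    simp only [hg]
    rw [← planeToComplex_sub, ← planeToComplex_sub]
    have e1 : planeToComplex (v - (v + k)) = -planeToComplex k := by
      apply Complex.ext <;> simp [planeToComplex]
    have e2 : planeToComplex (v - (v - N • k)) = N * planeToComplex k := by
      apply Complex.ext <;> simp [planeToComplex]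
    have hNC : (N : ℂ) ≠ 0 := by exact_mod_cast hN.ne'
    rw [e1, e2]
    push_cast
    field_simp
  have hre : (g v).re < 0 := by rw [hgv, Complex.ofReal_re]; simpa using hN
  have him : (g v).im = 0 := by rw [hgv, Complex.ofReal_im]
  -- The sign of the imaginary part of `g` tells the two sides of the segment apart.
  have hsign : ∀ e : Plane, ∀ τ : ℝ, (g (v + τ • e)).im =
      τ * (N + 1) * cross k e / Complex.normSq (planeToComplex (τ • e + N • k)) := by
    intro e τ
    simp only [hg]
    rw [← planeToComplex_sub, ← planeToComplex_sub]
    have e1 : v + τ • e - (v + k) = τ • e - k := by abel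
    have e2 : v + τ • e - (v - N • k) = τ • e + N • k := by abel
    rw [e1, e2, Complex.div_im]
    simp only [planeToComplex, cross, PiLp.add_apply, PiLp.sub_apply, PiLp.smul_apply, smul_eq_mul]
    ring
  have hAB : ContinuousWithinAt (fun z => A z - B z) K v := (hA.sub hB) v hv
  have ht1 := tendsto_ray v e₁ hε hZ1
  have ht2 := tendsto_ray v e₂ hε hZ2
  have hl1 : Filter.Tendsto (fun τ : ℝ => (A (v + τ • e₁) - B (v + τ • e₁)) -
      Complex.log (g (v + τ • e₁))) (nhdsWithin 0 (Ioi 0))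
      (nhds ((A v - B v) - (Real.log ‖g v‖ + Real.pi * Complex.I))) := by
    refine Filter.Tendsto.sub (hAB.tendsto.comp (ht1.mono_right (nhdsWithin_mono _ hZK))) ?_
    refine (Complex.tendsto_log_nhdsWithin_im_nonneg_of_re_neg_of_im_zero hre him).comp ?_
    refine tendsto_nhdsWithin_iff.2
      ⟨(hgK v hv).tendsto.comp (ht1.mono_right (nhdsWithin_mono _ hZK)), ?_⟩
    filter_upwards [self_mem_nhdsWithin] with τ hτ
    have hτ' : (0 : ℝ) < τ := hτ
    change 0 ≤ (g (v + τ • e₁)).im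
    rw [hsign]
    have := Complex.normSq_nonneg (planeToComplex (τ • e₁ + N • k))
    positivity
  have hl2 : Filter.Tendsto (fun τ : ℝ => (A (v + τ • e₂) - B (v + τ • e₂)) -
      Complex.log (g (v + τ • e₂))) (nhdsWithin 0 (Ioi 0))
      (nhds ((A v - B v) - (Real.log ‖g v‖ - Real.pi * Complex.I))) := by
    refine Filter.Tendsto.sub (hAB.tendsto.comp (ht2.mono_right (nhdsWithin_mono _ hZK))) ?_
    refine (Complex.tendsto_log_nhdsWithin_im_neg_of_re_neg_of_im_zero hre him).comp ?_
    refine tendsto_nhdsWithin_iff.2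
      ⟨(hgK v hv).tendsto.comp (ht2.mono_right (nhdsWithin_mono _ hZK)), ?_⟩
    filter_upwards [Ioc_mem_nhdsGT hε] with τ hτ
    rw [hsign]
    refine div_neg_of_neg_of_pos ?_ ?_
    · exact mul_neg_of_pos_of_neg (mul_pos hτ.1 (by linarith)) h2
    · rw [Complex.normSq_pos]
      have := hBne _ (hZK (hZ2 τ hτ))
      rw [← planeToComplex_sub] at this
      convert this using 2
      abel
  have hlim := tendsto_nhds_unique_of_eventuallyEq hl1 hl2 (by
    filter_upwards [Ioc_mem_nhdsGT hε] with τ hτ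
    exact hconst _ (hZ1 τ hτ) _ (hZ2 τ hτ))
  have : (2 * Real.pi * Complex.I : ℂ) = 0 := by linear_combination -hlim
  exact Complex.two_pi_I_ne_zero this

/-- The angle spanned by `a` and `b` at `x` is free of obstacles near `x`. -/
def Free (K : Set Plane) (x a b : Plane) : Prop :=
  ∃ δ > 0, ∀ α β : ℝ, 0 ≤ α → 0 ≤ β → α + β ≤ δ → x + α • a + β • b ∈ K

lemma Free.symm {K : Set Plane} {x a b : Plane} (h : Free K x a b) : Free K x b a := by
  obtain ⟨δ, hδ, h⟩ := h
  refine ⟨δ, hδ, fun α β hα hβ hs => ?_⟩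
  rw [add_right_comm]
  exact h β α hβ hα (by linarith)

lemma Free.smul_right {K : Set Plane} {x a b : Plane} (h : Free K x a b) {c : ℝ} (hc : 0 < c) :
    Free K x a (c • b) := by
  obtain ⟨δ, hδ, h⟩ := h
  refine ⟨δ / (1 + c), by positivity, fun α β hα hβ hs => ?_⟩
  rw [smul_smul]
  rw [le_div_iff₀ (by positivity)] at hs
  exact h α (β * c) hα (by positivity) (by nlinarith [mul_nonneg hα hc.le])

/-- At a point where a linear functional takes its maximum over a closed curve in `K`, the angle
spanned by the curve is free of obstacles: an obstacle would be enclosed by the curve, since the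
ray from the obstacle through the point leaves the curve behind. -/
lemma IsTame.free_of_max {K : Set Plane} (hK : IsTame K) {v e₁ e₂ ξ : Plane} {ε₁ ε₂ : ℝ}
    (hε₁ : 0 < ε₁) (hε₂ : 0 < ε₂) (he₁ : ∀ τ ∈ Icc 0 ε₁, v + τ • e₁ ∈ K)
    (he₂ : ∀ τ ∈ Icc 0 ε₂, v + τ • e₂ ∈ K) {Z : Set Plane} (hZK : Z ⊆ K) (hZc : IsCompact Z)
    (hZ : IsPreconnected Z) (h1 : v + ε₁ • e₁ ∈ Z) (h2 : v + ε₂ • e₂ ∈ Z) (hv : v ∉ Z)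
    (hξ : ∀ z ∈ Z, inner ℝ ξ z ≤ inner ℝ ξ v) (hlt : inner ℝ ξ e₁ + inner ℝ ξ e₂ < 0)
    (hc : cross e₁ e₂ ≠ 0) : Free K v e₁ e₂ := by
  wlog hpos : cross e₁ e₂ < 0 generalizing e₁ e₂ ε₁ ε₂
  · exact (this hε₂ hε₁ he₂ he₁ h2 h1 (by linarith) (by rw [cross_swap]; exact neg_ne_zero.2 hc)
      (by rw [cross_swap]; have := lt_of_le_of_ne (not_lt.1 hpos) hc.symm; linarith)).symm
  obtain ⟨ρ, hρ, hball⟩ := Metric.isOpen_iff.1 hZc.isClosed.isOpen_compl v hv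
  set δ := min (min ε₁ ε₂) (ρ / (‖e₁‖ + ‖e₂‖ + 1)) with hδ
  have hnn : 0 < ‖e₁‖ + ‖e₂‖ + 1 := by positivity
  have hδ0 : 0 < δ := lt_min (lt_min hε₁ hε₂) (by positivity)
  have hδ1 : δ ≤ ε₁ := (min_le_left _ _).trans (min_le_left _ _)
  have hδ2 : δ ≤ ε₂ := (min_le_left _ _).trans (min_le_right _ _)
  have hδ3 : δ * (‖e₁‖ + ‖e₂‖ + 1) ≤ ρ := (le_div_iff₀ hnn).1 (min_le_right _ _)
  have hvK : v ∈ K := by simpa using he₁ 0 ⟨le_rfl, hε₁.le⟩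
  refine ⟨δ, hδ0, fun α β hα hβ hs => ?_⟩
  by_contra hwK
  have hα0 : 0 < α := by
    refine lt_of_le_of_ne hα ?_
    rintro rfl
    refine hwK ?_
    simpa using he₂ β ⟨hβ, by linarith⟩
  have hβ0 : 0 < β := by
    refine lt_of_le_of_ne hβ ?_
    rintro rfl
    refine hwK ?_
    simpa using he₁ α ⟨hα, by linarith⟩
  set k := α • e₁ + β • e₂ with hk
  have hck1 : cross k e₁ = -β * cross e₁ e₂ := by
    simp only [hk, cross, PiLp.add_apply, PiLp.smul_apply, smul_eq_mul]; ring
  have hck2 : cross k e₂ = α * cross e₁ e₂ := by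
    simp only [hk, cross, PiLp.add_apply, PiLp.smul_apply, smul_eq_mul]; ring
  have hk0 : k ≠ 0 := by
    intro h
    rw [h] at hck2
    have : α * cross e₁ e₂ = 0 := by rw [← hck2]; simp [cross]
    rcases mul_eq_zero.1 this with h | h
    · exact hα0.ne' h
    · exact hc h
  have hkn : 0 < ‖k‖ := norm_pos_iff.2 hk0
  have hkρ : ‖k‖ < ρ := by
    have : ‖k‖ ≤ α * ‖e₁‖ + β * ‖e₂‖ := by
      refine (norm_add_le _ _).trans ?_
      rw [norm_smul, norm_smul, Real.norm_of_nonneg hα, Real.norm_of_nonneg hβ]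
    have h3 := norm_nonneg e₁
    have h4 := norm_nonneg e₂
    nlinarith
  obtain ⟨R, hR⟩ := hK.isCompact.isBounded.exists_norm_le
  have hR0 : 0 ≤ R := (norm_nonneg v).trans (hR v hvK)
  set N := (R + ‖v‖ + 1) / ‖k‖ with hN
  have hN0 : 0 < N := by positivity
  have hrK : v - N • k ∉ K := by
    intro h
    have h3 := hR _ h
    have h4 : ‖N • k‖ = R + ‖v‖ + 1 := by
      rw [norm_smul, Real.norm_of_nonneg hN0.le, hN, div_mul_cancel₀ _ hkn.ne']
    have h5 := norm_sub_norm_le (N • k) v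
    rw [norm_sub_rev] at h5
    linarith
  have hξ1 : inner ℝ ξ e₁ ≤ 0 := by
    have := hξ _ h1
    rw [inner_add_right, inner_smul_right] at this
    nlinarith
  have hξ2 : inner ℝ ξ e₂ ≤ 0 := by
    have := hξ _ h2
    rw [inner_add_right, inner_smul_right] at this
    nlinarith
  have hξk : inner ℝ ξ k < 0 := by
    rw [hk, inner_add_right, inner_smul_right, inner_smul_right]
    rcases hξ1.lt_or_eq with h | h
    · nlinarith
    · have : inner ℝ ξ e₂ < 0 := by linarith
      nlinarith
  have hray : ∀ (e : Plane) (ε : ℝ), IsPreconnected ((fun τ : ℝ => v + τ • e) '' Ioc 0 ε) :=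
    fun e ε => isPreconnected_Ioc.image _ (by fun_prop)
  have hZ1 : IsPreconnected (Z ∪ (fun τ : ℝ => v + τ • e₁) '' Ioc 0 ε₁) :=
    hZ.union _ h1 ⟨ε₁, ⟨hε₁, le_rfl⟩, rfl⟩ (hray _ _)
  have hZ2 : IsPreconnected (Z ∪ (fun τ : ℝ => v + τ • e₁) '' Ioc 0 ε₁ ∪
      (fun τ : ℝ => v + τ • e₂) '' Ioc 0 ε₂) :=
    hZ1.union _ (Or.inl h2) ⟨ε₂, ⟨hε₂, le_rfl⟩, rfl⟩ (hray _ _)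
  refine crossing (v := v) (k := k) (e₁ := e₁) (e₂ := e₂) (N := N) (ε := min ε₁ ε₂) (K := K)
    hN0 (lt_min hε₁ hε₂) (hK.hasLog _ (by rwa [hk, ← add_assoc])) (hK.hasLog _ hrK) hvK
    (by rw [hck1]; nlinarith) (by rw [hck2]; nlinarith) ?_ hZ2 ?_ ?_ ?_
  · refine union_subset (union_subset hZK ?_) ?_
    · rintro _ ⟨τ, hτ, rfl⟩
      exact he₁ τ ⟨hτ.1.le, hτ.2⟩
    · rintro _ ⟨τ, hτ, rfl⟩
      exact he₂ τ ⟨hτ.1.le, hτ.2⟩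
  · rintro s hs ((hmem | ⟨τ, hτ, hmem⟩) | ⟨τ, hτ, hmem⟩)
    · rcases lt_trichotomy s 0 with h | h | h
      · have := hξ _ hmem
        rw [inner_add_right, inner_smul_right] at this
        nlinarith
      · rw [h, zero_smul, add_zero] at hmem
        exact hv hmem
      · refine hball ?_ hmem
        rw [Metric.mem_ball, dist_eq_norm, add_sub_cancel_left, norm_smul,
          Real.norm_of_nonneg h.le]
        nlinarith [hs.2]
    · have h3 : τ • e₁ = s • k := add_left_cancel hmem
      have h4 : cross k (τ • e₁) = 0 := by
        rw [h3]; simp only [cross, PiLp.smul_apply, smul_eq_mul]; ring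
      have h5 : cross k (τ • e₁) = τ * cross k e₁ := by
        simp only [cross, PiLp.smul_apply, smul_eq_mul]; ring
      rw [h5, hck1] at h4
      have := hτ.1
      have : 0 < τ * (-β * cross e₁ e₂) := mul_pos hτ.1 (by nlinarith)
      linarith
    · have h3 : τ • e₂ = s • k := add_left_cancel hmem
      have h4 : cross k (τ • e₂) = 0 := by
        rw [h3]; simp only [cross, PiLp.smul_apply, smul_eq_mul]; ring
      have h5 : cross k (τ • e₂) = τ * cross k e₂ := by
        simp only [cross, PiLp.smul_apply, smul_eq_mul]; ring
      rw [h5, hck2] at h4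
      have : τ * (α * cross e₁ e₂) < 0 := mul_neg_of_pos_of_neg hτ.1 (by nlinarith)
      linarith
  · intro τ hτ
    exact Or.inl (Or.inr ⟨τ, ⟨hτ.1, hτ.2.trans (min_le_left _ _)⟩, rfl⟩)
  · intro τ hτ
    exact Or.inr ⟨τ, ⟨hτ.1, hτ.2.trans (min_le_right _ _)⟩, rfl⟩

/-- If the angle at `x` is free, then points on its legs see each other. -/
lemma Free.exists_segment {K : Set Plane} {x a b : Plane} (h : Free K x a b) :
    ∃ δ > 0, ∀ α β : ℝ, α ∈ Icc 0 δ → β ∈ Icc 0 δ → segment ℝ (x + α • a) (x + β • b) ⊆ K := by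
  obtain ⟨δ, hδ, h⟩ := h
  refine ⟨δ, hδ, fun α β hα hβ => ?_⟩
  rintro _ ⟨p, q, hp, hq, hpq, rfl⟩
  have : p • (x + α • a) + q • (x + β • b) = x + (p * α) • a + (q * β) • b := by
    have hx : x = (p + q) • x := by rw [hpq, one_smul]
    conv_rhs => rw [hx]
    module
  rw [this]
  exact h _ _ (mul_nonneg hp hα.1) (mul_nonneg hq hβ.1) (by nlinarith [hα.2, hβ.2])

namespace IsGeodesic

variable {K : Set Plane} {σ : ℝ → Plane} {l : ℝ}

/-- A geodesic passes straight through an angle that is free of obstacles. -/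
lemma eq_neg_of_free (hσ : IsGeodesic K σ l) {s ε : ℝ} {a b : Plane} (ha : ‖a‖ = 1) (hb : ‖b‖ = 1)
    (hε : 0 < ε) (h0 : ε ≤ s) (hl : s + ε ≤ l) (hσa : ∀ τ ∈ Icc 0 ε, σ (s - τ) = σ s + τ • a)
    (hσb : ∀ τ ∈ Icc 0 ε, σ (s + τ) = σ s + τ • b) (hfree : Free K (σ s) a b) : a = -b := by
  obtain ⟨δ, hδ, h⟩ := hfree.exists_segment
  set τ := min δ ε with hτ
  have hτ0 : 0 < τ := lt_min hδ hε
  have hτε : τ ∈ Icc 0 ε := ⟨hτ0.le, min_le_right _ _⟩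
  have hseg := h τ τ ⟨hτ0.le, min_le_left _ _⟩ ⟨hτ0.le, min_le_left _ _⟩
  have h1 := geodDist_of_segment hseg
  rw [← hσa τ hτε, ← hσb τ hτε, hσ.dist_eq _ ⟨by linarith [hτε.2], by linarith [hτε.2]⟩ _
    ⟨by linarith [hτε.2], by linarith [hτε.2]⟩, hσa τ hτε, hσb τ hτε, dist_eq_norm,
    abs_of_neg (by linarith), add_sub_add_left_eq_sub, ← smul_sub, norm_smul,
    Real.norm_of_nonneg hτ0.le] at h1
  have h2 : ‖a - b‖ = 2 := by
    have : τ * ‖a - b‖ = τ * 2 := by linarith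
    exact mul_left_cancel₀ hτ0.ne' this
  have h3 := norm_sub_sq_real a b
  have h4 := norm_add_sq_real a b
  rw [ha, hb, h2] at h3
  rw [ha, hb] at h4
  have h5 : ‖a + b‖ ^ 2 = 0 := by linarith
  exact eq_neg_of_add_eq_zero_left (norm_eq_zero.1 (pow_eq_zero_iff two_ne_zero |>.1 h5))

lemma restrict (hσ : IsGeodesic K σ l) {l' : ℝ} (h : l' ≤ l) : IsGeodesic K σ l' :=
  ⟨fun s hs => hσ.mem s ⟨hs.1, hs.2.trans h⟩,
    fun s hs t ht => hσ.dist_eq s ⟨hs.1, hs.2.trans h⟩ t ⟨ht.1, ht.2.trans h⟩⟩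

lemma isPreconnected_image (hσ : IsGeodesic K σ l) (hK : IsTame K) {a b : ℝ} (ha : 0 ≤ a)
    (hb : b ≤ l) : IsPreconnected (σ '' Icc a b) :=
  isPreconnected_Icc.image _ ((hσ.continuousOn hK).mono (Icc_subset_Icc ha hb))

lemma isCompact_image (hσ : IsGeodesic K σ l) (hK : IsTame K) {a b : ℝ} (ha : 0 ≤ a)
    (hb : b ≤ l) : IsCompact (σ '' Icc a b) :=
  isCompact_Icc.image_of_continuousOn ((hσ.continuousOn hK).mono (Icc_subset_Icc ha hb))

lemma image_subset (hσ : IsGeodesic K σ l) {a b : ℝ} (ha : 0 ≤ a) (hb : b ≤ l) :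
    σ '' Icc a b ⊆ K := by
  rintro _ ⟨s, hs, rfl⟩
  exact hσ.mem s ⟨ha.trans hs.1, hs.2.trans hb⟩

/-- If a linear functional takes its maximum over a closed curve inside a geodesic arc of the curve,
then it is locally constant there, because a bend would be free of obstacles. -/
lemma eventually_eq_of_max (hσ : IsGeodesic K σ l) (hK : IsTame K) {Y : Set Plane} (hYK : Y ⊆ K)
    (hYc : IsCompact Y) (hY : IsPreconnected Y) (h0 : σ 0 ∈ Y) (hl : σ l ∈ Y)
    (hdisj : ∀ s ∈ Ioo 0 l, σ s ∉ Y) {ξ : Plane} {M : ℝ} (hYM : ∀ z ∈ Y, inner ℝ ξ z ≤ M)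
    (hσM : ∀ s ∈ Icc 0 l, inner ℝ ξ (σ s) ≤ M) {s : ℝ} (hs : s ∈ Ioo 0 l)
    (hM : inner ℝ ξ (σ s) = M) :
    ∃ ε > 0, s + ε ≤ l ∧ ∀ τ ∈ Icc 0 ε, inner ℝ ξ (σ (s + τ)) = M := by
  obtain ⟨b, hb, ε₂, hε₂, hle₂, hσb⟩ := hσ.exists_direction hK (a := s) ⟨hs.1.le, hs.2⟩
  obtain ⟨a, ha, ε₁, hε₁, hle₁, hσa⟩ := hσ.exists_direction_left hK (a := s) ⟨hs.1, hs.2.le⟩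
  set ε := min ε₁ ε₂ with hεdef
  have hε : 0 < ε := lt_min hε₁ hε₂
  have h1 : ε ≤ ε₁ := min_le_left _ _
  have h2 : ε ≤ ε₂ := min_le_right _ _
  have hξb : inner ℝ ξ b ≤ 0 := by
    have := hσM (s + ε) ⟨by linarith [hs.1], by linarith⟩
    rw [hσb ε ⟨hε.le, h2⟩, inner_add_right, inner_smul_right, hM] at this
    nlinarith
  have hξa : inner ℝ ξ a ≤ 0 := by
    have := hσM (s - ε) ⟨by linarith, by linarith [hs.2]⟩
    rw [hσa ε ⟨hε.le, h1⟩, inner_add_right, inner_smul_right, hM] at this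
    nlinarith
  suffices h : inner ℝ ξ b = 0 by
    refine ⟨ε, hε, by linarith, fun τ hτ => ?_⟩
    rw [hσb τ ⟨hτ.1, hτ.2.trans h2⟩, inner_add_right, inner_smul_right, hM, h, mul_zero, add_zero]
  by_contra hne
  have hlt : inner ℝ ξ b < 0 := lt_of_le_of_ne hξb hne
  have hab : a = -b := by
    by_cases hc : cross a b = 0
    · rcases eq_or_eq_neg_of_cross_eq_zero ha hb hc with h | h
      · exfalso
        have h3 : σ (s - ε) = σ (s + ε) := by
          rw [hσa ε ⟨hε.le, h1⟩, hσb ε ⟨hε.le, h2⟩, h]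
        have := hσ.injOn ⟨by linarith, by linarith [hs.2]⟩ ⟨by linarith [hs.1], by linarith⟩ h3
        linarith
      · exact h
    · refine hσ.eq_neg_of_free ha hb hε (h1.trans hle₁) (by linarith)
        (fun τ hτ => hσa τ ⟨hτ.1, hτ.2.trans h1⟩) (fun τ hτ => hσb τ ⟨hτ.1, hτ.2.trans h2⟩) ?_
      refine hK.free_of_max (ξ := ξ) (Z := σ '' Icc 0 (s - ε) ∪ Y ∪ σ '' Icc (s + ε) l) hε hε
        (fun τ hτ => ?_) (fun τ hτ => ?_) ?_ ?_ ?_ ?_ ?_ ?_ ?_ (by linarith) hc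
      · rw [← hσa τ ⟨hτ.1, hτ.2.trans h1⟩]
        exact hσ.mem _ ⟨by linarith [hτ.2], by linarith [hτ.1, hs.2]⟩
      · rw [← hσb τ ⟨hτ.1, hτ.2.trans h2⟩]
        exact hσ.mem _ ⟨by linarith [hτ.1, hs.1], by linarith [hτ.2]⟩
      · exact union_subset (union_subset (hσ.image_subset le_rfl (by linarith [hs.2])) hYK)
          (hσ.image_subset (by linarith [hs.1]) le_rfl)
      · exact ((hσ.isCompact_image hK le_rfl (by linarith [hs.2])).union hYc).union
          (hσ.isCompact_image hK (by linarith [hs.1]) le_rfl)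
      · refine IsPreconnected.union (σ l) (Or.inr hl) ⟨l, ⟨by linarith, le_rfl⟩, rfl⟩ ?_
          (hσ.isPreconnected_image hK (by linarith [hs.1]) le_rfl)
        exact IsPreconnected.union (σ 0) ⟨0, ⟨le_rfl, by linarith⟩, rfl⟩ h0
          (hσ.isPreconnected_image hK le_rfl (by linarith [hs.2])) hY
      · rw [← hσa ε ⟨hε.le, h1⟩]
        exact Or.inl (Or.inl ⟨s - ε, ⟨by linarith, le_rfl⟩, rfl⟩)
      · rw [← hσb ε ⟨hε.le, h2⟩]
        exact Or.inr ⟨s + ε, ⟨le_rfl, by linarith⟩, rfl⟩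
      · rintro ((⟨t, ht, hts⟩ | h) | ⟨t, ht, hts⟩)
        · have := hσ.injOn ⟨ht.1, by linarith [ht.2, hs.2]⟩ ⟨hs.1.le, hs.2.le⟩ hts
          linarith [ht.2]
        · exact hdisj s hs h
        · have := hσ.injOn ⟨by linarith [ht.1, hs.1], ht.2⟩ ⟨hs.1.le, hs.2.le⟩ hts
          linarith [ht.1]
      · rw [hM]
        rintro z ((⟨t, ht, rfl⟩ | h) | ⟨t, ht, rfl⟩)
        · exact hσM t ⟨ht.1, by linarith [ht.2, hs.2]⟩
        · exact hYM z h
        · exact hσM t ⟨by linarith [ht.1, hs.1], ht.2⟩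
  rw [hab, inner_neg_right] at hξa
  linarith

lemma eq_max_of_le (hσ : IsGeodesic K σ l) (hK : IsTame K) {Y : Set Plane} (hYK : Y ⊆ K)
    (hYc : IsCompact Y) (hY : IsPreconnected Y) (h0 : σ 0 ∈ Y) (hl : σ l ∈ Y)
    (hdisj : ∀ s ∈ Ioo 0 l, σ s ∉ Y) {ξ : Plane} {M : ℝ} (hYM : ∀ z ∈ Y, inner ℝ ξ z ≤ M)
    (hσM : ∀ s ∈ Icc 0 l, inner ℝ ξ (σ s) ≤ M) {s : ℝ} (hs : s ∈ Ioo 0 l)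
    (hM : inner ℝ ξ (σ s) = M) : inner ℝ ξ (σ l) = M := by
  have hcl : IsClosed ({t | inner ℝ ξ (σ t) = M} ∩ Icc s l) := by
    have := ContinuousOn.preimage_isClosed_of_isClosed (f := fun t => inner ℝ ξ (σ t))
      (s := Icc s l) (t := {M})
      (continuousOn_const.inner ((hσ.continuousOn hK).mono (Icc_subset_Icc hs.1.le le_rfl)))
      isClosed_Icc isClosed_singleton
    rw [inter_comm]
    exact this
  refine hcl.Icc_subset_of_forall_exists_gt hM ?_ ⟨hs.2.le, le_rfl⟩
  rintro t ⟨ht, hts⟩ y hy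
  obtain ⟨ε, hε, hle, h⟩ := hσ.eventually_eq_of_max hK hYK hYc hY h0 hl hdisj hYM hσM
    (s := t) ⟨hs.1.trans_le hts.1, hts.2⟩ ht
  have hy' : 0 < y - t := sub_pos.2 hy
  have h0 : 0 < min ε (y - t) := lt_min hε hy'
  exact ⟨t + min ε (y - t), h _ ⟨h0.le, min_le_left _ _⟩, by linarith,
    by linarith [min_le_right ε (y - t)]⟩

end IsGeodesic

lemma IsGeodesic.eq_max_of_le_zero {K : Set Plane} {σ : ℝ → Plane} {l : ℝ}
    (hσ : IsGeodesic K σ l) (hK : IsTame K) {Y : Set Plane} (hYK : Y ⊆ K)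
    (hYc : IsCompact Y) (hY : IsPreconnected Y) (h0 : σ 0 ∈ Y) (hl : σ l ∈ Y)
    (hdisj : ∀ s ∈ Ioo 0 l, σ s ∉ Y) {ξ : Plane} {M : ℝ} (hYM : ∀ z ∈ Y, inner ℝ ξ z ≤ M)
    (hσM : ∀ s ∈ Icc 0 l, inner ℝ ξ (σ s) ≤ M) {s : ℝ} (hs : s ∈ Ioo 0 l)
    (hM : inner ℝ ξ (σ s) = M) : inner ℝ ξ (σ 0) = M := by
  have := hσ.reverse.eq_max_of_le hK hYK hYc hY (by simpa using hl) (by simpa using h0)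
    (fun t ht => hdisj _ ⟨by linarith [ht.2], by linarith [ht.1]⟩) hYM
    (fun t ht => hσM _ ⟨by linarith [ht.2], by linarith [ht.1]⟩) (s := l - s)
    ⟨by linarith [hs.2], by linarith [hs.1]⟩ (by rwa [sub_sub_cancel])
  rwa [sub_self] at this

lemma inner_le_of_mem_segment {ξ a b z : Plane} {M : ℝ} (ha : inner ℝ ξ a ≤ M)
    (hb : inner ℝ ξ b ≤ M) (hz : z ∈ segment ℝ a b) : inner ℝ ξ z ≤ M := by
  obtain ⟨p, q, hp, hq, hpq, rfl⟩ := hz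
  rw [inner_add_right, inner_smul_right, inner_smul_right]
  have : M = p * M + q * M := by rw [← add_mul, hpq, one_mul]
  rw [this]
  gcongr

/-! ### Geodesic quadrilaterals -/

/-- The closed curve formed by the arcs `σ₁` and `σ₂` and the segments between their first points
and between their last points. -/
def quadCurve (σ₁ σ₂ : ℝ → Plane) (l₁ l₂ : ℝ) : Set Plane :=
  segment ℝ (σ₁ 0) (σ₂ 0) ∪ σ₁ '' Icc 0 l₁ ∪ σ₂ '' Icc 0 l₂ ∪ segment ℝ (σ₁ l₁) (σ₂ l₂)

/-- A geodesic quadrilateral in `K`: two geodesic arcs, joined by a nondegenerate segment at their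
first points and by a segment at their last points, without further intersections. If
the last points coincide, then this is a geodesic triangle. -/
structure IsQuad (K : Set Plane) (σ₁ σ₂ : ℝ → Plane) (l₁ l₂ : ℝ) : Prop where
  geo₁ : IsGeodesic K σ₁ l₁
  geo₂ : IsGeodesic K σ₂ l₂
  pos₁ : 0 < l₁
  pos₂ : 0 < l₂
  base : segment ℝ (σ₁ 0) (σ₂ 0) ⊆ K
  top : segment ℝ (σ₁ l₁) (σ₂ l₂) ⊆ K
  ne : σ₁ 0 ≠ σ₂ 0
  arcs : ∀ s ∈ Icc 0 l₁, ∀ t ∈ Icc 0 l₂, σ₁ s = σ₂ t → s = l₁ ∧ t = l₂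
  base₁ : ∀ s ∈ Ioc 0 l₁, σ₁ s ∉ segment ℝ (σ₁ 0) (σ₂ 0)
  base₂ : ∀ s ∈ Ioc 0 l₂, σ₂ s ∉ segment ℝ (σ₁ 0) (σ₂ 0)
  top₁ : ∀ s ∈ Ico 0 l₁, σ₁ s ∉ segment ℝ (σ₁ l₁) (σ₂ l₂)
  top₂ : ∀ s ∈ Ico 0 l₂, σ₂ s ∉ segment ℝ (σ₁ l₁) (σ₂ l₂)
  base_top : ∀ z ∈ segment ℝ (σ₁ 0) (σ₂ 0), z ∉ segment ℝ (σ₁ l₁) (σ₂ l₂)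

lemma quadCurve_swap (σ₁ σ₂ : ℝ → Plane) (l₁ l₂ : ℝ) :
    quadCurve σ₂ σ₁ l₂ l₁ = quadCurve σ₁ σ₂ l₁ l₂ := by
  rw [quadCurve, quadCurve, segment_symm ℝ (σ₂ 0), segment_symm ℝ (σ₂ l₂), union_right_comm
    (segment ℝ (σ₁ 0) (σ₂ 0))]

lemma image_reverse (σ : ℝ → Plane) (l : ℝ) :
    (fun s => σ (l - s)) '' Icc 0 l = σ '' Icc 0 l := by
  have : (fun s => σ (l - s)) = σ ∘ fun s => l - s := rfl
  rw [this, image_comp, image_const_sub_Icc, sub_self, sub_zero]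

lemma quadCurve_flip (σ₁ σ₂ : ℝ → Plane) (l₁ l₂ : ℝ) :
    quadCurve (fun s => σ₁ (l₁ - s)) (fun s => σ₂ (l₂ - s)) l₁ l₂ = quadCurve σ₁ σ₂ l₁ l₂ := by
  rw [quadCurve, quadCurve, image_reverse, image_reverse]
  simp only [sub_zero, sub_self]
  ext z
  simp only [mem_union]
  tauto

namespace IsQuad

variable {K : Set Plane} {σ₁ σ₂ : ℝ → Plane} {l₁ l₂ : ℝ}

lemma swap (hQ : IsQuad K σ₁ σ₂ l₁ l₂) : IsQuad K σ₂ σ₁ l₂ l₁ where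
  geo₁ := hQ.geo₂
  geo₂ := hQ.geo₁
  pos₁ := hQ.pos₂
  pos₂ := hQ.pos₁
  base := by rw [segment_symm]; exact hQ.base
  top := by rw [segment_symm]; exact hQ.top
  ne := hQ.ne.symm
  arcs s hs t ht h := (hQ.arcs t ht s hs h.symm).symm
  base₁ := by rw [segment_symm]; exact hQ.base₂
  base₂ := by rw [segment_symm]; exact hQ.base₁
  top₁ := by rw [segment_symm]; exact hQ.top₂
  top₂ := by rw [segment_symm]; exact hQ.top₁
  base_top := by rw [segment_symm, segment_symm ℝ (σ₂ l₂)]; exact hQ.base_top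

lemma flip (hQ : IsQuad K σ₁ σ₂ l₁ l₂) (hne : σ₁ l₁ ≠ σ₂ l₂) :
    IsQuad K (fun s => σ₁ (l₁ - s)) (fun s => σ₂ (l₂ - s)) l₁ l₂ where
  geo₁ := hQ.geo₁.reverse
  geo₂ := hQ.geo₂.reverse
  pos₁ := hQ.pos₁
  pos₂ := hQ.pos₂
  base := by simpa using hQ.top
  top := by simpa using hQ.base
  ne := by simpa using hne
  arcs s hs t ht h := by
    obtain ⟨h1, h2⟩ := hQ.arcs _ ⟨by linarith [hs.2], by linarith [hs.1]⟩ _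
      ⟨by linarith [ht.2], by linarith [ht.1]⟩ h
    simp only [h1, h2] at h
    exact absurd h hne
  base₁ s hs := by
    simpa using hQ.top₁ (l₁ - s) ⟨by linarith [hs.2], by linarith [hs.1]⟩
  base₂ s hs := by
    simpa using hQ.top₂ (l₂ - s) ⟨by linarith [hs.2], by linarith [hs.1]⟩
  top₁ s hs := by
    simpa using hQ.base₁ (l₁ - s) ⟨by linarith [hs.2], by linarith [hs.1]⟩
  top₂ s hs := by
    simpa using hQ.base₂ (l₂ - s) ⟨by linarith [hs.2], by linarith [hs.1]⟩
  base_top z hz hz' := by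
    simp only [sub_zero, sub_self] at hz hz'
    exact hQ.base_top z hz' hz

lemma mem_base {z : Plane} (hz : z ∈ segment ℝ (σ₁ 0) (σ₂ 0)) : z ∈ quadCurve σ₁ σ₂ l₁ l₂ :=
  Or.inl (Or.inl (Or.inl hz))

lemma mem_arc₁ {s : ℝ} (hs : s ∈ Icc 0 l₁) : σ₁ s ∈ quadCurve σ₁ σ₂ l₁ l₂ :=
  Or.inl (Or.inl (Or.inr ⟨s, hs, rfl⟩))

lemma mem_arc₂ {s : ℝ} (hs : s ∈ Icc 0 l₂) : σ₂ s ∈ quadCurve σ₁ σ₂ l₁ l₂ :=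
  Or.inl (Or.inr ⟨s, hs, rfl⟩)

lemma mem_top {z : Plane} (hz : z ∈ segment ℝ (σ₁ l₁) (σ₂ l₂)) : z ∈ quadCurve σ₁ σ₂ l₁ l₂ :=
  Or.inr hz

/-- A linear functional that takes its maximum over a geodesic quadrilateral inside an arc also
takes it at both ends of the arc. -/
lemma eq_max_arc₁ (hQ : IsQuad K σ₁ σ₂ l₁ l₂) (hK : IsTame K) {ξ : Plane} {M : ℝ}
    (hM : ∀ z ∈ quadCurve σ₁ σ₂ l₁ l₂, inner ℝ ξ z ≤ M) {s : ℝ} (hs : s ∈ Ioo 0 l₁)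
    (h : inner ℝ ξ (σ₁ s) = M) : inner ℝ ξ (σ₁ 0) = M := by
  have hp₂ := hQ.pos₂.le
  refine hQ.geo₁.eq_max_of_le_zero hK (Y := segment ℝ (σ₁ 0) (σ₂ 0) ∪ σ₂ '' Icc 0 l₂ ∪
    segment ℝ (σ₁ l₁) (σ₂ l₂)) ?_ ?_ ?_ ?_ ?_ ?_ ?_ (fun t ht => hM _ (mem_arc₁ ht)) hs h
  · exact union_subset (union_subset hQ.base (hQ.geo₂.image_subset le_rfl le_rfl)) hQ.top
  · exact ((isCompact_segment _ _).union (hQ.geo₂.isCompact_image hK le_rfl le_rfl)).union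
      (isCompact_segment _ _)
  · refine IsPreconnected.union (σ₂ l₂) (Or.inr ⟨l₂, ⟨hp₂, le_rfl⟩, rfl⟩)
      (right_mem_segment _ _ _) ?_ (segment_isPreconnected _ _)
    exact IsPreconnected.union (σ₂ 0) (right_mem_segment _ _ _) ⟨0, ⟨le_rfl, hp₂⟩, rfl⟩
      (segment_isPreconnected _ _) (hQ.geo₂.isPreconnected_image hK le_rfl le_rfl)
  · exact Or.inl (Or.inl (left_mem_segment _ _ _))
  · exact Or.inr (left_mem_segment _ _ _)
  · rintro t ht ((h | ⟨r, hr, hrt⟩) | h)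
    · exact hQ.base₁ t ⟨ht.1, ht.2.le⟩ h
    · exact ht.2.ne (hQ.arcs t ⟨ht.1.le, ht.2.le⟩ r hr hrt.symm).1
    · exact hQ.top₁ t ⟨ht.1.le, ht.2⟩ h
  · rintro z ((h | ⟨r, hr, rfl⟩) | h)
    · exact hM z (mem_base h)
    · exact hM _ (mem_arc₂ hr)
    · exact hM z (mem_top h)

/-- A corner at which a linear functional takes its maximum is free of obstacles. -/
lemma free_corner (hQ : IsQuad K σ₁ σ₂ l₁ l₂) (hK : IsTame K) {ξ u : Plane} {ε : ℝ} (hε : 0 < ε)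
    (hε₁ : ε ≤ l₁) (hu : ∀ τ ∈ Icc 0 ε, σ₁ τ = σ₁ 0 + τ • u)
    (hM : ∀ z ∈ quadCurve σ₁ σ₂ l₁ l₂, inner ℝ ξ z ≤ inner ℝ ξ (σ₁ 0))
    (hlt : inner ℝ ξ u + inner ℝ ξ (σ₂ 0 - σ₁ 0) < 0) (hc : cross u (σ₂ 0 - σ₁ 0) ≠ 0) :
    Free K (σ₁ 0) u (σ₂ 0 - σ₁ 0) := by
  have hp₁ := hQ.pos₁.le
  have hp₂ := hQ.pos₂.le
  have hseg : ∀ τ ∈ Icc (0 : ℝ) 1, σ₁ 0 + τ • (σ₂ 0 - σ₁ 0) ∈ segment ℝ (σ₁ 0) (σ₂ 0) := by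
    intro τ hτ
    rw [segment_eq_image']
    exact ⟨τ, hτ, rfl⟩
  have hhalf : segment ℝ (σ₁ 0 + (1 / 2 : ℝ) • (σ₂ 0 - σ₁ 0)) (σ₂ 0) ⊆
      segment ℝ (σ₁ 0) (σ₂ 0) :=
    (convex_segment _ _).segment_subset (hseg _ (by norm_num)) (right_mem_segment _ _ _)
  refine hK.free_of_max (ξ := ξ) (ε₁ := ε) (ε₂ := 1 / 2) (Z := σ₁ '' Icc ε l₁ ∪
    segment ℝ (σ₁ l₁) (σ₂ l₂) ∪ σ₂ '' Icc 0 l₂ ∪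
    segment ℝ (σ₁ 0 + (1 / 2 : ℝ) • (σ₂ 0 - σ₁ 0)) (σ₂ 0)) hε (by norm_num) ?_ ?_ ?_ ?_ ?_ ?_ ?_
    ?_ ?_ hlt hc
  · intro τ hτ
    rw [← hu τ hτ]
    exact hQ.geo₁.mem τ ⟨hτ.1, hτ.2.trans hε₁⟩
  · intro τ hτ
    exact hQ.base (hseg τ ⟨hτ.1, by linarith [hτ.2]⟩)
  · exact union_subset (union_subset (union_subset (hQ.geo₁.image_subset hε.le le_rfl) hQ.top)
      (hQ.geo₂.image_subset le_rfl le_rfl)) (hhalf.trans hQ.base)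
  · exact (((hQ.geo₁.isCompact_image hK hε.le le_rfl).union (isCompact_segment _ _)).union
      (hQ.geo₂.isCompact_image hK le_rfl le_rfl)).union (isCompact_segment _ _)
  · refine IsPreconnected.union (σ₂ 0) (Or.inr ⟨0, ⟨le_rfl, hp₂⟩, rfl⟩) (right_mem_segment _ _ _)
      ?_ (segment_isPreconnected _ _)
    refine IsPreconnected.union (σ₂ l₂) (Or.inr (right_mem_segment _ _ _))
      ⟨l₂, ⟨hp₂, le_rfl⟩, rfl⟩ ?_ (hQ.geo₂.isPreconnected_image hK le_rfl le_rfl)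
    exact IsPreconnected.union (σ₁ l₁) ⟨l₁, ⟨hε₁, le_rfl⟩, rfl⟩ (left_mem_segment _ _ _)
      (hQ.geo₁.isPreconnected_image hK hε.le le_rfl) (segment_isPreconnected _ _)
  · rw [← hu ε ⟨hε.le, le_rfl⟩]
    exact Or.inl (Or.inl (Or.inl ⟨ε, ⟨le_rfl, hε₁⟩, rfl⟩))
  · exact Or.inr (left_mem_segment _ _ _)
  · rintro (((⟨t, ht, h⟩ | h) | ⟨t, ht, h⟩) | h)
    · have := hQ.geo₁.injOn ⟨hε.le.trans ht.1, ht.2⟩ ⟨le_rfl, hp₁⟩ h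
      linarith [ht.1]
    · exact hQ.top₁ 0 ⟨le_rfl, hQ.pos₁⟩ h
    · exact hQ.pos₁.ne (hQ.arcs 0 ⟨le_rfl, hp₁⟩ t ht h.symm).1
    · obtain ⟨p, q, hp, hq, hpq, h⟩ := h
      have h1 : (p * (1 / 2) + q) • (σ₂ 0 - σ₁ 0) = 0 := by
        have h2 : p = 1 - q := by linarith
        rw [← sub_eq_zero] at h
        rw [← h, h2]
        module
      rcases smul_eq_zero.1 h1 with h1 | h1
      · linarith
      · exact hQ.ne (sub_eq_zero.1 h1).symm
  · rintro z (((⟨t, ht, rfl⟩ | h) | ⟨t, ht, rfl⟩) | h)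
    · exact hM _ (mem_arc₁ ⟨hε.le.trans ht.1, ht.2⟩)
    · exact hM z (mem_top h)
    · exact hM _ (mem_arc₂ ht)
    · exact hM z (mem_base (hhalf h))

lemma isCompact (hQ : IsQuad K σ₁ σ₂ l₁ l₂) (hK : IsTame K) :
    IsCompact (quadCurve σ₁ σ₂ l₁ l₂) :=
  (((isCompact_segment _ _).union (hQ.geo₁.isCompact_image hK le_rfl le_rfl)).union
    (hQ.geo₂.isCompact_image hK le_rfl le_rfl)).union (isCompact_segment _ _)

/-- A geodesic quadrilateral lies in the convex hull of its corners. -/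
lemma exists_max_corner (hQ : IsQuad K σ₁ σ₂ l₁ l₂) (hK : IsTame K) (ξ : Plane) :
    ∃ c, (c = σ₁ 0 ∨ c = σ₂ 0 ∨ c = σ₁ l₁ ∨ c = σ₂ l₂) ∧
      ∀ z ∈ quadCurve σ₁ σ₂ l₁ l₂, inner ℝ ξ z ≤ inner ℝ ξ c := by
  have hp₁ := hQ.pos₁.le
  have hp₂ := hQ.pos₂.le
  obtain ⟨z, hz, hmax⟩ := (hQ.isCompact hK).exists_isMaxOn
    ⟨_, mem_base (left_mem_segment ℝ (σ₁ 0) (σ₂ 0))⟩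
    (f := fun z => inner ℝ ξ z) (continuous_const.inner continuous_id).continuousOn
  have hM : ∀ w ∈ quadCurve σ₁ σ₂ l₁ l₂, inner ℝ ξ w ≤ inner ℝ ξ z := fun w hw => hmax hw
  suffices h : ∃ c, (c = σ₁ 0 ∨ c = σ₂ 0 ∨ c = σ₁ l₁ ∨ c = σ₂ l₂) ∧
      inner ℝ ξ z ≤ inner ℝ ξ c by
    obtain ⟨c, hc, h⟩ := h
    exact ⟨c, hc, fun w hw => (hM w hw).trans h⟩
  have hends : ∀ a b : Plane, z ∈ segment ℝ a b →
      inner ℝ ξ z ≤ inner ℝ ξ a ∨ inner ℝ ξ z ≤ inner ℝ ξ b := by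
    intro a b h
    rcases le_total (inner ℝ ξ a) (inner ℝ ξ b) with h' | h'
    · exact Or.inr (inner_le_of_mem_segment h' le_rfl h)
    · exact Or.inl (inner_le_of_mem_segment le_rfl h' h)
  rcases hz with ((h | ⟨s, hs, rfl⟩) | ⟨s, hs, rfl⟩) | h
  · rcases hends _ _ h with h | h
    exacts [⟨_, by simp, h⟩, ⟨_, by simp, h⟩]
  · by_cases h0 : s = 0
    · exact ⟨σ₁ 0, by simp, by rw [h0]⟩
    by_cases h1 : s = l₁
    · exact ⟨σ₁ l₁, by simp, by rw [h1]⟩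
    exact ⟨σ₁ 0, by simp, (hQ.eq_max_arc₁ hK hM
      ⟨lt_of_le_of_ne hs.1 (Ne.symm h0), lt_of_le_of_ne hs.2 h1⟩ rfl).ge⟩
  · by_cases h0 : s = 0
    · exact ⟨σ₂ 0, by simp, by rw [h0]⟩
    by_cases h1 : s = l₂
    · exact ⟨σ₂ l₂, by simp, by rw [h1]⟩
    rw [← quadCurve_swap] at hM
    exact ⟨σ₂ 0, by simp, (hQ.swap.eq_max_arc₁ hK hM
      ⟨lt_of_le_of_ne hs.1 (Ne.symm h0), lt_of_le_of_ne hs.2 h1⟩ rfl).ge⟩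
  · rcases hends _ _ h with h | h
    exacts [⟨_, by simp, h⟩, ⟨_, by simp, h⟩]

end IsQuad

/-! ### Initial directions of shortest geodesics to a segment -/

lemma exists_normal {w : Plane} (hw : ‖w‖ = 1) (v : Plane) :
    ∃ n : Plane, (∀ z, inner ℝ w z ^ 2 + inner ℝ n z ^ 2 = ‖z‖ ^ 2) ∧ inner ℝ n w = 0 ∧
      (∀ z, inner ℝ n z = 0 ↔ cross w z = 0) ∧ 0 ≤ inner ℝ n v := by
  have hJ : ∀ z, inner ℝ (!₂[-w 1, w 0] : Plane) z = cross w z := fun z => by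
    rw [inner_eq_coord, cross]
    simp
    ring
  have h := fun z => inner_sq_add_cross_sq w z
  simp only [hw, one_pow, one_mul] at h
  have hww : cross w w = 0 := by simp only [cross]; ring
  rcases le_total 0 (cross w v) with hv | hv
  · refine ⟨!₂[-w 1, w 0], ?_, ?_, ?_, ?_⟩
    · simpa only [hJ] using h
    · rw [hJ, hww]
    · simp only [hJ, implies_true]
    · rwa [hJ]
  · refine ⟨-!₂[-w 1, w 0], ?_, ?_, ?_, ?_⟩
    · simpa only [inner_neg_left, hJ, neg_sq] using h
    · rw [inner_neg_left, hJ, hww, neg_zero]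
    · simp only [inner_neg_left, hJ, neg_eq_zero, implies_true]
    · rw [inner_neg_left, hJ]
      linarith

/-- A point of the upper unit half-circle is determined by its abscissa, which increases
with the cotangent. -/
lemma le_of_mul_le_mul_of_sq_add_sq {c₁ s₁ c₂ s₂ : ℝ} (h₁ : c₁ ^ 2 + s₁ ^ 2 = 1)
    (h₂ : c₂ ^ 2 + s₂ ^ 2 = 1) (hs₁ : 0 < s₁) (hs₂ : 0 < s₂) (h : c₂ * s₁ ≤ c₁ * s₂) :
    c₂ ≤ c₁ := by
  by_contra! hlt
  rcases le_or_gt 0 c₁ with hc | hc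
  · have : s₂ < s₁ := by
      refine lt_of_pow_lt_pow_left₀ 2 hs₁.le ?_
      nlinarith
    nlinarith
  · rcases le_or_gt c₂ 0 with hc' | hc'
    · have : s₁ < s₂ := by
        refine lt_of_pow_lt_pow_left₀ 2 hs₂.le ?_
        nlinarith
      nlinarith
    · nlinarith

/-- First variation of the distance: if no point of the segment from `σ l` in the direction `η` is
closer to `σ 0` than `σ l`, and this can be seen from the end of the geodesic, then the segment
does not turn back. -/
lemma IsGeodesic.inner_nonpos_of_free {K : Set Plane} {σ : ℝ → Plane} {l ε : ℝ} {v η : Plane}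
    (hσ : IsGeodesic K σ l) (hK : IsTame K) (hv : ‖v‖ = 1) (hε : 0 < ε) (hεl : ε ≤ l)
    (hσv : ∀ τ ∈ Icc 0 ε, σ (l - τ) = σ l + τ • v) (hη : ∀ r ∈ Icc (0 : ℝ) 1, σ l + r • η ∈ K)
    (hmin : ∀ r ∈ Icc (0 : ℝ) 1, l ≤ geodDist K (σ 0) (σ l + r • η))
    (hfree : Free K (σ l) v η) : inner ℝ v η ≤ 0 := by
  obtain ⟨δ, hδ, h⟩ := hfree.exists_segment
  by_contra! hpos
  set τ := min δ ε with hτ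
  have hτ0 : 0 < τ := lt_min hδ hε
  have hτε : τ ≤ ε := min_le_right _ _
  set r := min (min δ 1) (τ * inner ℝ v η / (‖η‖ ^ 2 + 1)) with hr
  have hr0 : 0 < r := by positivity
  have hrδ : r ≤ δ := (min_le_left _ _).trans (min_le_left _ _)
  have hr1 : r ≤ 1 := (min_le_left _ _).trans (min_le_right _ _)
  have hrη : r * (‖η‖ ^ 2 + 1) ≤ τ * inner ℝ v η :=
    (le_div_iff₀ (by positivity)).1 (min_le_right _ _)
  have hseg := h τ r ⟨hτ0.le, min_le_left _ _⟩ ⟨hr0.le, hrδ⟩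
  have h1 := geodDist_of_segment hseg
  rw [dist_eq_norm, add_sub_add_left_eq_sub] at h1
  have hl0 : 0 < l := hε.trans_le hεl
  have hmem : σ (l - τ) ∈ K := hσ.mem _ ⟨by linarith, by linarith⟩
  have h2 := hK.geodDist_triangle (hσ.mem 0 ⟨le_rfl, hl0.le⟩) hmem (hη r ⟨hr0.le, hr1⟩)
  rw [hσ.dist_eq 0 ⟨le_rfl, hl0.le⟩ _ ⟨by linarith, by linarith⟩,
    hσv τ ⟨hτ0.le, hτε⟩, h1, abs_of_nonpos (by linarith)] at h2
  have h3 := hmin r ⟨hr0.le, hr1⟩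
  have h4 : τ ≤ ‖τ • v - r • η‖ := by linarith
  have h5 := norm_sub_sq_real (τ • v) (r • η)
  rw [norm_smul, norm_smul, hv, Real.norm_of_nonneg hτ0.le, Real.norm_of_nonneg hr0.le,
    inner_smul_left, inner_smul_right] at h5
  simp only [conj_trivial, mul_one] at h5
  have h6 : τ ^ 2 ≤ ‖τ • v - r • η‖ ^ 2 := by gcongr
  have h7 : r * (2 * (τ * inner ℝ v η)) ≤ r * (r * ‖η‖ ^ 2) := by nlinarith
  have h8 := le_of_mul_le_mul_left h7 hr0
  nlinarith [mul_pos hτ0 hpos]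

namespace IsQuad

variable {K : Set Plane} {σ₁ σ₂ : ℝ → Plane} {l₁ l₂ : ℝ}

lemma exists_pos_smul_of_cross_eq_zero (hQ : IsQuad K σ₁ σ₂ l₁ l₂) {u : Plane} {ε : ℝ}
    (hε : 0 < ε) (hε₁ : ε ≤ l₁) (hu1 : ‖u‖ = 1) (hu : ∀ τ ∈ Icc 0 ε, σ₁ τ = σ₁ 0 + τ • u)
    (hc : cross u (σ₂ 0 - σ₁ 0) = 0) : ∃ c > (0 : ℝ), σ₂ 0 - σ₁ 0 = -c • u := by
  set e := σ₂ 0 - σ₁ 0 with he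
  have he0 : e ≠ 0 := sub_ne_zero.2 hQ.ne.symm
  have hn : 0 < ‖e‖ := norm_pos_iff.2 he0
  have hc' : cross u (‖e‖⁻¹ • e) = 0 := by
    have : cross u (‖e‖⁻¹ • e) = ‖e‖⁻¹ * cross u e := by
      simp only [cross, PiLp.smul_apply, smul_eq_mul]; ring
    rw [this, hc, mul_zero]
  have h1 : ‖(‖e‖⁻¹ • e)‖ = 1 := by
    rw [norm_smul, norm_inv, norm_norm, inv_mul_cancel₀ hn.ne']
  rcases eq_or_eq_neg_of_cross_eq_zero hu1 h1 hc' with h | h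
  · exfalso
    have hm : 0 < min ε ‖e‖ := lt_min hε hn
    refine hQ.base₁ (min ε ‖e‖) ⟨hm, (min_le_left _ _).trans hε₁⟩ ?_
    rw [hu _ ⟨hm.le, min_le_left _ _⟩, segment_eq_image']
    refine ⟨min ε ‖e‖ * ‖e‖⁻¹, ⟨by positivity, ?_⟩, ?_⟩
    · rw [← div_eq_mul_inv, div_le_one hn]
      exact min_le_right _ _
    · simp only
      rw [h, smul_smul]
  · refine ⟨‖e‖, hn, ?_⟩
    rw [h, neg_smul, smul_neg, neg_neg, smul_smul, mul_inv_cancel₀ hn.ne', one_smul]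

/-- If the first corner is obstructed, then a linear functional can take its maximum there only if
it is constant on the base. -/
lemma inner_base_eq_zero (hQ : IsQuad K σ₁ σ₂ l₁ l₂) (hK : IsTame K) {ξ u : Plane} {ε : ℝ}
    (hε : 0 < ε) (hε₁ : ε ≤ l₁) (hu1 : ‖u‖ = 1) (hu : ∀ τ ∈ Icc 0 ε, σ₁ τ = σ₁ 0 + τ • u)
    (hbad : cross u (σ₂ 0 - σ₁ 0) = 0 ∨ ¬ Free K (σ₁ 0) u (σ₂ 0 - σ₁ 0))
    (hM : ∀ z ∈ quadCurve σ₁ σ₂ l₁ l₂, inner ℝ ξ z ≤ inner ℝ ξ (σ₁ 0)) :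
    inner ℝ ξ (σ₂ 0 - σ₁ 0) = 0 := by
  have h1 : inner ℝ ξ u ≤ 0 := by
    have := hM _ (mem_arc₁ (l₂ := l₂) (σ₂ := σ₂) ⟨hε.le, hε₁⟩)
    rw [hu ε ⟨hε.le, le_rfl⟩, inner_add_right, inner_smul_right] at this
    nlinarith
  have h2 : inner ℝ ξ (σ₂ 0 - σ₁ 0) ≤ 0 := by
    have := hM _ (mem_base (right_mem_segment _ _ _))
    rw [inner_sub_right]
    linarith
  by_cases hc : cross u (σ₂ 0 - σ₁ 0) = 0
  · obtain ⟨c, hc0, hc⟩ := hQ.exists_pos_smul_of_cross_eq_zero hε hε₁ hu1 hu hc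
    rw [hc, inner_smul_right] at h2 ⊢
    nlinarith
  · by_contra hne
    have h3 : inner ℝ ξ (σ₂ 0 - σ₁ 0) < 0 := lt_of_le_of_ne h2 hne
    exact (hbad.resolve_left hc) (hQ.free_corner hK hε hε₁ hu hM (by linarith) hc)

/-- A geodesic triangle has no obstructed corner. -/
lemma not_obstructed_of_triangle (hQ : IsQuad K σ₁ σ₂ l₁ l₂) (hK : IsTame K) (hm : σ₁ l₁ = σ₂ l₂)
    {u v : Plane} {ε : ℝ} (hε : 0 < ε) (hε₁ : ε ≤ l₁) (hε₂ : ε ≤ l₂) (hu1 : ‖u‖ = 1)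
    (hv1 : ‖v‖ = 1) (hu : ∀ τ ∈ Icc 0 ε, σ₁ τ = σ₁ 0 + τ • u)
    (hv : ∀ τ ∈ Icc 0 ε, σ₂ τ = σ₂ 0 + τ • v) :
    ¬ (cross u (σ₂ 0 - σ₁ 0) = 0 ∨ ¬ Free K (σ₁ 0) u (σ₂ 0 - σ₁ 0)) := by
  intro hbad
  have hmax : ∀ ξ : Plane, (∀ z ∈ quadCurve σ₁ σ₂ l₁ l₂, inner ℝ ξ z ≤ inner ℝ ξ (σ₂ 0)) ∨
      ∀ z ∈ quadCurve σ₁ σ₂ l₁ l₂, inner ℝ ξ z ≤ inner ℝ ξ (σ₂ l₂) := by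
    intro ξ
    obtain ⟨c, hc, hM⟩ := hQ.exists_max_corner hK ξ
    rcases hc with rfl | rfl | rfl | rfl
    · left
      have := hQ.inner_base_eq_zero hK hε hε₁ hu1 hu hbad hM
      rw [inner_sub_right, sub_eq_zero] at this
      rwa [this]
    · exact Or.inl hM
    · right
      rwa [← hm]
    · exact Or.inr hM
  set d := σ₂ l₂ - σ₂ 0 with hd
  have hd0 : d ≠ 0 := by
    intro h
    have := hQ.geo₂.injOn ⟨hQ.pos₂.le, le_rfl⟩ ⟨le_rfl, hQ.pos₂.le⟩ (sub_eq_zero.1 h)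
    exact hQ.pos₂.ne' this
  have hJ : ∀ z, inner ℝ (!₂[-d 1, d 0] : Plane) z = cross d z := fun z => by
    rw [inner_eq_coord, cross]
    simp
    ring
  have hdd : cross d (σ₂ 0) = cross d (σ₂ l₂) := by
    have h1 : cross d d = 0 := by simp only [cross]; ring
    have h2 : cross d (σ₂ l₂) - cross d (σ₂ 0) = cross d d := by
      simp only [hd, cross, PiLp.sub_apply]; ring
    linarith
  have hline : ∀ z ∈ quadCurve σ₁ σ₂ l₁ l₂, cross d z = cross d (σ₂ 0) := by
    intro z hz
    have h1 : cross d z ≤ cross d (σ₂ 0) := by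
      rcases hmax (!₂[-d 1, d 0]) with h | h
      · simpa only [hJ] using h z hz
      · simpa only [hJ, ← hdd] using h z hz
    have h2 : -cross d z ≤ -cross d (σ₂ 0) := by
      rcases hmax (-!₂[-d 1, d 0]) with h | h
      · simpa only [inner_neg_left, hJ] using h z hz
      · simpa only [inner_neg_left, hJ, ← hdd] using h z hz
    linarith
  have hde : cross d (σ₂ 0 - σ₁ 0) = 0 := by
    have h1 := hline _ (mem_base (left_mem_segment _ _ _))
    have h2 : cross d (σ₂ 0 - σ₁ 0) = cross d (σ₂ 0) - cross d (σ₁ 0) := by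
      simp only [cross, PiLp.sub_apply]; ring
    rw [h2, h1, sub_self]
  have hdv : cross d v = 0 := by
    have h1 := hline _ (mem_arc₂ ⟨hε.le, hε₂⟩)
    rw [hv ε ⟨hε.le, le_rfl⟩] at h1
    have h2 : cross d (σ₂ 0 + ε • v) = cross d (σ₂ 0) + ε * cross d v := by
      simp only [cross, PiLp.add_apply, PiLp.smul_apply, smul_eq_mul]; ring
    rw [h2] at h1
    have h3 : ε * cross d v = 0 := by linarith
    exact (mul_eq_zero.1 h3).resolve_left hε.ne'
  have hev : cross v (σ₁ 0 - σ₂ 0) = 0 := by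
    have h1 := cross_eq_zero_of_cross_eq_zero hd0 hdv hde
    have h2 : cross v (σ₁ 0 - σ₂ 0) = -cross v (σ₂ 0 - σ₁ 0) := by
      simp only [cross, PiLp.sub_apply]; ring
    rw [h2, h1, neg_zero]
  obtain ⟨c, hc0, hc⟩ := hQ.swap.exists_pos_smul_of_cross_eq_zero hε hε₂ hv1 hv hev
  have hvv : inner ℝ v v = 1 := by rw [real_inner_self_eq_norm_sq, hv1, one_pow]
  have hx : σ₁ 0 = σ₂ 0 + -c • v := by rw [← hc]; abel
  have h1 := hmax v
  have h2 := hmax (-v)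
  have hx1 := mem_base (l₁ := l₁) (l₂ := l₂) (left_mem_segment ℝ (σ₁ 0) (σ₂ 0))
  have hx2 := mem_base (l₁ := l₁) (l₂ := l₂) (right_mem_segment ℝ (σ₁ 0) (σ₂ 0))
  have hx3 := mem_arc₂ (σ₁ := σ₁) (l₁ := l₁) (σ₂ := σ₂) ⟨hε.le, hε₂⟩
  rcases h1 with h1 | h1
  · have := h1 _ hx3
    rw [hv ε ⟨hε.le, le_rfl⟩, inner_add_right, inner_smul_right, hvv] at this
    linarith
  · rcases h2 with h2 | h2
    · have := h2 _ hx1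
      rw [hx, inner_add_right, inner_smul_right, inner_neg_left, inner_neg_left, hvv] at this
      linarith
    · have h3 := h1 _ hx3
      have h4 := h2 _ hx2
      rw [inner_neg_left, inner_neg_left] at h4
      rw [hv ε ⟨hε.le, le_rfl⟩, inner_add_right, inner_smul_right, hvv] at h3
      linarith

/-- The angles of a geodesic triangle at its base are smaller than those of a Euclidean triangle. -/
lemma mul_lt_mul_of_triangle (hQ : IsQuad K σ₁ σ₂ l₁ l₂) (hK : IsTame K) (hm : σ₁ l₁ = σ₂ l₂)
    {u v w : Plane} {ε L : ℝ} (hε : 0 < ε) (hε₁ : ε ≤ l₁) (hε₂ : ε ≤ l₂)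
    (hu : ∀ τ ∈ Icc 0 ε, σ₁ τ = σ₁ 0 + τ • u) (hv : ∀ τ ∈ Icc 0 ε, σ₂ τ = σ₂ 0 + τ • v)
    (hw : ‖w‖ = 1) (hL : 0 < L) (he : σ₂ 0 - σ₁ 0 = L • w) (hcu : cross w u ≠ 0)
    (hcv : cross w v ≠ 0) :
    ∃ n : Plane, (∀ z, inner ℝ w z ^ 2 + inner ℝ n z ^ 2 = ‖z‖ ^ 2) ∧ 0 < inner ℝ n u ∧
      0 < inner ℝ n v ∧ inner ℝ w v * inner ℝ n u < inner ℝ w u * inner ℝ n v := by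
  obtain ⟨n, hn, hnw, hnc, hnm⟩ := exists_normal hw (σ₂ l₂ - σ₁ 0)
  set a := inner ℝ w (σ₂ l₂ - σ₁ 0) with ha
  set b := inner ℝ n (σ₂ l₂ - σ₁ 0) with hb
  have hww : inner ℝ w w = 1 := by rw [real_inner_self_eq_norm_sq, hw, one_pow]
  have hx2 : σ₂ 0 = σ₁ 0 + L • w := by rw [← he]; abel
  have hm2 : σ₂ l₂ = σ₁ 0 + (σ₂ l₂ - σ₁ 0) := by abel
  -- Bounds at the three corners extend to both arcs.
  have key : ∀ (α β M : ℝ), 0 ≤ M → α * L ≤ M → α * a + β * b ≤ M →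
      (α * inner ℝ w u + β * inner ℝ n u) * ε ≤ M ∧
      α * L + (α * inner ℝ w v + β * inner ℝ n v) * ε ≤ M := by
    intro α β M h0 h1 h2
    obtain ⟨c, hc, hmax⟩ := hQ.exists_max_corner hK (α • w + β • n)
    have hcM : inner ℝ (α • w + β • n) c ≤ inner ℝ (α • w + β • n) (σ₁ 0) + M := by
      have h3 : inner ℝ (α • w + β • n) (σ₂ l₂) ≤ inner ℝ (α • w + β • n) (σ₁ 0) + M := by
        rw [hm2, inner_add_right _ (σ₁ 0), inner_add_left _ _ (σ₂ l₂ - σ₁ 0), real_inner_smul_left,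
          real_inner_smul_left]
        linarith
      rcases hc with rfl | rfl | rfl | rfl
      · linarith
      · rw [hx2, inner_add_right _ (σ₁ 0), inner_add_left _ _ (L • w), real_inner_smul_left,
          real_inner_smul_left, inner_smul_right, inner_smul_right, hnw, hww]
        linarith
      · rwa [hm]
      · exact h3
    constructor
    · have h3 := (hmax _ (mem_arc₁ (l₂ := l₂) (σ₂ := σ₂) ⟨hε.le, hε₁⟩)).trans hcM
      rw [hu ε ⟨hε.le, le_rfl⟩, inner_add_right _ (σ₁ 0), inner_add_left _ _ (ε • u),
        real_inner_smul_left, real_inner_smul_left, inner_smul_right, inner_smul_right] at h3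
      linarith
    · have h3 := (hmax _ (mem_arc₂ (l₁ := l₁) (σ₁ := σ₁) ⟨hε.le, hε₂⟩)).trans hcM
      rw [hv ε ⟨hε.le, le_rfl⟩, hx2, add_assoc, inner_add_right _ (σ₁ 0), inner_add_left _ _ (_ + _),
        inner_add_right, inner_add_right, real_inner_smul_left, real_inner_smul_left,
        real_inner_smul_left, real_inner_smul_left, inner_smul_right, inner_smul_right,
        inner_smul_right, inner_smul_right, hnw, hww] at h3
      linarith
  have hnu : inner ℝ n u ≠ 0 := fun h => hcu ((hnc u).1 h)
  have hnv : inner ℝ n v ≠ 0 := fun h => hcv ((hnc v).1 h)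
  have hsu : 0 < inner ℝ n u := by
    have := (key 0 (-1) 0 le_rfl (by simp) (by linarith)).1
    exact lt_of_le_of_ne (by nlinarith) hnu.symm
  have hsv : 0 < inner ℝ n v := by
    have := (key 0 (-1) 0 le_rfl (by simp) (by linarith)).2
    exact lt_of_le_of_ne (by nlinarith) hnv.symm
  have hb0 : 0 < b := by
    have := (key 0 1 b hnm (by simpa using hnm) (by simp)).1
    nlinarith
  have h1 := (key (-b) a 0 le_rfl (by nlinarith) (by linarith)).1
  have h2 := (key b (-(a - L)) (b * L) (by positivity) le_rfl (by linarith)).2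
  have h3 : a * inner ℝ n u ≤ b * inner ℝ w u := by nlinarith
  have h4 : b * inner ℝ w v ≤ (a - L) * inner ℝ n v := by nlinarith
  refine ⟨n, hn, hsu, hsv, ?_⟩
  have h5 : b * (inner ℝ w v * inner ℝ n u) < b * (inner ℝ w u * inner ℝ n v) := by
    nlinarith [mul_le_mul_of_nonneg_right h3 hsv.le, mul_le_mul_of_nonneg_right h4 hsu.le,
      mul_pos hL (mul_pos hsu hsv)]
  exact lt_of_mul_lt_mul_left h5 hb0.le

/-- If the last point of `σ₁` is the closest point of the top segment, then the functional given
by the top segment takes its minimum at the base. -/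
lemma exists_min_base (hQ : IsQuad K σ₁ σ₂ l₁ l₂) (hK : IsTame K) (hne : σ₁ l₁ ≠ σ₂ l₂)
    (hmin : ∀ z ∈ segment ℝ (σ₁ l₁) (σ₂ l₂), l₁ ≤ geodDist K (σ₁ 0) z) :
    ∃ c, (c = σ₁ 0 ∨ c = σ₂ 0) ∧ ∀ z ∈ quadCurve σ₁ σ₂ l₁ l₂,
      inner ℝ (σ₂ l₂ - σ₁ l₁) c ≤ inner ℝ (σ₂ l₂ - σ₁ l₁) z := by
  set η := σ₂ l₂ - σ₁ l₁ with hη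
  have hη0 : 0 < inner ℝ η η := by
    rw [real_inner_self_eq_norm_sq]
    have : 0 < ‖η‖ := norm_pos_iff.2 (sub_ne_zero.2 hne.symm)
    positivity
  obtain ⟨c, hc, hmax⟩ := hQ.exists_max_corner hK (-η)
  have hmax' : ∀ z ∈ quadCurve σ₁ σ₂ l₁ l₂, inner ℝ η c ≤ inner ℝ η z := fun z hz => by
    have := hmax z hz
    rw [inner_neg_left, inner_neg_left] at this
    linarith
  rcases hc with rfl | rfl | rfl | rfl
  · exact ⟨_, Or.inl rfl, hmax'⟩
  · exact ⟨_, Or.inr rfl, hmax'⟩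
  · refine ⟨_, Or.inl rfl, ?_⟩
    obtain ⟨v, hv1, ε, hε, hεl, hv⟩ := hQ.geo₁.exists_direction_left hK (a := l₁)
      ⟨hQ.pos₁, le_rfl⟩
    have hseg : ∀ r ∈ Icc (0 : ℝ) 1, σ₁ l₁ + r • η ∈ segment ℝ (σ₁ l₁) (σ₂ l₂) := fun r hr => by
      rw [segment_eq_image']
      exact ⟨r, hr, rfl⟩
    have hv0 : 0 ≤ inner ℝ η v := by
      have := hmax' _ (mem_arc₁ (l₂ := l₂) (σ₂ := σ₂) ⟨sub_nonneg.2 hεl, by linarith⟩)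
      rw [hv ε ⟨hε.le, le_rfl⟩, inner_add_right, inner_smul_right] at this
      nlinarith
    have hF := hQ.flip hne
    have hv' : ∀ τ ∈ Icc 0 ε, (fun s => σ₁ (l₁ - s)) τ = (fun s => σ₁ (l₁ - s)) 0 + τ • v := by
      intro τ hτ
      simp only [sub_zero]
      exact hv τ hτ
    have hc : cross v η ≠ 0 := by
      intro hc
      obtain ⟨c, hc0, hc⟩ := hF.exists_pos_smul_of_cross_eq_zero hε hεl hv1 hv'
        (by simpa only [sub_zero] using hc)
      simp only [sub_zero, ← hη] at hc
      have h2 := hη0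
      nth_rewrite 2 [hc] at h2
      rw [inner_smul_right] at h2
      nlinarith
    have hfree := hF.free_corner hK (ξ := -η) hε hεl hv' (by
      rw [quadCurve_flip]
      simpa only [sub_zero] using hmax) (by
      simp only [sub_zero, ← hη, inner_neg_left]
      linarith) (by simpa only [sub_zero] using hc)
    simp only [sub_zero] at hfree
    have h1 := hQ.geo₁.inner_nonpos_of_free hK hv1 hε hεl hv (fun r hr => hQ.top (hseg r hr))
      (fun r hr => hmin _ (hseg r hr)) hfree
    rw [real_inner_comm] at h1
    have h2 : inner ℝ η v = 0 := le_antisymm h1 hv0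
    have h3 : inner ℝ (-η) (σ₁ (l₁ - ε / 2)) = inner ℝ (-η) (σ₁ l₁) := by
      rw [hv (ε / 2) ⟨by linarith, by linarith⟩, inner_add_right, inner_smul_right,
        inner_neg_left _ v, h2, neg_zero, mul_zero, add_zero]
    have h4 := hQ.eq_max_arc₁ hK hmax (s := l₁ - ε / 2) ⟨by linarith, by linarith⟩ h3
    rw [inner_neg_left, inner_neg_left, neg_inj] at h4
    rwa [h4]
  · exfalso
    have := hmax' _ (mem_top (left_mem_segment _ _ _))
    rw [hη, inner_sub_right] at hη0
    linarith

/-- If the last points of the arcs are closest points of the top segment, then the projection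
to the direction of the top segment maps the quadrilateral to the image of the base. -/
lemma exists_functional (hQ : IsQuad K σ₁ σ₂ l₁ l₂) (hK : IsTame K) (hne : σ₁ l₁ ≠ σ₂ l₂)
    (hmin₁ : ∀ z ∈ segment ℝ (σ₁ l₁) (σ₂ l₂), l₁ ≤ geodDist K (σ₁ 0) z)
    (hmin₂ : ∀ z ∈ segment ℝ (σ₁ l₁) (σ₂ l₂), l₂ ≤ geodDist K (σ₂ 0) z) :
    ∃ ζ, (ζ = σ₂ l₂ - σ₁ l₁ ∨ ζ = -(σ₂ l₂ - σ₁ l₁)) ∧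
      (∀ z ∈ quadCurve σ₁ σ₂ l₁ l₂, inner ℝ ζ (σ₁ 0) ≤ inner ℝ ζ z ∧
        inner ℝ ζ z ≤ inner ℝ ζ (σ₂ 0)) ∧ inner ℝ ζ (σ₁ 0) < inner ℝ ζ (σ₂ 0) := by
  obtain ⟨c, hc, h1⟩ := hQ.exists_min_base hK hne hmin₁
  obtain ⟨d, hd, h2⟩ := hQ.swap.exists_min_base hK hne.symm (by rwa [segment_symm])
  rw [quadCurve_swap] at h2
  set η := σ₂ l₂ - σ₁ l₁ with hη
  have h2 : ∀ z ∈ quadCurve σ₁ σ₂ l₁ l₂, inner ℝ η z ≤ inner ℝ η d := fun z hz => by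
    have := h2 z hz
    rw [← neg_sub, ← hη, inner_neg_left, inner_neg_left] at this
    linarith
  have hη0 : 0 < inner ℝ η η := by
    rw [real_inner_self_eq_norm_sq]
    have : 0 < ‖η‖ := norm_pos_iff.2 (sub_ne_zero.2 hne.symm)
    positivity
  have hcd : inner ℝ η c < inner ℝ η d := by
    have h3 := h1 _ (mem_top (left_mem_segment _ _ _))
    have h4 := h2 _ (mem_top (right_mem_segment _ _ _))
    rw [hη, inner_sub_right, ← hη] at hη0
    linarith
  rcases hc with rfl | rfl <;> rcases hd with rfl | rfl
  · exact ⟨η, Or.inl rfl, fun z hz => ⟨h1 z hz, h2 z hz⟩, hcd⟩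
  · exact absurd hcd (lt_irrefl _)
  · exact absurd hcd (lt_irrefl _)
  · refine ⟨-η, Or.inr rfl, fun z hz => ?_, ?_⟩
    · simp only [inner_neg_left, neg_le_neg_iff]
      exact ⟨h2 z hz, h1 z hz⟩
    · simpa only [inner_neg_left, neg_lt_neg_iff] using hcd

end IsQuad

namespace IsQuad

variable {K : Set Plane} {σ₁ σ₂ : ℝ → Plane} {l₁ l₂ : ℝ}

/-- The first corner of a geodesic triangle, or of a geodesic quadrilateral between its base and its
closest points on the top segment, is not obstructed. -/
lemma not_obstructed (hQ : IsQuad K σ₁ σ₂ l₁ l₂) (hK : IsTame K)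
    (hend : σ₁ l₁ ≠ σ₂ l₂ → ∀ z ∈ segment ℝ (σ₁ l₁) (σ₂ l₂),
      l₁ ≤ geodDist K (σ₁ 0) z ∧ l₂ ≤ geodDist K (σ₂ 0) z)
    {u v : Plane} {ε : ℝ} (hε : 0 < ε) (hε₁ : ε ≤ l₁) (hε₂ : ε ≤ l₂) (hu1 : ‖u‖ = 1)
    (hv1 : ‖v‖ = 1) (hu : ∀ τ ∈ Icc 0 ε, σ₁ τ = σ₁ 0 + τ • u)
    (hv : ∀ τ ∈ Icc 0 ε, σ₂ τ = σ₂ 0 + τ • v) :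
    ¬ (cross u (σ₂ 0 - σ₁ 0) = 0 ∨ ¬ Free K (σ₁ 0) u (σ₂ 0 - σ₁ 0)) := by
  by_cases hm : σ₁ l₁ = σ₂ l₂
  · exact hQ.not_obstructed_of_triangle hK hm hε hε₁ hε₂ hu1 hv1 hu hv
  · intro hbad
    obtain ⟨ζ, -, h1, h2⟩ := hQ.exists_functional hK hm (fun z hz => (hend hm z hz).1)
      (fun z hz => (hend hm z hz).2)
    have h3 := hQ.inner_base_eq_zero hK (ξ := -ζ) hε hε₁ hu1 hu hbad (fun z hz => by
      rw [inner_neg_left, inner_neg_left, neg_le_neg_iff]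
      exact (h1 z hz).1)
    rw [inner_neg_left, inner_sub_right] at h3
    linarith

/-- The geodesics do not diverge faster than the base. If both are orthogonal to the base, then
the top segment is parallel to the base. -/
lemma inner_le_inner (hQ : IsQuad K σ₁ σ₂ l₁ l₂) (hK : IsTame K)
    (hend : σ₁ l₁ ≠ σ₂ l₂ → ∀ z ∈ segment ℝ (σ₁ l₁) (σ₂ l₂),
      l₁ ≤ geodDist K (σ₁ 0) z ∧ l₂ ≤ geodDist K (σ₂ 0) z)
    {u v w : Plane} {ε L : ℝ} (hε : 0 < ε) (hε₁ : ε ≤ l₁) (hε₂ : ε ≤ l₂) (hu1 : ‖u‖ = 1)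
    (hv1 : ‖v‖ = 1) (hu : ∀ τ ∈ Icc 0 ε, σ₁ τ = σ₁ 0 + τ • u)
    (hv : ∀ τ ∈ Icc 0 ε, σ₂ τ = σ₂ 0 + τ • v)
    (hw : ‖w‖ = 1) (hL : 0 < L) (he : σ₂ 0 - σ₁ 0 = L • w) (hcu : cross w u ≠ 0)
    (hcv : cross w v ≠ 0) :
    inner ℝ w v ≤ inner ℝ w u ∧ (inner ℝ w u = 0 → inner ℝ w v = 0 →
      σ₁ l₁ ≠ σ₂ l₂ ∧ cross w (σ₂ l₂ - σ₁ l₁) = 0) := by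
  by_cases hm : σ₁ l₁ = σ₂ l₂
  · obtain ⟨n, hn, hnu, hnv, hlt⟩ :=
      hQ.mul_lt_mul_of_triangle hK hm hε hε₁ hε₂ hu hv hw hL he hcu hcv
    refine ⟨?_, fun h1 h2 => ?_⟩
    · exact le_of_mul_le_mul_of_sq_add_sq (by rw [hn, hu1, one_pow]) (by rw [hn, hv1, one_pow])
        hnu hnv hlt.le
    · rw [h1, h2, zero_mul, zero_mul] at hlt
      exact absurd hlt (lt_irrefl _)
  obtain ⟨ζ, hζ, h1, h2⟩ := hQ.exists_functional hK hm (fun z hz => (hend hm z hz).1)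
    (fun z hz => (hend hm z hz).2)
  obtain ⟨n, hn, hnw, hnc, hny⟩ := exists_normal hw (σ₁ l₁ - σ₁ 0)
  have hww : inner ℝ w w = 1 := by rw [real_inner_self_eq_norm_sq, hw, one_pow]
  have hnn : inner ℝ n n = 1 := by
    have h3 := hn n
    rw [real_inner_comm, hnw, ← real_inner_self_eq_norm_sq] at h3
    have h4 : inner ℝ n n * (inner ℝ n n - 1) = 0 := by nlinarith
    rcases mul_eq_zero.1 h4 with h5 | h5
    · exfalso
      rw [inner_self_eq_zero] at h5
      refine hcu ((hnc u).1 ?_)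
      rw [h5, inner_zero_left]
    · linarith
  -- Expansion in the orthonormal frame
  have hζe : ∀ z : Plane, inner ℝ ζ z =
      inner ℝ ζ w * inner ℝ w z + inner ℝ ζ n * inner ℝ n z := by
    intro z
    have h3 : z - inner ℝ w z • w - inner ℝ n z • n = 0 := by
      rw [← norm_eq_zero, ← pow_eq_zero_iff two_ne_zero, ← hn]
      simp only [inner_sub_right, inner_smul_right, hww, hnn, hnw, real_inner_comm n w]
      ring
    have h4 : inner ℝ ζ (z - inner ℝ w z • w - inner ℝ n z • n) = 0 := by
      rw [h3, inner_zero_right]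
    rw [inner_sub_right, inner_sub_right, inner_smul_right, inner_smul_right] at h4
    linarith
  have hx2 : σ₂ 0 = σ₁ 0 + L • w := by rw [← he]; abel
  have hζw : 0 < inner ℝ ζ w := by
    rw [hx2, inner_add_right, inner_smul_right] at h2
    nlinarith
  have hζu : 0 ≤ inner ℝ ζ u := by
    have := (h1 _ (mem_arc₁ ⟨hε.le, hε₁⟩)).1
    rw [hu ε ⟨hε.le, le_rfl⟩, inner_add_right, inner_smul_right] at this
    nlinarith
  have hζv : inner ℝ ζ v ≤ 0 := by
    have := (h1 _ (mem_arc₂ ⟨hε.le, hε₂⟩)).2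
    rw [hv ε ⟨hε.le, le_rfl⟩, inner_add_right, inner_smul_right] at this
    nlinarith
  -- The top segment does not reach the line through the base.
  have htop : 0 < inner ℝ n (σ₁ l₁ - σ₁ 0) ∧ 0 < inner ℝ n (σ₂ l₂ - σ₁ 0) := by
    by_contra hcon
    obtain ⟨z, hz, hz0⟩ : ∃ z ∈ segment ℝ (σ₁ l₁) (σ₂ l₂), inner ℝ n (z - σ₁ 0) = 0 := by
      rcases hny.eq_or_lt with h3 | h3
      · exact ⟨σ₁ l₁, left_mem_segment _ _ _, h3.symm⟩
      · have h4 : inner ℝ n (σ₂ l₂ - σ₁ 0) ≤ 0 := not_lt.1 fun h4 => hcon ⟨h3, h4⟩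
        exact (segment_isPreconnected (σ₁ l₁) (σ₂ l₂)).intermediate_value
          (right_mem_segment _ _ _) (left_mem_segment _ _ _)
          (f := fun z => inner ℝ n (z - σ₁ 0)) (by fun_prop) ⟨h4, h3.le⟩
    obtain ⟨h3, h4⟩ := h1 z (mem_top hz)
    have h5 := hζe (z - σ₁ 0)
    rw [hz0, mul_zero, add_zero] at h5
    have h6 : z - σ₁ 0 = inner ℝ w (z - σ₁ 0) • w := by
      have h7 : z - σ₁ 0 - inner ℝ w (z - σ₁ 0) • w = 0 := by
        rw [← norm_eq_zero, ← pow_eq_zero_iff two_ne_zero, ← hn]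
        rw [inner_sub_right n, hz0, inner_smul_right n, hnw, inner_sub_right w, inner_smul_right w,
          hww]
        ring
      exact sub_eq_zero.1 h7
    refine hQ.base_top z ?_ hz
    rw [segment_eq_image']
    rw [inner_sub_right] at h5
    rw [hx2, inner_add_right, inner_smul_right] at h4
    refine ⟨inner ℝ w (z - σ₁ 0) / L, ⟨?_, ?_⟩, ?_⟩
    · refine div_nonneg ?_ hL.le
      nlinarith
    · rw [div_le_one hL]
      nlinarith
    · simp only
      rw [he, smul_smul, div_mul_cancel₀ _ hL.ne', ← h6]
      abel
  have hside : ∀ z ∈ quadCurve σ₁ σ₂ l₁ l₂, 0 ≤ inner ℝ n (z - σ₁ 0) := by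
    intro z hz
    obtain ⟨c, hc, hmax⟩ := hQ.exists_max_corner hK (-n)
    have h3 : 0 ≤ inner ℝ n (c - σ₁ 0) := by
      rcases hc with rfl | rfl | rfl | rfl
      · simp
      · rw [he, inner_smul_right, hnw, mul_zero]
      · exact htop.1.le
      · exact htop.2.le
    have h4 := hmax z hz
    rw [inner_neg_left, inner_neg_left, neg_le_neg_iff] at h4
    rw [inner_sub_right] at h3 ⊢
    linarith
  have hsu : 0 < inner ℝ n u := by
    have := hside _ (mem_arc₁ ⟨hε.le, hε₁⟩)
    rw [hu ε ⟨hε.le, le_rfl⟩, add_sub_cancel_left, inner_smul_right] at this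
    exact lt_of_le_of_ne (by nlinarith) fun h => hcu ((hnc u).1 h.symm)
  have hsv : 0 < inner ℝ n v := by
    have := hside _ (mem_arc₂ ⟨hε.le, hε₂⟩)
    rw [hv ε ⟨hε.le, le_rfl⟩, add_sub_right_comm, he, inner_add_right, inner_smul_right,
      inner_smul_right, hnw, mul_zero, zero_add] at this
    exact lt_of_le_of_ne (by nlinarith) fun h => hcv ((hnc v).1 h.symm)
  rw [hζe] at hζu hζv
  refine ⟨?_, fun h3 h4 => ⟨hm, ?_⟩⟩
  · refine le_of_mul_le_mul_of_sq_add_sq (by rw [hn, hu1, one_pow]) (by rw [hn, hv1, one_pow])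
      hsu hsv ?_
    have h5 : inner ℝ ζ w * (inner ℝ w v * inner ℝ n u) ≤
        inner ℝ ζ w * (inner ℝ w u * inner ℝ n v) := by
      nlinarith [mul_le_mul_of_nonneg_right hζv hsu.le, mul_nonneg hζu hsv.le]
    exact le_of_mul_le_mul_left h5 hζw
  · rw [h3, mul_zero, zero_add] at hζu
    rw [h4, mul_zero, zero_add] at hζv
    have h5 : inner ℝ ζ n = 0 := le_antisymm (by nlinarith) (by nlinarith)
    rw [← hnc]
    rw [real_inner_comm] at h5
    rcases hζ with rfl | rfl
    · exact h5
    · rwa [inner_neg_right, neg_eq_zero] at h5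

end IsQuad

/-- `σ` is a shortest geodesic of positive length from `σ 0` to the set `h`. -/
structure IsClosest (K h : Set Plane) (σ : ℝ → Plane) (l : ℝ) : Prop where
  geo : IsGeodesic K σ l
  pos : 0 < l
  mem : σ l ∈ h
  le_geodDist : ∀ y ∈ h, l ≤ geodDist K (σ 0) y

lemma IsClosest.notMem {K h : Set Plane} {σ : ℝ → Plane} {l : ℝ} (hσ : IsClosest K h σ l) {s : ℝ}
    (hs : s ∈ Ico 0 l) : σ s ∉ h := by
  intro hmem
  have := hσ.le_geodDist _ hmem
  rw [hσ.geo.dist_eq 0 ⟨le_rfl, hσ.pos.le⟩ s ⟨hs.1, hs.2.le⟩, zero_sub, abs_neg,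
    abs_of_nonneg hs.1] at this
  linarith [hs.2]

/-- A geodesic that returns to a segment from its first point starts along this segment. -/
lemma IsGeodesic.notMem_segment {K : Set Plane} {σ : ℝ → Plane} {l : ℝ} (hσ : IsGeodesic K σ l)
    (hK : IsTame K) {u w x : Plane} {ε L : ℝ} (hε : 0 < ε) (hw : ‖w‖ = 1)
    (hu1 : ‖u‖ = 1) (hu : ∀ τ ∈ Icc 0 ε, σ τ = σ 0 + τ • u) (hL : 0 < L) (hx : x - σ 0 = L • w)
    (hseg : segment ℝ (σ 0) x ⊆ K) (huw : u ≠ w) {s : ℝ} (hs : s ∈ Ioc 0 l) :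
    σ s ∉ segment ℝ (σ 0) x := by
  intro hmem
  have h1 : segment ℝ (σ 0) (σ s) ⊆ K :=
    ((convex_segment _ _).segment_subset (left_mem_segment _ _ _) hmem).trans hseg
  have hm : 0 < min ε s := lt_min hε hs.1
  have h2 := hσ.eq_add_smul_of_segment hK (a := 0) (b := s) ⟨le_rfl, hs.1.le.trans hs.2⟩
    ⟨hs.1.le, hs.2⟩ hs.1 h1 (s := min ε s) ⟨hm.le, min_le_right _ _⟩
  rw [hu _ ⟨hm.le, min_le_left _ _⟩, sub_zero, sub_zero] at h2
  have h3 := smul_right_injective Plane hm.ne' (add_left_cancel h2)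
  rw [segment_eq_image'] at hmem
  obtain ⟨θ, hθ, h4⟩ := hmem
  simp only at h4
  rw [← h4, add_sub_cancel_left, hx, smul_smul, smul_smul] at h3
  have h5 : 0 ≤ s⁻¹ * θ * L :=
    mul_nonneg (mul_nonneg (inv_nonneg.2 hs.1.le) hθ.1) hL.le
  have h6 := congrArg norm h3
  rw [norm_smul, hw, hu1, mul_one, Real.norm_of_nonneg h5] at h6
  rw [← h6, one_smul] at h3
  exact huw h3

/-- Two points at the ends of a segment outside `h` span, together with shortest geodesics to the
segment `h`, a geodesic triangle or quadrilateral. -/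
lemma IsClosest.exists_isQuad {K h : Set Plane} {σ₁ σ₂ : ℝ → Plane} {l₁ l₂ : ℝ}
    (h₁ : IsClosest K h σ₁ l₁) (h₂ : IsClosest K h σ₂ l₂) (hK : IsTame K) (hhK : h ⊆ K)
    (hh : Convex ℝ h) {u v w : Plane} {ε L : ℝ} (hε : 0 < ε) (hu1 : ‖u‖ = 1)
    (hv1 : ‖v‖ = 1) (hu : ∀ τ ∈ Icc 0 ε, σ₁ τ = σ₁ 0 + τ • u)
    (hv : ∀ τ ∈ Icc 0 ε, σ₂ τ = σ₂ 0 + τ • v) (hw : ‖w‖ = 1) (hL : 0 < L)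
    (he : σ₂ 0 - σ₁ 0 = L • w) (hseg : segment ℝ (σ₁ 0) (σ₂ 0) ⊆ K)
    (hdisj : ∀ z ∈ segment ℝ (σ₁ 0) (σ₂ 0), z ∉ h) (huw : u ≠ w) (hvw : v ≠ -w) :
    ∃ m₁ m₂, IsQuad K σ₁ σ₂ m₁ m₂ ∧ (σ₁ m₁ ≠ σ₂ m₂ → σ₁ m₁ ∈ h ∧ σ₂ m₂ ∈ h ∧
      ∀ z ∈ segment ℝ (σ₁ m₁) (σ₂ m₂), m₁ ≤ geodDist K (σ₁ 0) z ∧ m₂ ≤ geodDist K (σ₂ 0) z) := by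
  have hb₁ : ∀ s ∈ Ioc 0 l₁, σ₁ s ∉ segment ℝ (σ₁ 0) (σ₂ 0) := fun s hs =>
    h₁.geo.notMem_segment hK hε hw hu1 hu hL he hseg huw hs
  have hb₂ : ∀ s ∈ Ioc 0 l₂, σ₂ s ∉ segment ℝ (σ₁ 0) (σ₂ 0) := fun s hs => by
    rw [segment_symm]
    exact h₂.geo.notMem_segment hK hε (by rwa [norm_neg]) hv1 hv hL (w := -w)
      (by rw [smul_neg, ← he]; abel) (by rwa [segment_symm]) hvw hs
  have hne : σ₁ 0 ≠ σ₂ 0 := by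
    intro h
    rw [h, sub_self, eq_comm, smul_eq_zero] at he
    rcases he with he | he
    · exact hL.ne' he
    · rw [he, norm_zero] at hw
      exact zero_ne_one hw
  have hp₁ := h₁.pos
  have hp₂ := h₂.pos
  by_cases hmeet : ∃ t ∈ Icc 0 l₂, σ₂ t ∈ σ₁ '' Icc 0 l₁
  · -- Cut the geodesics off at their first common point.
    have hcomp : IsCompact (Icc 0 l₂ ∩ σ₂ ⁻¹' (σ₁ '' Icc 0 l₁)) :=
      isCompact_Icc.of_isClosed_subset ((h₂.geo.continuousOn hK).preimage_isClosed_of_isClosed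
        isClosed_Icc (h₁.geo.isCompact_image hK le_rfl le_rfl).isClosed) inter_subset_left
    obtain ⟨t, ⟨ht, s, hs, hst⟩, hleast⟩ := hcomp.exists_isLeast hmeet
    have ht0 : 0 < t := by
      refine lt_of_le_of_ne ht.1 ?_
      rintro rfl
      rcases hs.1.eq_or_lt with rfl | hs0
      · exact hne hst
      · exact hb₁ s ⟨hs0, hs.2⟩ (by rw [hst]; exact right_mem_segment _ _ _)
    have hs0 : 0 < s := by
      refine lt_of_le_of_ne hs.1 ?_
      rintro rfl
      exact hb₂ t ⟨ht0, ht.2⟩ (by rw [← hst]; exact left_mem_segment _ _ _)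
    have htop : segment ℝ (σ₁ s) (σ₂ t) = {σ₁ s} := by rw [hst, segment_same]
    refine ⟨s, t, ⟨h₁.geo.restrict hs.2, h₂.geo.restrict ht.2, hs0, ht0, hseg, ?_, hne, ?_, ?_, ?_,
      ?_, ?_, ?_⟩, fun h => absurd hst h⟩
    · rw [htop, singleton_subset_iff]
      exact h₁.geo.mem s hs
    · intro a ha b hb hab
      have hbt : b = t := le_antisymm hb.2
        (hleast ⟨⟨hb.1, hb.2.trans ht.2⟩, a, ⟨ha.1, ha.2.trans hs.2⟩, hab⟩)
      refine ⟨?_, hbt⟩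
      rw [hbt, ← hst] at hab
      exact h₁.geo.injOn ⟨ha.1, ha.2.trans hs.2⟩ hs hab
    · exact fun a ha => hb₁ a ⟨ha.1, ha.2.trans hs.2⟩
    · exact fun a ha => hb₂ a ⟨ha.1, ha.2.trans ht.2⟩
    · rw [htop]
      intro a ha h
      exact ha.2.ne (h₁.geo.injOn ⟨ha.1, ha.2.le.trans hs.2⟩ hs h)
    · rw [htop, hst]
      intro a ha h
      exact ha.2.ne (h₂.geo.injOn ⟨ha.1, ha.2.le.trans ht.2⟩ ht h)
    · rw [htop]
      rintro z hz rfl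
      exact hb₁ s ⟨hs0, hs.2⟩ hz
  · have htop : segment ℝ (σ₁ l₁) (σ₂ l₂) ⊆ h := hh.segment_subset h₁.mem h₂.mem
    refine ⟨l₁, l₂, ⟨h₁.geo, h₂.geo, hp₁, hp₂, hseg, htop.trans hhK, hne, ?_, hb₁, hb₂, ?_, ?_, ?_⟩,
      fun _ => ⟨h₁.mem, h₂.mem, fun z hz => ⟨h₁.le_geodDist z (htop hz), h₂.le_geodDist z (htop hz)⟩⟩⟩
    · exact fun s hs t ht hst => absurd ⟨t, ht, s, hs, hst⟩ hmeet
    · exact fun s hs h => h₁.notMem hs (htop h)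
    · exact fun s hs h => h₂.notMem hs (htop h)
    · exact fun z hz h => hdisj z hz (htop h)

open Classical in
/-- The slope, in the direction `e` at `x`, of the distance to the far end of a geodesic that leaves
`x` in the direction `u`: if the angle between the directions is obstructed, then `x` is on
the shortest paths from the points of the ray in the direction `e`. -/
noncomputable def distSlope (K : Set Plane) (x u e : Plane) : ℝ :=
  if Free K x u e then -inner ℝ u e else 1

lemma distSlope_le_one {K : Set Plane} {x u e : Plane} (hu : ‖u‖ = 1) (he : ‖e‖ = 1) :
    distSlope K x u e ≤ 1 := by
  rw [distSlope]
  split_ifs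
  · have := abs_real_inner_le_norm u e
    rw [hu, he, mul_one] at this
    linarith [neg_le_abs (inner ℝ u e)]
  · exact le_rfl

lemma free_self_of_segment {K : Set Plane} {x y w : Plane} {L : ℝ} (hL : 0 < L)
    (he : y - x = L • w) (hseg : segment ℝ x y ⊆ K) : Free K x w w := by
  refine ⟨L, hL, fun α β hα hβ h => hseg ?_⟩
  rw [segment_eq_image']
  refine ⟨(α + β) / L, ⟨by positivity, by rwa [div_le_one hL]⟩, ?_⟩
  simp only
  rw [he, smul_smul, div_mul_cancel₀ _ hL.ne', add_smul, add_assoc]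

/-- The slopes of the distance to `h` at the two ends of a line segment, each taken towards the
other end, add up to at most zero. If both vanish, then the segment is parallel to a part of `h`. -/
lemma IsClosest.distSlope_add_le {K h : Set Plane} {σ₁ σ₂ : ℝ → Plane} {l₁ l₂ : ℝ}
    (h₁ : IsClosest K h σ₁ l₁) (h₂ : IsClosest K h σ₂ l₂) (hK : IsTame K) (hhK : h ⊆ K)
    (hh : Convex ℝ h) {u v w : Plane} {ε L : ℝ} (hε : 0 < ε) (hu1 : ‖u‖ = 1)
    (hv1 : ‖v‖ = 1) (hu : ∀ τ ∈ Icc 0 ε, σ₁ τ = σ₁ 0 + τ • u)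
    (hv : ∀ τ ∈ Icc 0 ε, σ₂ τ = σ₂ 0 + τ • v) (hw : ‖w‖ = 1) (hL : 0 < L)
    (he : σ₂ 0 - σ₁ 0 = L • w) (hseg : segment ℝ (σ₁ 0) (σ₂ 0) ⊆ K)
    (hdisj : ∀ z ∈ segment ℝ (σ₁ 0) (σ₂ 0), z ∉ h) :
    distSlope K (σ₁ 0) u w + distSlope K (σ₂ 0) v (-w) ≤ 0 ∧
      (distSlope K (σ₁ 0) u w = 0 → distSlope K (σ₂ 0) v (-w) = 0 →
        ∃ y₁ ∈ h, ∃ y₂ ∈ h, y₁ ≠ y₂ ∧ cross w (y₂ - y₁) = 0) := by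
  have hww : inner ℝ w w = 1 := by rw [real_inner_self_eq_norm_sq, hw, one_pow]
  have hw' : ‖-w‖ = 1 := by rwa [norm_neg]
  by_cases huw : u = w
  · -- The first geodesic starts along the base: the slope there is `-1`.
    have h3 : distSlope K (σ₁ 0) u w = -1 := by
      rw [distSlope, huw, if_pos (free_self_of_segment hL he hseg), hww]
    refine ⟨?_, fun h4 => ?_⟩
    · have := distSlope_le_one (K := K) (x := σ₂ 0) hv1 hw'
      linarith
    · norm_num [h3] at h4
  by_cases hvw : v = -w
  · have h3 : distSlope K (σ₂ 0) v (-w) = -1 := by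
      rw [distSlope, hvw, if_pos (free_self_of_segment hL (y := σ₁ 0)
        (by rw [smul_neg, ← he]; abel) (by rwa [segment_symm])), inner_neg_neg, hww]
    refine ⟨?_, fun _ h4 => ?_⟩
    · have := distSlope_le_one (K := K) (x := σ₁ 0) hu1 hw
      linarith
    · norm_num [h3] at h4
  obtain ⟨m₁, m₂, hQ, hend⟩ := h₁.exists_isQuad h₂ hK hhK hh hε hu1 hv1 hu hv hw hL he hseg hdisj
    huw hvw
  set ε' := min ε (min m₁ m₂) with hε'
  have hε'0 : 0 < ε' := lt_min hε (lt_min hQ.pos₁ hQ.pos₂)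
  have hε'1 : ε' ≤ m₁ := (min_le_right _ _).trans (min_le_left _ _)
  have hε'2 : ε' ≤ m₂ := (min_le_right _ _).trans (min_le_right _ _)
  have hu' : ∀ τ ∈ Icc 0 ε', σ₁ τ = σ₁ 0 + τ • u := fun τ hτ =>
    hu τ ⟨hτ.1, hτ.2.trans (min_le_left _ _)⟩
  have hv' : ∀ τ ∈ Icc 0 ε', σ₂ τ = σ₂ 0 + τ • v := fun τ hτ =>
    hv τ ⟨hτ.1, hτ.2.trans (min_le_left _ _)⟩
  have hobs₁ := hQ.not_obstructed hK (fun hne => (hend hne).2.2) hε'0 hε'1 hε'2 hu1 hv1 hu' hv'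
  have hobs₂ := hQ.swap.not_obstructed hK (fun hne z hz => ((hend hne.symm).2.2 z
    (by rwa [segment_symm])).symm) hε'0 hε'2 hε'1 hv1 hu1 hv' hu'
  rw [not_or, not_not] at hobs₁ hobs₂
  have he' : σ₁ 0 - σ₂ 0 = L • -w := by rw [smul_neg, ← he]; abel
  have hunscale : ∀ x a b : Plane, Free K x a (L • b) → Free K x a b := by
    intro x a b hf
    have := hf.smul_right (inv_pos.2 hL)
    rwa [smul_smul, inv_mul_cancel₀ hL.ne', one_smul] at this
  have hf₁ : Free K (σ₁ 0) u w := hunscale _ _ _ (by rw [← he]; exact hobs₁.2)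
  have hf₂ : Free K (σ₂ 0) v (-w) := hunscale _ _ _ (by rw [← he']; exact hobs₂.2)
  have hc₁ : cross w u ≠ 0 := by
    intro hc
    refine hobs₁.1 ?_
    rw [he]
    have : cross u (L • w) = -(L * cross w u) := by
      simp only [cross, PiLp.smul_apply, smul_eq_mul]; ring
    rw [this, hc, mul_zero, neg_zero]
  have hc₂ : cross w v ≠ 0 := by
    intro hc
    refine hobs₂.1 ?_
    rw [he']
    have : cross v (L • -w) = L * cross w v := by
      simp only [cross, PiLp.smul_apply, PiLp.neg_apply, smul_eq_mul]; ring
    rw [this, hc, mul_zero]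
  obtain ⟨h3, h4⟩ := hQ.inner_le_inner hK (fun hne => (hend hne).2.2) hε'0 hε'1 hε'2 hu1 hv1 hu' hv'
    hw hL he hc₁ hc₂
  rw [distSlope, distSlope, if_pos hf₁, if_pos hf₂, inner_neg_right, neg_neg, real_inner_comm w u,
    real_inner_comm w v]
  refine ⟨by linarith, fun h5 h6 => ?_⟩
  obtain ⟨h7, h8⟩ := h4 (by linarith) h6
  exact ⟨_, (hend h7).1, _, (hend h7).2.1, h7, h8⟩

/-! ### The distance to a set -/

section

variable {K h : Set Plane}

lemma IsTame.exists_geodDistTo_eq (hK : IsTame K) (hc : IsCompact h) (hne : h.Nonempty)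
    (hhK : h ⊆ K) {x : Plane} (hx : x ∈ K) :
    ∃ y ∈ h, geodDistTo K h x = geodDist K x y ∧ ∀ z ∈ h, geodDist K x y ≤ geodDist K x z := by
  obtain ⟨y, hy, hmin⟩ := hc.exists_isMinOn hne ((hK.continuousOn_geodDist_left hx).mono hhK)
  refine ⟨y, hy, ?_, fun z hz => hmin hz⟩
  have : ⨅ z ∈ h, geodEDist K x z = geodEDist K x y := by
    refine le_antisymm (iInf₂_le y hy) (le_iInf₂ fun z hz => ?_)
    rw [← hK.ofReal_geodDist hx (hhK hy), ← hK.ofReal_geodDist hx (hhK hz)]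
    exact ENNReal.ofReal_le_ofReal (hmin hz)
  rw [geodDistTo, this, geodDist]

lemma IsTame.geodDistTo_le (hK : IsTame K) (hc : IsCompact h) (hhK : h ⊆ K) {x y : Plane}
    (hx : x ∈ K) (hy : y ∈ h) : geodDistTo K h x ≤ geodDist K x y := by
  obtain ⟨z, -, h1, h2⟩ := hK.exists_geodDistTo_eq hc ⟨y, hy⟩ hhK hx
  rw [h1]
  exact h2 y hy

lemma IsTame.geodDistTo_le_add (hK : IsTame K) (hc : IsCompact h) (hne : h.Nonempty) (hhK : h ⊆ K)
    {x y : Plane} (hx : x ∈ K) (hy : y ∈ K) :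
    geodDistTo K h x ≤ geodDist K x y + geodDistTo K h y := by
  obtain ⟨z, hz, h1, -⟩ := hK.exists_geodDistTo_eq hc hne hhK hy
  rw [h1]
  exact (hK.geodDistTo_le hc hhK hx hz).trans (hK.geodDist_triangle hx hy (hhK hz))

lemma geodDistTo_nonneg (K h : Set Plane) (x : Plane) : 0 ≤ geodDistTo K h x :=
  ENNReal.toReal_nonneg

lemma IsTame.geodDistTo_eq_zero_iff (hK : IsTame K) (hc : IsCompact h) (hne : h.Nonempty)
    (hhK : h ⊆ K) {x : Plane} (hx : x ∈ K) : geodDistTo K h x = 0 ↔ x ∈ h := by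
  constructor
  · intro h0
    obtain ⟨y, hy, h1, -⟩ := hK.exists_geodDistTo_eq hc hne hhK hx
    have h2 := hK.dist_le_geodDist hx (hhK hy)
    rw [← h1, h0] at h2
    rwa [dist_le_zero.1 h2]
  · intro hxh
    refine le_antisymm ?_ (geodDistTo_nonneg K h x)
    have := hK.geodDistTo_le hc hhK hx hxh
    rwa [geodDist_self hx] at this

/-- The distance to a set is 1-Lipschitz along geodesics. -/
lemma IsGeodesic.continuousOn_geodDistTo {σ : ℝ → Plane} {l : ℝ} (hσ : IsGeodesic K σ l)
    (hK : IsTame K) (hc : IsCompact h) (hne : h.Nonempty) (hhK : h ⊆ K) :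
    ContinuousOn (fun s => geodDistTo K h (σ s)) (Icc 0 l) := by
  have : LipschitzOnWith 1 (fun s => geodDistTo K h (σ s)) (Icc 0 l) :=
    LipschitzOnWith.of_dist_le_mul fun s hs t ht => by
      have h1 := hK.geodDistTo_le_add hc hne hhK (hσ.mem s hs) (hσ.mem t ht)
      have h2 := hK.geodDistTo_le_add hc hne hhK (hσ.mem t ht) (hσ.mem s hs)
      rw [hσ.dist_eq t ht s hs, abs_sub_comm] at h2
      rw [hσ.dist_eq s hs t ht] at h1
      rw [Real.dist_eq, Real.dist_eq, NNReal.coe_one, one_mul, abs_le]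
      constructor <;> linarith
  exact this.continuousOn

lemma IsTame.exists_isClosest (hK : IsTame K) (hc : IsCompact h) (hne : h.Nonempty) (hhK : h ⊆ K)
    {x : Plane} (hx : x ∈ K) (hxh : x ∉ h) :
    ∃ σ u ε, IsClosest K h σ (geodDistTo K h x) ∧ σ 0 = x ∧ ‖u‖ = 1 ∧ 0 < ε ∧
      ε ≤ geodDistTo K h x ∧ ∀ τ ∈ Icc 0 ε, σ τ = σ 0 + τ • u := by
  obtain ⟨y, hy, h1, h2⟩ := hK.exists_geodDistTo_eq hc hne hhK hx
  obtain ⟨σ, hσ, h0, hl⟩ := hK.exists_isGeodesic hx (hhK hy)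
  have hpos : 0 < geodDistTo K h x := lt_of_le_of_ne (geodDistTo_nonneg K h x)
    fun h0 => hxh ((hK.geodDistTo_eq_zero_iff hc hne hhK hx).1 h0.symm)
  rw [← h1] at hσ hl
  obtain ⟨u, hu, ε, hε, hεl, hσu⟩ := hσ.exists_direction hK (a := 0) ⟨le_rfl, hpos⟩
  simp only [zero_add] at hεl hσu
  refine ⟨σ, u, ε, ⟨hσ, hpos, by rwa [hl], ?_⟩, h0, hu, hε, hεl, hσu⟩
  rw [h1, h0]
  exact h2

/-- An upper bound for the one-sided derivative of the distance to a set. -/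
lemma IsClosest.geodDistTo_le {σ : ℝ → Plane} {l : ℝ} (hσ : IsClosest K h σ l) (hK : IsTame K)
    (hc : IsCompact h) (hhK : h ⊆ K) {u e : Plane} {ε L : ℝ} (hu1 : ‖u‖ = 1) (he1 : ‖e‖ = 1)
    (hε : 0 < ε) (hεl : ε ≤ l) (hu : ∀ τ ∈ Icc 0 ε, σ τ = σ 0 + τ • u) (hL : 0 < L)
    (heK : ∀ τ ∈ Icc 0 L, σ 0 + τ • e ∈ K) {η : ℝ} (hη : 0 < η) :
    ∃ δ > 0, ∀ τ ∈ Icc 0 δ, geodDistTo K h (σ 0 + τ • e) ≤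
      l + (distSlope K (σ 0) u e + η) * τ := by
  have hl := hσ.pos
  have hx := hσ.geo.mem 0 ⟨le_rfl, hl.le⟩
  have hne : h.Nonempty := ⟨_, hσ.mem⟩
  by_cases hf : Free K (σ 0) u e
  · obtain ⟨δ, hδ, hseg⟩ := hf.exists_segment
    set ρ := min δ ε with hρ
    have hρ0 : 0 < ρ := lt_min hδ hε
    have hρε : ρ ≤ ε := min_le_right _ _
    refine ⟨min (min δ L) (2 * ρ * η), by positivity, fun τ hτ => ?_⟩
    have hτδ : τ ≤ δ := hτ.2.trans ((min_le_left _ _).trans (min_le_left _ _))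
    have hτL : τ ≤ L := hτ.2.trans ((min_le_left _ _).trans (min_le_right _ _))
    have hτη : τ ≤ 2 * ρ * η := hτ.2.trans (min_le_right _ _)
    have hKτ := heK τ ⟨hτ.1, hτL⟩
    have hmem : σ ρ ∈ K := hσ.geo.mem ρ ⟨hρ0.le, hρε.trans hεl⟩
    have h1 : geodDist K (σ ρ) (σ 0 + τ • e) = ‖ρ • u - τ • e‖ := by
      rw [hu ρ ⟨hρ0.le, hρε⟩, geodDist_of_segment (hseg ρ τ ⟨hρ0.le, min_le_left _ _⟩ ⟨hτ.1, hτδ⟩),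
        dist_eq_norm, add_sub_add_left_eq_sub]
    have h2 := hK.geodDistTo_le hc hhK hKτ hσ.mem
    have h3 := hK.geodDist_triangle hKτ hmem (hhK hσ.mem)
    rw [hσ.geo.dist_eq ρ ⟨hρ0.le, hρε.trans hεl⟩ l ⟨hl.le, le_rfl⟩, geodDist_comm K _ (σ ρ), h1,
      abs_of_nonpos (by linarith)] at h3
    set c : ℝ := inner ℝ u e with hcdef
    have hc1 : c ≤ 1 := by
      have := real_inner_le_norm u e
      rwa [hu1, he1, mul_one] at this
    have h4 : ‖ρ • u - τ • e‖ ≤ ρ - τ * c + τ ^ 2 / (2 * ρ) := by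
      have h5 : 0 ≤ ρ - τ * c + τ ^ 2 / (2 * ρ) := by
        have h6 : ρ - τ + τ ^ 2 / (2 * ρ) = ((ρ - τ) ^ 2 + ρ ^ 2) / (2 * ρ) := by
          field_simp
          ring
        have h7 : 0 ≤ ((ρ - τ) ^ 2 + ρ ^ 2) / (2 * ρ) := by positivity
        nlinarith [hτ.1]
      refine le_of_sq_le_sq ?_ h5
      have h6 := norm_sub_sq_real (ρ • u) (τ • e)
      rw [norm_smul, norm_smul, hu1, he1, Real.norm_of_nonneg hτ.1, Real.norm_of_nonneg hρ0.le,
        real_inner_smul_left, real_inner_smul_right, ← hcdef] at h6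
      have h7 : (ρ - τ * c + τ ^ 2 / (2 * ρ)) ^ 2 =
          ρ ^ 2 - 2 * (ρ * (τ * c)) + τ ^ 2 + (τ * c - τ ^ 2 / (2 * ρ)) ^ 2 := by
        field_simp
        ring
      rw [h6, h7]
      nlinarith [sq_nonneg (τ * c - τ ^ 2 / (2 * ρ))]
    have h5 : τ ^ 2 / (2 * ρ) ≤ η * τ := by
      rw [div_le_iff₀ (by positivity)]
      nlinarith [hτ.1]
    rw [distSlope, if_pos hf]
    linarith
  · refine ⟨L, hL, fun τ hτ => ?_⟩
    have hKτ := heK τ hτ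
    have h1 := hK.geodDistTo_le hc hhK hKτ hσ.mem
    have h2 := hK.geodDist_triangle hKτ hx (hhK hσ.mem)
    have hseg : segment ℝ (σ 0 + τ • e) (σ 0) ⊆ K := by
      rw [segment_symm, segment_eq_image']
      rintro _ ⟨θ, hθ, rfl⟩
      simp only [add_sub_cancel_left, smul_smul]
      exact heK _ ⟨mul_nonneg hθ.1 hτ.1, (mul_le_of_le_one_left hτ.1 hθ.2).trans hτ.2⟩
    rw [geodDist_of_segment hseg, dist_eq_norm, add_sub_cancel_left, norm_smul, he1,
      Real.norm_of_nonneg hτ.1, hσ.geo.dist_eq 0 ⟨le_rfl, hl.le⟩ l ⟨hl.le, le_rfl⟩, zero_sub,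
      abs_neg, abs_of_pos hl] at h2
    rw [distSlope, if_neg hf]
    nlinarith [hτ.1]

/-- The slope is a global bound along segments outside `h`. -/
lemma IsClosest.le_geodDistTo {σ : ℝ → Plane} {l : ℝ} (hσ : IsClosest K h σ l) (hK : IsTame K)
    (hc : IsCompact h) (hhK : h ⊆ K) (hh : Convex ℝ h) {u w : Plane} {ε L : ℝ}
    (hu1 : ‖u‖ = 1) (hw : ‖w‖ = 1) (hε : 0 < ε)
    (hu : ∀ τ ∈ Icc 0 ε, σ τ = σ 0 + τ • u) (hL : 0 ≤ L)
    (hwK : ∀ τ ∈ Icc 0 L, σ 0 + τ • w ∈ K) (hwh : ∀ τ ∈ Icc 0 L, σ 0 + τ • w ∉ h) :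
    geodDistTo K h (σ 0) + distSlope K (σ 0) u w * L ≤ geodDistTo K h (σ 0 + L • w) := by
  have hne : h.Nonempty := ⟨_, hσ.mem⟩
  set f := geodDistTo K h with hf
  set S := distSlope K (σ 0) u w with hS
  have hsub : ∀ s ∈ Icc 0 L, ∀ t ∈ Icc 0 L,
      segment ℝ (σ 0 + s • w) (σ 0 + t • w) ⊆ (fun τ : ℝ => σ 0 + τ • w) '' Icc 0 L := by
    rintro s hs t ht _ ⟨a, b, ha, hb, hab, rfl⟩
    refine ⟨a * s + b * t, (convex_Icc 0 L) hs ht ha hb hab, ?_⟩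
    have hx : σ 0 = (a + b) • σ 0 := by rw [hab, one_smul]
    simp only
    conv_lhs => rw [hx]
    module
  have hsubK : ∀ s ∈ Icc 0 L, ∀ t ∈ Icc 0 L, segment ℝ (σ 0 + s • w) (σ 0 + t • w) ⊆ K := by
    intro s hs t ht z hz
    obtain ⟨τ, hτ, rfl⟩ := hsub s hs t ht hz
    exact hwK τ hτ
  have hdist : ∀ s ∈ Icc 0 L, ∀ t ∈ Icc 0 L,
      geodDist K (σ 0 + s • w) (σ 0 + t • w) = |s - t| := by
    intro s hs t ht
    rw [geodDist_of_segment (hsubK s hs t ht), dist_eq_norm, add_sub_add_left_eq_sub, ← sub_smul,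
      norm_smul, hw, mul_one, Real.norm_eq_abs]
  have hgeo : IsGeodesic K (fun τ => σ 0 + τ • w) L := ⟨hwK, hdist⟩
  have hcont := hgeo.continuousOn_geodDistTo hK hc hne hhK
  suffices key : ∀ η > 0, f (σ 0) + (S - η) * L ≤ f (σ 0 + L • w) by
    refine le_of_forall_pos_le_add fun η hη => ?_
    have h1 := key (η / (L + 1)) (by positivity)
    have h2 : η / (L + 1) * L ≤ η := by
      rw [div_mul_eq_mul_div, div_le_iff₀ (by positivity)]
      nlinarith
    linarith
  intro η hη
  have hcl : IsClosed ({s | f (σ 0 + s • w) + (S - η) * (L - s) ≤ f (σ 0 + L • w)} ∩ Icc 0 L) := by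
    have hcont' : ContinuousOn (fun s => f (σ 0 + s • w) + (S - η) * (L - s)) (Icc 0 L) :=
      hcont.add (by fun_prop)
    have := hcont'.preimage_isClosed_of_isClosed isClosed_Icc (isClosed_Iic (a := f (σ 0 + L • w)))
    rw [inter_comm]
    exact this
  have hmem := hcl.Icc_subset_of_forall_exists_lt (a := 0) (b := L) ?_ ?_
  · have h0 := hmem ⟨le_rfl, hL⟩
    have h1 : f (σ 0 + (0 : ℝ) • w) + (S - η) * (L - 0) ≤ f (σ 0 + L • w) := h0
    rwa [zero_smul, add_zero, sub_zero] at h1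
  · change f (σ 0 + L • w) + (S - η) * (L - L) ≤ f (σ 0 + L • w)
    rw [sub_self, mul_zero, add_zero]
  · rintro s ⟨hs, hs0⟩ y hy
    have hsI : s ∈ Icc 0 L := ⟨hs0.1.le, hs0.2⟩
    have hs' : f (σ 0 + s • w) + (S - η) * (L - s) ≤ f (σ 0 + L • w) := hs
    obtain ⟨σ', v, ε', hσ', h0, hv1, hε', hεl', hv⟩ :=
      hK.exists_isClosest hc hne hhK (hwK s hsI) (hwh s hsI)
    have hseg : segment ℝ (σ 0) (σ' 0) ⊆ (fun τ : ℝ => σ 0 + τ • w) '' Icc 0 L := by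
      have := hsub 0 ⟨le_rfl, hL⟩ s hsI
      rwa [zero_smul, add_zero, ← h0] at this
    have h1 := (hσ.distSlope_add_le hσ' hK hhK hh (w := w) (L := s) (lt_min hε hε') hu1 hv1
      (fun τ hτ => hu τ ⟨hτ.1, hτ.2.trans (min_le_left _ _)⟩)
      (fun τ hτ => hv τ ⟨hτ.1, hτ.2.trans (min_le_right _ _)⟩) hw hs0.1
      (by rw [h0, add_sub_cancel_left]) (fun z hz => by
        obtain ⟨τ, hτ, rfl⟩ := hseg hz
        exact hwK τ hτ) (fun z hz => by
        obtain ⟨τ, hτ, rfl⟩ := hseg hz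
        exact hwh τ hτ)).1
    have hback : ∀ τ : ℝ, σ' 0 + τ • -w = σ 0 + (s - τ) • w := fun τ => by
      rw [h0]
      module
    obtain ⟨δ, hδ, h2⟩ := hσ'.geodDistTo_le hK hc hhK (e := -w) (L := s) hv1 (by rwa [norm_neg])
      hε' hεl' hv hs0.1 (fun τ hτ => by
        rw [hback]
        exact hwK _ ⟨by linarith [hτ.2], by linarith [hτ.1, hs0.2]⟩) hη
    set y' := max y 0 with hy'
    have hy's : y' < s := max_lt hy hs0.1
    have hτ0 : 0 < min δ (s - y') := lt_min hδ (by linarith)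
    have hτ1 : min δ (s - y') ≤ s - y' := min_le_right _ _
    have h3 := h2 (min δ (s - y')) ⟨hτ0.le, min_le_left _ _⟩
    rw [hback] at h3
    refine ⟨s - min δ (s - y'), ?_, by linarith [le_max_left y 0], by linarith⟩
    change f (σ 0 + (s - min δ (s - y')) • w) + (S - η) * (L - (s - min δ (s - y'))) ≤
      f (σ 0 + L • w)
    rw [← hf] at h3
    nlinarith

end

/-- The angle between two directions is free if it is covered by the angles that a third direction
forms with them. -/
lemma Free.of_add {K : Set Plane} {x u a b : Plane} (ha : Free K x u a) (hb : Free K x u b)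
    {r s : ℝ} (hu : u = r • a + s • b) (h : 0 < r ∨ 0 < s) : Free K x a b := by
  -- The case in which `b` lies between `u` and `a`
  have side : ∀ {a b : Plane} {r s : ℝ}, Free K x u a → u = r • a + s • b → 0 < s → r ≤ 0 →
      Free K x a b := by
    intro a b r s ha hu hs hr
    obtain ⟨δ, hδ, h⟩ := ha
    have hC : 0 < 1 + 1 / s - r / s := by
      have : r / s ≤ 0 := div_nonpos_of_nonpos_of_nonneg hr hs.le
      have : 0 < 1 / s := by positivity
      linarith
    refine ⟨δ / (1 + 1 / s - r / s), by positivity, fun α β hα hβ hαβ => ?_⟩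
    rw [le_div_iff₀ hC] at hαβ
    have h1 : x + α • a + β • b = x + (β / s) • u + (α - β * (r / s)) • a := by
      have : b = (1 / s) • u - (r / s) • a := by
        rw [hu, smul_add, smul_smul, smul_smul, one_div_mul_cancel hs.ne', one_div_mul_eq_div]
        module
      rw [this]
      module
    have h2 : r / s ≤ 0 := div_nonpos_of_nonpos_of_nonneg hr hs.le
    have h3 : 0 < 1 / s := by positivity
    rw [h1]
    refine h _ _ (by positivity) (by nlinarith) ?_
    have : β / s = β * (1 / s) := by ring
    rw [this]
    nlinarith [mul_nonneg hα h3.le, mul_nonneg hα (neg_nonneg.2 h2)]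
  rcases le_or_gt r 0 with hr | hr
  · exact side ha hu (h.resolve_left (not_lt.2 hr)) hr
  rcases le_or_gt s 0 with hs | hs
  · exact (side hb (by rw [hu, add_comm]) hr hs).symm
  obtain ⟨δ, hδ, h1⟩ := ha
  obtain ⟨δ', hδ', h2⟩ := hb
  have hC : 0 < 1 + 1 / r + 1 / s := by positivity
  refine ⟨min δ δ' / (1 + 1 / r + 1 / s), by positivity, fun α β hα hβ hαβ => ?_⟩
  rw [le_div_iff₀ hC] at hαβ
  have hr' : 0 < 1 / r := by positivity
  have hs' : 0 < 1 / s := by positivity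
  rcases le_total (β * r) (α * s) with hle | hle
  · have h3 : x + α • a + β • b = x + (β / s) • u + (α - β * r / s) • a := by
      rw [hu, smul_add, smul_smul, smul_smul, div_mul_cancel₀ _ hs.ne']
      have : β * r / s = β / s * r := by ring
      rw [this]
      module
    rw [h3]
    have h4 : 0 ≤ β * r / s := by positivity
    have h6 : β / s = β * (1 / s) := by ring
    refine h1 _ _ (by positivity) ?_ ?_
    · rw [sub_nonneg, div_le_iff₀ hs]
      exact hle
    · rw [h6]
      nlinarith [min_le_left δ δ', mul_nonneg hα hs'.le, mul_nonneg hα hr'.le,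
        mul_nonneg hβ hr'.le]
  · have h3 : x + α • a + β • b = x + (α / r) • u + (β - α * s / r) • b := by
      rw [hu, smul_add, smul_smul, smul_smul, div_mul_cancel₀ _ hr.ne']
      have : α * s / r = α / r * s := by ring
      rw [this]
      module
    rw [h3]
    have h4 : 0 ≤ α * s / r := by positivity
    have h6 : α / r = α * (1 / r) := by ring
    refine h2 _ _ (by positivity) ?_ ?_
    · rw [sub_nonneg, div_le_iff₀ hr]
      exact hle
    · rw [h6]
      nlinarith [min_le_right δ δ', mul_nonneg hα hs'.le, mul_nonneg hβ hs'.le,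
        mul_nonneg hβ hr'.le]

/-- At a bend of a geodesic the two slopes of the distance do not make up a concave angle. -/
lemma IsGeodesic.distSlope_add_nonneg {K : Set Plane} {σ : ℝ → Plane} {l s ε : ℝ}
    (hσ : IsGeodesic K σ l) {a b u : Plane} (ha : ‖a‖ = 1) (hb : ‖b‖ = 1) (hu : ‖u‖ = 1)
    (hε : 0 < ε) (h0 : ε ≤ s) (hl : s + ε ≤ l)
    (hσa : ∀ τ ∈ Icc 0 ε, σ (s - τ) = σ s + τ • a)
    (hσb : ∀ τ ∈ Icc 0 ε, σ (s + τ) = σ s + τ • b) :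
    0 ≤ distSlope K (σ s) u b + distSlope K (σ s) u a := by
  have hle : ∀ c d : Plane, ‖c‖ = 1 → ‖d‖ = 1 → inner ℝ c d ≤ 1 ∧ -1 ≤ inner ℝ c d := by
    intro c d hc hd
    have := abs_real_inner_le_norm c d
    rw [hc, hd, mul_one, abs_le] at this
    exact this.symm
  rw [distSlope, distSlope]
  split_ifs with hfb hfa hfa
  · suffices h : inner ℝ u (a + b) ≤ 0 by
      rw [inner_add_right] at h
      linarith
    by_cases hab : a = -b
    · rw [hab, neg_add_cancel, inner_zero_right]
    have hnf : ¬ Free K (σ s) a b := fun hf =>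
      hab (hσ.eq_neg_of_free ha hb hε h0 hl hσa hσb hf)
    have hc : cross a b ≠ 0 := by
      intro hc
      rcases eq_or_eq_neg_of_cross_eq_zero ha hb hc with h | h
      · have h3 : σ (s - ε) = σ (s + ε) := by
          rw [hσa ε ⟨hε.le, le_rfl⟩, hσb ε ⟨hε.le, le_rfl⟩, h]
        have := hσ.injOn ⟨by linarith, by linarith⟩ ⟨by linarith, by linarith⟩ h3
        linarith
      · exact hab h
    have hexp : u = (cross u b / cross a b) • a + (cross a u / cross a b) • b := by
      have h1 : cross a b • u = cross u b • a + cross a u • b := by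
        ext i
        fin_cases i
        · simp only [cross, PiLp.add_apply, PiLp.smul_apply, smul_eq_mul]
          simp
          ring
        · simp only [cross, PiLp.add_apply, PiLp.smul_apply, smul_eq_mul]
          simp
          ring
      rw [div_eq_inv_mul, div_eq_inv_mul, ← smul_smul, ← smul_smul, ← smul_add, ← h1, smul_smul,
        inv_mul_cancel₀ hc, one_smul]
    have hr : cross u b / cross a b ≤ 0 := by
      by_contra! h
      exact hnf (hfa.of_add hfb hexp (Or.inl h))
    have hs : cross a u / cross a b ≤ 0 := by
      by_contra! h
      exact hnf (hfa.of_add hfb hexp (Or.inr h))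
    have h1 := (hle a b ha hb).2
    rw [hexp, inner_add_left, inner_add_right, inner_add_right, real_inner_smul_left,
      real_inner_smul_left, real_inner_smul_left, real_inner_smul_left,
      real_inner_self_eq_norm_sq, real_inner_self_eq_norm_sq, ha, hb, real_inner_comm a b]
    nlinarith
  · linarith [(hle u b hu hb).1]
  · linarith [(hle u a hu ha).1]
  · norm_num

/-! ### Convexity along geodesics -/

/-- A continuous function on an interval with local affine lower bounds that are attained at the
interior points is convex: the difference to a chord cannot have a first positive maximum. -/
lemma convexOn_of_local_support {g : ℝ → ℝ} {D : ℝ} (hg : ContinuousOn g (Icc 0 D))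
    (hsupp : ∀ t ∈ Ioo 0 D, ∃ m : ℝ, ∃ ε > 0, ∀ τ ∈ Icc 0 ε,
      g t + m * τ ≤ g (t + τ) ∧ g t - m * τ ≤ g (t - τ)) : ConvexOn ℝ (Icc 0 D) g := by
  refine LinearOrder.convexOn_of_lt (convex_Icc 0 D) fun x hx y hy hxy a b ha hb hab => ?_
  have hyx : 0 < y - x := sub_pos.2 hxy
  set k := (g y - g x) / (y - x) with hk
  have hky : k * (y - x) = g y - g x := div_mul_cancel₀ _ hyx.ne'
  set φ : ℝ → ℝ := fun t => g t - g x - k * (t - x) with hφ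
  have hφc : ContinuousOn φ (Icc x y) := by
    have := hg.mono (Icc_subset_Icc hx.1 hy.2)
    fun_prop
  suffices h : ∀ t ∈ Icc x y, φ t ≤ 0 by
    have hb' : b = 1 - a := by linarith
    have h1 := h (a • x + b • y) ((convex_Icc x y) ⟨le_rfl, hxy.le⟩ ⟨hxy.le, le_rfl⟩ ha.le hb.le hab)
    have h2 : k * (a • x + b • y - x) = b * (g y - g x) := by
      rw [← hky, hb', smul_eq_mul, smul_eq_mul]
      ring
    simp only [hφ] at h1
    rw [h2] at h1
    simp only [smul_eq_mul] at h1 ⊢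
    rw [hb'] at h1 ⊢
    linarith
  obtain ⟨t₀, ht₀, hmax⟩ := isCompact_Icc.exists_isMaxOn ⟨x, ⟨le_rfl, hxy.le⟩⟩ hφc
  have hmax : ∀ s ∈ Icc x y, φ s ≤ φ t₀ := fun s hs => hmax hs
  by_contra! hcon
  obtain ⟨t', ht', hpos'⟩ := hcon
  have hpos : 0 < φ t₀ := hpos'.trans_le (hmax t' ht')
  have hcomp : IsCompact (Icc x y ∩ φ ⁻¹' {φ t₀}) :=
    isCompact_Icc.of_isClosed_subset (hφc.preimage_isClosed_of_isClosed isClosed_Icc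
      isClosed_singleton) inter_subset_left
  obtain ⟨t, ⟨ht, htM⟩, hleast⟩ := hcomp.exists_isLeast ⟨t₀, ht₀, rfl⟩
  have htM : φ t = φ t₀ := htM
  have hφx : φ x = 0 := by simp [hφ]
  have hφy : φ y = 0 := by
    simp only [hφ, hky]
    ring
  have hxt : x < t := lt_of_le_of_ne ht.1 (by rintro rfl; linarith)
  have hty : t < y := lt_of_le_of_ne ht.2 (by rintro rfl; linarith)
  obtain ⟨m, ε, hε, hm⟩ := hsupp t ⟨hx.1.trans_lt hxt, hty.trans_le hy.2⟩
  set τ := min ε (min (t - x) (y - t)) with hτ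
  have hτ0 : 0 < τ := lt_min hε (lt_min (by linarith) (by linarith))
  have hτx : τ ≤ t - x := (min_le_right _ _).trans (min_le_left _ _)
  have hτy : τ ≤ y - t := (min_le_right _ _).trans (min_le_right _ _)
  obtain ⟨h1, h2⟩ := hm τ ⟨hτ0.le, min_le_left _ _⟩
  have h3 := hmax (t + τ) ⟨by linarith, by linarith⟩
  have h4 := hmax (t - τ) ⟨by linarith, by linarith⟩
  have h5 : φ (t - τ) = φ t₀ := by
    refine le_antisymm h4 ?_
    rw [← htM] at h3 ⊢
    simp only [hφ] at h3 ⊢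
    linarith
  have h6 := hleast ⟨⟨by linarith, by linarith⟩, h5⟩
  linarith

lemma exists_smul_of_cross_eq_zero {d e : Plane} (hd : d ≠ 0) (h : cross d e = 0) :
    ∃ c : ℝ, e = c • d := by
  have hd' : ‖d‖ ≠ 0 := norm_ne_zero_iff.2 hd
  refine ⟨inner ℝ d e / ‖d‖ ^ 2, ?_⟩
  have h1 := inner_sq_add_cross_sq d (e - (inner ℝ d e / ‖d‖ ^ 2) • d)
  have h2 : inner ℝ d (e - (inner ℝ d e / ‖d‖ ^ 2) • d) = 0 := by
    rw [inner_sub_right, inner_smul_right, real_inner_self_eq_norm_sq,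
      div_mul_cancel₀ _ (pow_ne_zero 2 hd'), sub_self]
  have h3 : cross d (e - (inner ℝ d e / ‖d‖ ^ 2) • d) = cross d e := by
    simp only [cross, PiLp.sub_apply, PiLp.smul_apply, smul_eq_mul]
    ring
  rw [h2, h3, h] at h1
  have h4 : ‖e - (inner ℝ d e / ‖d‖ ^ 2) • d‖ ^ 2 = 0 := by
    have h5 : ‖d‖ ^ 2 ≠ 0 := pow_ne_zero 2 hd'
    have h6 : ‖d‖ ^ 2 * ‖e - (inner ℝ d e / ‖d‖ ^ 2) • d‖ ^ 2 = 0 := by linarith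
    exact (mul_eq_zero.1 h6).resolve_left h5
  exact sub_eq_zero.1 (norm_eq_zero.1 (pow_eq_zero_iff two_ne_zero |>.1 h4))

lemma exists_smul_of_mem_segment {p q y z : Plane} (hy : y ∈ segment ℝ p q)
    (hz : z ∈ segment ℝ p q) : ∃ c : ℝ, z - y = c • (q - p) := by
  rw [segment_eq_image'] at hy hz
  obtain ⟨a, -, rfl⟩ := hy
  obtain ⟨b, -, rfl⟩ := hz
  exact ⟨b - a, by module⟩

lemma IsGeodesic.image_eq_segment {K : Set Plane} {σ : ℝ → Plane} {l a b : ℝ}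
    (hσ : IsGeodesic K σ l) (hK : IsTame K) (ha : a ∈ Icc 0 l) (hb : b ∈ Icc 0 l) (hab : a < b)
    (hseg : segment ℝ (σ a) (σ b) ⊆ K) : σ '' Icc a b = segment ℝ (σ a) (σ b) := by
  have hba : 0 < b - a := sub_pos.2 hab
  rw [segment_eq_image']
  ext z
  constructor
  · rintro ⟨s, hs, rfl⟩
    refine ⟨(s - a) / (b - a), ⟨div_nonneg (by linarith [hs.1]) hba.le, ?_⟩, ?_⟩
    · rw [div_le_one hba]
      linarith [hs.2]
    · rw [hσ.eq_add_smul_of_segment hK ha hb hab hseg hs, smul_smul, div_eq_mul_inv]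
  · rintro ⟨θ, hθ, rfl⟩
    have hs : a + θ * (b - a) ∈ Icc a b := by
      constructor <;> nlinarith [hθ.1, hθ.2]
    refine ⟨_, hs, ?_⟩
    rw [hσ.eq_add_smul_of_segment hK ha hb hab hseg hs, smul_smul, add_sub_cancel_left,
      mul_assoc, mul_inv_cancel₀ hba.ne', mul_one]

/-- A geodesic that lies on a line is a segment. -/
lemma IsGeodesic.segment_subset_of_cross_eq {K : Set Plane} {σ : ℝ → Plane} {l a b : ℝ}
    (hσ : IsGeodesic K σ l) (hK : IsTame K) (ha : 0 ≤ a) (hb : b ≤ l) (hab : a ≤ b) {d : Plane}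
    (hd : d ≠ 0) (hcross : ∀ s ∈ Icc a b, cross d (σ s) = cross d (σ a)) :
    segment ℝ (σ a) (σ b) ⊆ K := by
  rintro z ⟨r, s, hr, hs, hrs, rfl⟩
  have hcont : ContinuousOn (fun s => inner ℝ d (σ s)) (uIcc a b) := by
    rw [uIcc_of_le hab]
    exact continuousOn_const.inner ((hσ.continuousOn hK).mono (Icc_subset_Icc ha hb))
  have hmem : inner ℝ d (r • σ a + s • σ b) ∈ uIcc (inner ℝ d (σ a)) (inner ℝ d (σ b)) := by
    rw [← segment_eq_uIcc, inner_add_right, inner_smul_right, inner_smul_right]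
    exact ⟨r, s, hr, hs, hrs, rfl⟩
  obtain ⟨t, ht, hti⟩ := intermediate_value_uIcc hcont hmem
  rw [uIcc_of_le hab] at ht
  simp only at hti
  have h1 : cross d (σ t - (r • σ a + s • σ b)) = 0 := by
    have h2 : cross d (σ t - (r • σ a + s • σ b)) =
        cross d (σ t) - (r * cross d (σ a) + s * cross d (σ b)) := by
      simp only [cross, PiLp.sub_apply, PiLp.add_apply, PiLp.smul_apply, smul_eq_mul]
      ring
    rw [h2, hcross t ht, hcross b ⟨hab, le_rfl⟩, ← add_mul, hrs, one_mul, sub_self]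
  obtain ⟨c, hc⟩ := exists_smul_of_cross_eq_zero hd h1
  have h3 : inner ℝ d (σ t - (r • σ a + s • σ b)) = 0 := by rw [inner_sub_right, hti, sub_self]
  rw [hc, inner_smul_right, mul_eq_zero, inner_self_eq_zero] at h3
  rw [h3.resolve_right hd, zero_smul, sub_eq_zero] at hc
  rw [← hc]
  exact hσ.mem t ⟨ha.trans ht.1, ht.2.trans hb⟩

section

variable {K h : Set Plane} {σ : ℝ → Plane} {l : ℝ}

/-- On a part of a geodesic on which the distance to the segment `h` is constant, the directions of
the geodesic are parallel to `h`. -/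
lemma IsGeodesic.cross_eq_zero_of_const (hσ : IsGeodesic K σ l) (hK : IsTame K) (hhK : h ⊆ K)
    {p q : Plane} (hh : h = segment ℝ p q) {s ε c : ℝ} {b : Plane} (hs : 0 ≤ s) (hε : 0 < ε)
    (hsl : s + ε ≤ l) (hb : ‖b‖ = 1) (hσb : ∀ τ ∈ Icc 0 ε, σ (s + τ) = σ s + τ • b)
    (hdisj : ∀ τ ∈ Icc 0 ε, σ (s + τ) ∉ h)
    (hconst : ∀ τ ∈ Icc 0 ε, geodDistTo K h (σ (s + τ)) = c) : cross (q - p) b = 0 := by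
  have hc : IsCompact h := by rw [hh]; exact isCompact_segment p q
  have hne : h.Nonempty := ⟨p, by rw [hh]; exact left_mem_segment _ _ _⟩
  have hconv : Convex ℝ h := by rw [hh]; exact convex_segment p q
  -- In the interior of the straight part, both slopes of the distance vanish.
  have key : ∀ r ∈ Ioo 0 ε, ∀ ζ u δ m, IsClosest K h ζ m → ζ 0 = σ (s + r) → ‖u‖ = 1 → 0 < δ →
      (∀ τ ∈ Icc 0 δ, ζ τ = ζ 0 + τ • u) →
      distSlope K (ζ 0) u b = 0 ∧ distSlope K (ζ 0) u (-b) = 0 := by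
    intro r hr ζ u δ m hζ h0 hu hδ hζu
    set ε' := min r (ε - r) with hε'
    have hε'0 : 0 < ε' := lt_min hr.1 (by linarith [hr.2])
    have hε'1 : ε' ≤ r := min_le_left _ _
    have hε'2 : ε' ≤ ε - r := min_le_right _ _
    have hright : ∀ τ ∈ Icc 0 ε', σ (s + r + τ) = σ (s + r) + τ • b := fun τ hτ => by
      rw [add_assoc, hσb _ ⟨by linarith [hτ.1, hr.1], by linarith [hτ.2]⟩,
        hσb r ⟨hr.1.le, hr.2.le⟩]
      module
    have hleft : ∀ τ ∈ Icc 0 ε', σ (s + r - τ) = σ (s + r) + τ • -b := fun τ hτ => by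
      rw [add_sub_assoc, hσb _ ⟨by linarith [hτ.2], by linarith [hτ.1, hr.2]⟩,
        hσb r ⟨hr.1.le, hr.2.le⟩]
      module
    have hb' : ‖-b‖ = 1 := by rwa [norm_neg]
    have hsum := hσ.distSlope_add_nonneg hb' hb hu hε'0 (by linarith) (by linarith) hleft hright
    rw [← h0] at hsum
    have e1 : geodDistTo K h (ζ 0) = c := by rw [h0, hconst r ⟨hr.1.le, hr.2.le⟩]
    have h1 : distSlope K (ζ 0) u b ≤ 0 := by
      have := hζ.le_geodDistTo hK hc hhK hconv hu hb hδ hζu hε'0.le (fun τ hτ => by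
        rw [h0, ← hright τ hτ]
        exact hσ.mem _ ⟨by linarith [hτ.1, hr.1], by linarith [hτ.2]⟩) (fun τ hτ => by
        rw [h0, ← hright τ hτ, add_assoc]
        exact hdisj _ ⟨by linarith [hτ.1, hr.1], by linarith [hτ.2]⟩)
      have e2 : geodDistTo K h (ζ 0 + ε' • b) = c := by
        rw [h0, ← hright ε' ⟨hε'0.le, le_rfl⟩, add_assoc,
          hconst _ ⟨by linarith [hr.1], by linarith⟩]
      rw [e1, e2] at this
      nlinarith
    have h2 : distSlope K (ζ 0) u (-b) ≤ 0 := by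
      have := hζ.le_geodDistTo hK hc hhK hconv hu hb' hδ hζu hε'0.le (fun τ hτ => by
        rw [h0, ← hleft τ hτ]
        exact hσ.mem _ ⟨by linarith [hτ.2], by linarith [hτ.1, hr.2]⟩) (fun τ hτ => by
        rw [h0, ← hleft τ hτ, add_sub_assoc]
        exact hdisj _ ⟨by linarith [hτ.2], by linarith [hτ.1, hr.2]⟩)
      have e2 : geodDistTo K h (ζ 0 + ε' • -b) = c := by
        rw [h0, ← hleft ε' ⟨hε'0.le, le_rfl⟩, add_sub_assoc,
          hconst _ ⟨by linarith, by linarith [hr.2]⟩]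
      rw [e1, e2] at this
      nlinarith
    constructor <;> linarith
  have hmem : ∀ τ ∈ Icc 0 ε, σ (s + τ) ∈ K := fun τ hτ =>
    hσ.mem _ ⟨by linarith [hτ.1], by linarith [hτ.2]⟩
  have i1 : ε / 3 ∈ Icc 0 ε := ⟨by linarith, by linarith⟩
  have i2 : 2 * ε / 3 ∈ Icc 0 ε := ⟨by linarith, by linarith⟩
  obtain ⟨ζ₁, u₁, δ₁, hζ₁, h0₁, hu₁, hδ₁, -, hζu₁⟩ :=
    hK.exists_isClosest hc hne hhK (hmem _ i1) (hdisj _ i1)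
  obtain ⟨ζ₂, u₂, δ₂, hζ₂, h0₂, hu₂, hδ₂, -, hζu₂⟩ :=
    hK.exists_isClosest hc hne hhK (hmem _ i2) (hdisj _ i2)
  have hsub : segment ℝ (ζ₁ 0) (ζ₂ 0) ⊆ (fun τ => σ (s + τ)) '' Icc 0 ε := by
    rw [h0₁, h0₂, hσb _ i1, hσb _ i2]
    rintro _ ⟨r, t, hr, ht, hrt, rfl⟩
    have hi : r * (ε / 3) + t * (2 * ε / 3) ∈ Icc 0 ε := (convex_Icc 0 ε) i1 i2 hr ht hrt
    refine ⟨_, hi, ?_⟩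
    have hx : σ s = (r + t) • σ s := by rw [hrt, one_smul]
    simp only
    rw [hσb _ hi]
    conv_lhs => rw [hx]
    module
  obtain ⟨y₁, hy₁, y₂, hy₂, hy, hcr⟩ := (hζ₁.distSlope_add_le hζ₂ hK hhK hconv (w := b)
    (L := ε / 3) (lt_min hδ₁ hδ₂) hu₁ hu₂
    (fun τ hτ => hζu₁ τ ⟨hτ.1, hτ.2.trans (min_le_left _ _)⟩)
    (fun τ hτ => hζu₂ τ ⟨hτ.1, hτ.2.trans (min_le_right _ _)⟩) hb (by linarith)
    (by rw [h0₁, h0₂, hσb _ i1, hσb _ i2]; module) (fun z hz => by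
      obtain ⟨τ, hτ, rfl⟩ := hsub hz
      exact hmem τ hτ) (fun z hz => by
      obtain ⟨τ, hτ, rfl⟩ := hsub hz
      exact hdisj τ hτ)).2
    (key _ ⟨by linarith, by linarith⟩ ζ₁ u₁ δ₁ _ hζ₁ h0₁ hu₁ hδ₁ hζu₁).1
    (key _ ⟨by linarith, by linarith⟩ ζ₂ u₂ δ₂ _ hζ₂ h0₂ hu₂ hδ₂ hζu₂).2
  rw [hh] at hy₁ hy₂
  obtain ⟨k, hk⟩ := exists_smul_of_mem_segment hy₁ hy₂
  have hk0 : k ≠ 0 := by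
    rintro rfl
    rw [zero_smul, sub_eq_zero] at hk
    exact hy hk.symm
  rw [hk] at hcr
  have h3 : cross b (k • (q - p)) = -(k * cross (q - p) b) := by
    simp only [cross, PiLp.smul_apply, PiLp.sub_apply, smul_eq_mul]
    ring
  rw [h3, neg_eq_zero] at hcr
  exact (mul_eq_zero.1 hcr).resolve_left hk0

/-- A part of a geodesic on which the distance to the segment `h` is constant and positive lies on
a parallel of `h`. -/
lemma IsGeodesic.cross_eq_of_const (hσ : IsGeodesic K σ l) (hK : IsTame K) (hhK : h ⊆ K)
    {p q : Plane} (hh : h = segment ℝ p q) {a b c : ℝ} (ha : 0 ≤ a) (hb : b ≤ l)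
    (hdisj : ∀ t ∈ Icc a b, σ t ∉ h) (hconst : ∀ t ∈ Icc a b, geodDistTo K h (σ t) = c) :
    ∀ s ∈ Icc a b, cross (q - p) (σ s) = cross (q - p) (σ a) := by
  have hcont : ContinuousOn (fun t => cross (q - p) (σ t)) (Icc a b) := by
    have h1 := (hσ.continuousOn hK).mono (Icc_subset_Icc ha hb)
    simp only [cross]
    fun_prop
  have hcl : IsClosed ({t | cross (q - p) (σ t) = cross (q - p) (σ a)} ∩ Icc a b) := by
    have := hcont.preimage_isClosed_of_isClosed isClosed_Icc
      (isClosed_singleton (x := cross (q - p) (σ a)))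
    rw [inter_comm]
    exact this
  refine fun s hs => hcl.Icc_subset_of_forall_exists_gt rfl ?_ hs
  rintro t ⟨ht, htI⟩ y hy
  have ht : cross (q - p) (σ t) = cross (q - p) (σ a) := ht
  obtain ⟨e, he, ε, hε, hεl, hσe⟩ := hσ.exists_direction hK (a := t)
    ⟨ha.trans htI.1, htI.2.trans_le hb⟩
  set δ := min ε (min (b - t) (y - t)) with hδ
  have hy' : 0 < y - t := sub_pos.2 hy
  have hδ0 : 0 < δ := lt_min hε (lt_min (by linarith [htI.2]) hy')
  have hδε : δ ≤ ε := min_le_left _ _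
  have hδb : δ ≤ b - t := (min_le_right _ _).trans (min_le_left _ _)
  have hδy : δ ≤ y - t := (min_le_right _ _).trans (min_le_right _ _)
  have hcr := hσ.cross_eq_zero_of_const hK hhK hh (ha.trans htI.1) hδ0 (by linarith) he
    (fun τ hτ => hσe τ ⟨hτ.1, hτ.2.trans hδε⟩)
    (fun τ hτ => hdisj _ ⟨by linarith [hτ.1, htI.1], by linarith [hτ.2]⟩)
    (fun τ hτ => hconst _ ⟨by linarith [hτ.1, htI.1], by linarith [hτ.2]⟩)
  refine ⟨t + δ, ?_, by linarith, by linarith⟩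
  change cross (q - p) (σ (t + δ)) = cross (q - p) (σ a)
  rw [hσe δ ⟨hδ0.le, hδε⟩, ← ht]
  have h1 : cross (q - p) (σ t + δ • e) = cross (q - p) (σ t) + δ * cross (q - p) e := by
    simp only [cross, PiLp.add_apply, PiLp.smul_apply, PiLp.sub_apply, smul_eq_mul]
    ring
  rw [h1, hcr, mul_zero, add_zero]

end

section

variable {K H H' : Set Plane} {p q : Plane}

/-- Outside a part `H` that is separated from the rest of `K` by a segment, the distance to `H` is
the distance to the segment. -/
lemma IsTame.geodDistTo_eq_of_notMem (hK : IsTame K) (hH : IsCompact H) (hH' : IsClosed H')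
    (hKH : K = H ∪ H') (hHH' : H ∩ H' = segment ℝ p q) {x : Plane} (hx : x ∈ K) (hxH : x ∉ H) :
    geodDistTo K H x = geodDistTo K (segment ℝ p q) x := by
  have hHK : H ⊆ K := by rw [hKH]; exact subset_union_left
  have hhH : segment ℝ p q ⊆ H := by rw [← hHH']; exact inter_subset_left
  have hp : p ∈ segment ℝ p q := left_mem_segment _ _ _
  have hc := isCompact_segment p q
  obtain ⟨σ, -, -, hσ, h0, -⟩ := hK.exists_isClosest hH ⟨p, hhH hp⟩ hHK hx hxH
  set l := geodDistTo K H x with hl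
  have hpos := hσ.pos
  have hend : σ l ∈ H' := by
    have hcw : ContinuousWithinAt σ (Ico 0 l) l :=
      ((hσ.geo.continuousOn hK) l ⟨hpos.le, le_rfl⟩).mono Ico_subset_Icc_self
    have h1 := hcw.mem_closure (t := H') (by
      rw [closure_Ico hpos.ne]
      exact ⟨hpos.le, le_rfl⟩) (fun s hs => by
      have h2 := hσ.geo.mem s ⟨hs.1, hs.2.le⟩
      rw [hKH] at h2
      exact h2.resolve_left (hσ.notMem hs))
    rwa [hH'.closure_eq] at h1
  have hmem : σ l ∈ segment ℝ p q := by
    rw [← hHH']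
    exact ⟨hσ.mem, hend⟩
  refine le_antisymm ?_ ?_
  · obtain ⟨y, hy, h1, -⟩ := hK.exists_geodDistTo_eq hc ⟨p, hp⟩ (hhH.trans hHK) hx
    rw [h1]
    exact hK.geodDistTo_le hH hHK hx (hhH hy)
  · have h1 := hK.geodDistTo_le hc (hhH.trans hHK) hx hmem
    rwa [← h0, hσ.geo.dist_eq 0 ⟨le_rfl, hpos.le⟩ l ⟨hpos.le, le_rfl⟩, zero_sub, abs_neg,
      abs_of_pos hpos, h0] at h1

/-- The distance to a part `H` that is separated from the rest of `K` by a segment is convex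
along geodesics. -/
lemma IsGeodesic.convexOn_geodDistTo {σ : ℝ → Plane} {l : ℝ} (hσ : IsGeodesic K σ l)
    (hK : IsTame K) (hH : IsCompact H) (hH' : IsClosed H') (hKH : K = H ∪ H')
    (hHH' : H ∩ H' = segment ℝ p q) :
    ConvexOn ℝ (Icc 0 l) (fun s => geodDistTo K H (σ s)) := by
  have hHK : H ⊆ K := by rw [hKH]; exact subset_union_left
  have hhH : segment ℝ p q ⊆ H := by rw [← hHH']; exact inter_subset_left
  have hp : p ∈ segment ℝ p q := left_mem_segment _ _ _
  have hc := isCompact_segment p q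
  refine convexOn_of_local_support (hσ.continuousOn_geodDistTo hK hH ⟨p, hhH hp⟩ hHK) ?_
  intro t ht
  have htK := hσ.mem t ⟨ht.1.le, ht.2.le⟩
  by_cases htH : σ t ∈ H
  · refine ⟨0, 1, one_pos, fun τ _ => ?_⟩
    rw [(hK.geodDistTo_eq_zero_iff hH ⟨p, hhH hp⟩ hHK htK).2 htH, zero_mul, add_zero, sub_zero]
    exact ⟨geodDistTo_nonneg _ _ _, geodDistTo_nonneg _ _ _⟩
  obtain ⟨ρ, hρ, hball⟩ := Metric.isOpen_iff.1 hH.isClosed.isOpen_compl _ htH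
  obtain ⟨b, hb, ε₂, hε₂, hle₂, hσb⟩ := hσ.exists_direction hK (a := t) ⟨ht.1.le, ht.2⟩
  obtain ⟨a, ha, ε₁, hε₁, hle₁, hσa⟩ := hσ.exists_direction_left hK (a := t) ⟨ht.1, ht.2.le⟩
  obtain ⟨ζ, u, δ, hζ, h0, hu, hδ, -, hζu⟩ :=
    hK.exists_isClosest hc ⟨p, hp⟩ (hhH.trans hHK) htK (fun h => htH (hhH h))
  set ε := min (min ε₁ ε₂) (ρ / 2) with hε
  have hε0 : 0 < ε := by positivity
  have h1 : ε ≤ ε₁ := (min_le_left _ _).trans (min_le_left _ _)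
  have h2 : ε ≤ ε₂ := (min_le_left _ _).trans (min_le_right _ _)
  have h3 : ε < ρ := (min_le_right _ _).trans_lt (by linarith)
  have hnear : ∀ e : Plane, ‖e‖ = 1 → ∀ τ ∈ Icc 0 ε, σ t + τ • e ∉ H := fun e he τ hτ => by
    refine hball ?_
    rw [Metric.mem_ball, dist_eq_norm, add_sub_cancel_left, norm_smul, he, mul_one,
      Real.norm_of_nonneg hτ.1]
    exact hτ.2.trans_lt h3
  have hside : ∀ e : Plane, ‖e‖ = 1 → (∀ τ ∈ Icc 0 ε, σ t + τ • e ∈ K) → ∀ τ ∈ Icc 0 ε,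
      geodDistTo K H (σ t) + distSlope K (σ t) u e * τ ≤ geodDistTo K H (σ t + τ • e) := by
    intro e he heK τ hτ
    have h4 := hζ.le_geodDistTo hK hc (hhH.trans hHK) (convex_segment p q) hu he hδ hζu hτ.1
      (fun r hr => by
        rw [h0]
        exact heK r ⟨hr.1, hr.2.trans hτ.2⟩) (fun r hr hmem => by
        rw [h0] at hmem
        exact hnear e he r ⟨hr.1, hr.2.trans hτ.2⟩ (hhH hmem))
    rwa [h0, ← hK.geodDistTo_eq_of_notMem hH hH' hKH hHH' htK htH,
      ← hK.geodDistTo_eq_of_notMem hH hH' hKH hHH' (heK τ hτ) (hnear e he τ hτ)] at h4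
  have hsum := hσ.distSlope_add_nonneg ha hb hu hε0 (h1.trans hle₁) (by linarith)
    (fun τ hτ => hσa τ ⟨hτ.1, hτ.2.trans h1⟩) (fun τ hτ => hσb τ ⟨hτ.1, hτ.2.trans h2⟩)
  refine ⟨distSlope K (σ t) u b, ε, hε0, fun τ hτ => ⟨?_, ?_⟩⟩
  · rw [hσb τ ⟨hτ.1, hτ.2.trans h2⟩]
    refine hside b hb (fun r hr => ?_) τ hτ
    rw [← hσb r ⟨hr.1, hr.2.trans h2⟩]
    exact hσ.mem _ ⟨by linarith [hr.1, ht.1], by linarith [hr.2]⟩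
  · rw [hσa τ ⟨hτ.1, hτ.2.trans h1⟩]
    have h4 := hside a ha (fun r hr => by
      rw [← hσa r ⟨hr.1, hr.2.trans h1⟩]
      exact hσ.mem _ ⟨by linarith [hr.2], by linarith [hr.1, ht.2]⟩) τ hτ
    nlinarith [hτ.1]

/-- The points of a geodesic with both ends outside `H` that are closest to `H` form a single point
or a segment parallel to the segment that separates `H`. -/
lemma IsGeodesic.image_argmin {σ : ℝ → Plane} {l : ℝ} (hσ : IsGeodesic K σ l) (hl : 0 ≤ l)
    (hK : IsTame K) (hH : IsCompact H) (hH' : IsClosed H') (hKH : K = H ∪ H')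
    (hHH' : H ∩ H' = segment ℝ p q) (hpq : p ≠ q) (h0 : σ 0 ∉ H) (hlH : σ l ∉ H) {T : Set ℝ}
    (hT : T = {t | t ∈ Icc 0 l ∧ ∀ s ∈ Icc 0 l, geodDistTo K H (σ t) ≤ geodDistTo K H (σ s)}) :
    (∃ u, σ '' T = {u}) ∨
      ∃ u v, u ≠ v ∧ σ '' T = segment ℝ u v ∧ ∃ c : ℝ, v - u = c • (q - p) := by
  have hHK : H ⊆ K := by rw [hKH]; exact subset_union_left
  have hhH : segment ℝ p q ⊆ H := by rw [← hHH']; exact inter_subset_left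
  have hp : p ∈ segment ℝ p q := left_mem_segment _ _ _
  set g : ℝ → ℝ := fun s => geodDistTo K H (σ s) with hg
  have hcont : ContinuousOn g (Icc 0 l) := hσ.continuousOn_geodDistTo hK hH ⟨p, hhH hp⟩ hHK
  have hconv : ConvexOn ℝ (Icc 0 l) g := hσ.convexOn_geodDistTo hK hH hH' hKH hHH'
  obtain ⟨t₀, ht₀, hmin⟩ := isCompact_Icc.exists_isMinOn ⟨0, ⟨le_rfl, hl⟩⟩ hcont
  have hTeq : T = Icc 0 l ∩ g ⁻¹' Iic (g t₀) := by
    rw [hT]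
    ext t
    constructor
    · exact fun ht => ⟨ht.1, ht.2 t₀ ht₀⟩
    · exact fun ht => ⟨ht.1, fun s hs => le_trans ht.2 (hmin hs)⟩
  have hTc : IsCompact T := by
    rw [hTeq]
    exact isCompact_Icc.of_isClosed_subset (hcont.preimage_isClosed_of_isClosed isClosed_Icc
      isClosed_Iic) inter_subset_left
  have hTne : T.Nonempty := ⟨t₀, by rw [hTeq]; exact ⟨ht₀, le_refl (g t₀)⟩⟩
  obtain ⟨a, haT, ha⟩ := hTc.exists_isLeast hTne
  obtain ⟨b, hbT, hb⟩ := hTc.exists_isGreatest hTne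
  have hTab : T = Icc a b := by
    refine Subset.antisymm (fun t ht => ⟨ha ht, hb ht⟩) fun t ht => ?_
    rw [hTeq] at haT hbT ⊢
    exact ⟨⟨haT.1.1.trans ht.1, ht.2.trans hbT.1.2⟩,
      (hconv.le_max_of_mem_Icc haT.1 hbT.1 ht).trans (max_le haT.2 hbT.2)⟩
  have haI : a ∈ Icc 0 l := by rw [hTeq] at haT; exact haT.1
  have hbI : b ∈ Icc 0 l := by rw [hTeq] at hbT; exact hbT.1
  have hval : ∀ t ∈ Icc a b, g t = g t₀ := by
    intro t ht
    rw [← hTab, hTeq] at ht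
    exact le_antisymm ht.2 (hmin ht.1)
  rcases (ha hbT).eq_or_lt with hab | hab
  · left
    exact ⟨σ a, by rw [hTab, ← hab, Icc_self, image_singleton]⟩
  right
  have hne : σ a ≠ σ b := fun h => hab.ne (hσ.injOn haI hbI h)
  have hzero : ∀ t ∈ Icc 0 l, g t = 0 ↔ σ t ∈ H := fun t ht =>
    hK.geodDistTo_eq_zero_iff hH ⟨p, hhH hp⟩ hHK (hσ.mem t ht)
  by_cases hc : g t₀ = 0
  · -- The geodesic enters and leaves `H` through the separating segment.
    have hout : ∀ t ∈ Icc 0 l, t ∉ Icc a b → σ t ∈ H' := by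
      intro t ht htab
      have h1 := hσ.mem t ht
      rw [hKH] at h1
      refine h1.resolve_left fun h2 => htab ?_
      rw [← hTab, hTeq]
      refine ⟨ht, ?_⟩
      change g t ≤ g t₀
      rw [(hzero t ht).2 h2, hc]
    have hinH : ∀ t ∈ Icc a b, σ t ∈ H := fun t ht =>
      (hzero t ⟨haI.1.trans ht.1, ht.2.trans hbI.2⟩).1 ((hval t ht).trans hc)
    have ha0 : 0 < a := lt_of_le_of_ne haI.1 (by
      rintro rfl
      exact h0 (hinH 0 ⟨le_rfl, hab.le⟩))
    have hbl : b < l := lt_of_le_of_ne hbI.2 (by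
      rintro rfl
      exact hlH (hinH b ⟨hab.le, le_rfl⟩))
    have haH' : σ a ∈ H' := by
      have hcw : ContinuousWithinAt σ (Ico 0 a) a := ((hσ.continuousOn hK) a haI).mono
        (Ico_subset_Icc_self.trans (Icc_subset_Icc_right haI.2))
      have h1 := hcw.mem_closure (t := H') (by
        rw [closure_Ico ha0.ne]
        exact ⟨ha0.le, le_rfl⟩) (fun s hs => hout s ⟨hs.1, hs.2.le.trans haI.2⟩ fun h =>
          absurd h.1 (not_le.2 hs.2))
      rwa [hH'.closure_eq] at h1
    have hbH' : σ b ∈ H' := by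
      have hcw : ContinuousWithinAt σ (Ioc b l) b := ((hσ.continuousOn hK) b hbI).mono
        (Ioc_subset_Icc_self.trans (Icc_subset_Icc_left hbI.1))
      have h1 := hcw.mem_closure (t := H') (by
        rw [closure_Ioc hbl.ne]
        exact ⟨le_rfl, hbl.le⟩) (fun s hs => hout s ⟨hbI.1.trans hs.1.le, hs.2⟩ fun h =>
          absurd h.2 (not_le.2 hs.1))
      rwa [hH'.closure_eq] at h1
    have ha' : σ a ∈ segment ℝ p q := by
      rw [← hHH']
      exact ⟨hinH a ⟨le_rfl, hab.le⟩, haH'⟩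
    have hb' : σ b ∈ segment ℝ p q := by
      rw [← hHH']
      exact ⟨hinH b ⟨hab.le, le_rfl⟩, hbH'⟩
    refine ⟨σ a, σ b, hne, ?_, exists_smul_of_mem_segment ha' hb'⟩
    rw [hTab]
    exact hσ.image_eq_segment hK haI hbI hab
      (((convex_segment p q).segment_subset ha' hb').trans (hhH.trans hHK))
  · have hnot : ∀ t ∈ Icc a b, σ t ∉ H := fun t ht h => hc
      ((hval t ht).symm.trans ((hzero t ⟨haI.1.trans ht.1, ht.2.trans hbI.2⟩).2 h))
    have hcr := hσ.cross_eq_of_const hK (hhH.trans hHK) rfl haI.1 hbI.2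
      (fun t ht h => hnot t ht (hhH h)) (c := g t₀) (fun t ht => by
        rw [← hval t ht, ← hK.geodDistTo_eq_of_notMem hH hH' hKH hHH'
          (hσ.mem t ⟨haI.1.trans ht.1, ht.2.trans hbI.2⟩) (hnot t ht)])
    have hd : q - p ≠ 0 := sub_ne_zero.2 hpq.symm
    refine ⟨σ a, σ b, hne, ?_, exists_smul_of_cross_eq_zero hd ?_⟩
    · rw [hTab]
      exact hσ.image_eq_segment hK haI hbI hab
        (hσ.segment_subset_of_cross_eq hK haI.1 hbI.2 hab.le hd hcr)
    · have h1 : cross (q - p) (σ b - σ a) = cross (q - p) (σ b) - cross (q - p) (σ a) := by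
        simp only [cross, PiLp.sub_apply]
        ring
      rw [h1, hcr b ⟨hab.le, le_rfl⟩, sub_self]

end

/-! ### Shortest paths -/

/-- A shortest path is the image of a geodesic parametrized by arc length. -/
lemma IsShortestPath.exists_isGeodesic {K : Set Plane} (hK : IsTame K) {a b : Plane} (ha : a ∈ K)
    (hb : b ∈ K) {γ : Path a b} (hγ : IsShortestPath K γ) :
    ∃ σ, IsGeodesic K σ (geodDist K a b) ∧ σ 0 = a ∧ σ (geodDist K a b) = b ∧
      range γ = σ '' Icc 0 (geodDist K a b) := by
  obtain ⟨hγK, hγmin⟩ := hγ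
  set D := geodDist K a b with hD
  have hmem := fun t => extend_mem hγK t
  have hlen : pathLength γ ≤ geodEDist K a b := le_iInf₂ hγmin
  set ρ : ℝ → ℝ := fun t => geodDist K a (γ.extend t) with hρ
  have hsum : ∀ s t : ℝ, 0 ≤ s → s ≤ t → t ≤ 1 →
      geodDist K (γ.extend s) (γ.extend t) = ρ t - ρ s := by
    intro s t h0 hst h1
    have h2 := (geodEDist_add_add_le hγK h0 hst h1).trans hlen
    rw [← hK.ofReal_geodDist ha (hmem s), ← hK.ofReal_geodDist (hmem s) (hmem t),
      ← hK.ofReal_geodDist (hmem t) hb, ← hK.ofReal_geodDist ha hb,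
      ← ENNReal.ofReal_add (geodDist_nonneg _ _ _) (geodDist_nonneg _ _ _),
      ← ENNReal.ofReal_add (add_nonneg (geodDist_nonneg _ _ _) (geodDist_nonneg _ _ _))
        (geodDist_nonneg _ _ _), ENNReal.ofReal_le_ofReal_iff (geodDist_nonneg _ _ _)] at h2
    have h3 := hK.geodDist_triangle ha (hmem s) (hmem t)
    have h4 := hK.geodDist_triangle ha (hmem t) hb
    simp only [hρ]
    linarith
  have habs : ∀ s ∈ Icc (0 : ℝ) 1, ∀ t ∈ Icc (0 : ℝ) 1,
      geodDist K (γ.extend s) (γ.extend t) = |ρ s - ρ t| := by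
    intro s hs t ht
    have h := geodDist_nonneg K (γ.extend s) (γ.extend t)
    rcases le_total s t with hst | hst
    · rw [hsum s t hs.1 hst ht.2] at h ⊢
      rw [abs_sub_comm, abs_of_nonneg h]
    · rw [geodDist_comm, hsum t s ht.1 hst hs.2] at h ⊢
      rw [abs_of_nonneg h]
  have hρc : ContinuousOn ρ (Icc 0 1) :=
    (hK.continuousOn_geodDist_left ha).comp γ.continuous_extend.continuousOn fun t _ => hmem t
  have hρ0 : ρ 0 = 0 := by
    simp only [hρ, γ.extend_zero]
    exact geodDist_self ha
  have hρ1 : ρ 1 = D := by simp only [hρ, γ.extend_one, hD]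
  have hivt : ∀ r ∈ Icc 0 D, ∃ t ∈ Icc (0 : ℝ) 1, ρ t = r := fun r hr => by
    have := intermediate_value_Icc zero_le_one hρc
    rw [hρ0, hρ1] at this
    exact this hr
  choose! T hT hρT using hivt
  have hρD : ∀ t ∈ Icc (0 : ℝ) 1, ρ t ∈ Icc 0 D := fun t ht => by
    have h1 := hsum t 1 ht.1 ht.2 le_rfl
    have h2 := geodDist_nonneg K (γ.extend t) (γ.extend 1)
    rw [h1, hρ1] at h2
    exact ⟨geodDist_nonneg _ _ _, by linarith⟩
  -- A parameter is determined by its distance to the starting point, up to constant parts of `γ`.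
  have hTρ : ∀ t ∈ Icc (0 : ℝ) 1, γ.extend (T (ρ t)) = γ.extend t := fun t ht => by
    have h1 := habs _ (hT _ (hρD t ht)) t ht
    rw [hρT _ (hρD t ht), sub_self, abs_zero] at h1
    have h2 := hK.dist_le_geodDist (hmem (T (ρ t))) (hmem t)
    rw [h1] at h2
    exact dist_le_zero.1 h2
  refine ⟨fun r => γ.extend (T r), ⟨fun r _ => hmem _, fun r hr s hs => ?_⟩, ?_, ?_, ?_⟩
  · rw [habs _ (hT r hr) _ (hT s hs), hρT r hr, hρT s hs]
  · have := hTρ 0 ⟨le_rfl, zero_le_one⟩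
    rwa [hρ0, γ.extend_zero] at this
  · have := hTρ 1 ⟨zero_le_one, le_rfl⟩
    rwa [hρ1, γ.extend_one] at this
  · ext z
    constructor
    · rintro ⟨t, rfl⟩
      refine ⟨ρ t, hρD _ t.2, ?_⟩
      simp only
      rw [hTρ _ t.2]
      exact γ.extend_apply t.2
    · rintro ⟨r, -, rfl⟩
      rw [← γ.extend_range]
      exact mem_range_self _

theorem lemma1 {n : ℕ} [NeZero n] (P : SimplePolygon n) (H : HalfPolygon P) :
    GeodesicallyConvexOn P.region (geodDistTo P.region H.region) ∧
    ∀ a ∈ P.region \ H.region, ∀ b ∈ P.region \ H.region, ∀ γ : Path a b,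
      IsShortestPath P.region γ →
      (∃ u, {x ∈ range γ | IsMinOn (geodDistTo P.region H.region) (range γ) x} = {u}) ∨
      (∃ u v, u ≠ v ∧
        {x ∈ range γ | IsMinOn (geodDistTo P.region H.region) (range γ) x} = segment ℝ u v ∧
        ∃ c : ℝ, v - u = c • (H.q - H.p)) := by
  have hK := P.isTame_region
  obtain ⟨hH, H', hH', hKH, hHH'⟩ := H.exists_complement
  constructor
  · intro a ha b hb γ hγ
    obtain ⟨σ, hσ, h0, -, hrange⟩ := hγ.exists_isGeodesic hK ha hb
    refine ⟨_, hσ.convexOn_geodDistTo hK hH hH' hKH hHH', fun x hx => ?_⟩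
    rw [hrange] at hx
    obtain ⟨r, hr, rfl⟩ := hx
    have h1 : geodDist P.region a (σ r) = r := by
      rw [← h0, hσ.dist_eq 0 ⟨le_rfl, hr.1.trans hr.2⟩ r hr, zero_sub, abs_neg,
        abs_of_nonneg hr.1]
    rw [h1]
  · intro a ha b hb γ hγ
    obtain ⟨σ, hσ, h0, h1, hrange⟩ := hγ.exists_isGeodesic hK ha.1 hb.1
    have hset : {x ∈ range γ | IsMinOn (geodDistTo P.region H.region) (range γ) x} =
        σ '' {t | t ∈ Icc 0 (geodDist P.region a b) ∧ ∀ s ∈ Icc 0 (geodDist P.region a b),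
          geodDistTo P.region H.region (σ t) ≤ geodDistTo P.region H.region (σ s)} := by
      rw [hrange]
      ext x
      constructor
      · rintro ⟨⟨t, ht, rfl⟩, hmin⟩
        exact ⟨t, ⟨ht, fun s hs => hmin ⟨s, hs, rfl⟩⟩, rfl⟩
      · rintro ⟨t, ⟨ht, hmin⟩, rfl⟩
        refine ⟨⟨t, ht, rfl⟩, ?_⟩
        rintro _ ⟨s, hs, rfl⟩
        exact hmin s hs
    rw [hset]
    exact hσ.image_argmin (geodDist_nonneg _ _ _) hK hH hH' hKH hHH' H.p_ne_q
      (by rw [h0]; exact ha.2) (by rw [h1]; exact hb.2) rfl
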